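/- Let $\mathbb T$ be the unit circle with normalized Lebesgue measure $m$, and let $L^0$ be the space of (classes of a.e. equal) measurable functions $\mathbb T\to\mathbb C$. A Banach function space is a linear subspace $X\subset L^0$ with a complete norm such that (a) if $f\in X$, $g\in L^0$ and $|g|\le|f|$ a.e., then $g\in X$ and $\|g\|_X\le\|f\|_X$; (b) $L^\infty\subset X$; (c) if $f_n,f\in X$ and $0\le f_n\uparrow f$ a.e., then $\|f\|_X=\sup_n\|f_n\|_X$. It is rearrangement invariant (r.i.) if, whenever $f\in X$, $g\in L^0$ and $m\{|f|>\lambda\}=m\{|g|>\lambda\}$ for all $\lambda\ge0$, then $g\in X$ and $\|g\|_X=\|f\|_X$. It has the Fatou property if $f_n\in X$, $f\in L^0$, $0\le f_n\uparrow f$ a.e. and $\sup_n\|f_n\|_X<\infty$ imply $f\in X$ and $\|f\|_X=\sup_n\|f_n\|_X$. For $s>0$ and $\theta\in[0,2\pi)$ put $(D_sf)(e^{i\theta})=f(e^{is\theta})$ if $s\theta\in[0,2\pi)$ and $0$ otherwise; the Boyd indices of an r.i. space $X$ are $$\alpha_X=\lim_{s\to0^+}\frac{\log\|D_{1/s}\|_{X\to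 X}}{\log s},\qquad \beta_X=\lim_{s\to\infty}\frac{\log\|D_{1/s}\|_{X\to X}}{\log s},$$ and they are nontrivial if $\alpha_X,\beta_X\in(0,1)$. Every r.i. Banach function space is contained in $L^1$, and $H[X]=\{f\in X:\widehat f(n)=0\text{ for all }n<0\}$ with the norm of $X$. For $f\in L^1$ let $Pf=\frac12\bigl(f+i\tilde f+\widehat f(0)\bigr)$ be its Riesz projection, where the conjugate function $\tilde f$ is the a.e. radial limit of the conjugate Poisson integral of $f$. Let $M(X,Y)=\{a\in L^0: ag\in Y\text{ for all }g\in X\}$ and $\|a\|_{M(X,Y)}=\sup_{\|g\|_X\le1}\|ag\|_Y$. For $a\in L^0$, the Toeplitz operator $T_a:f\mapsto P(af)$ is called bounded from $H[X]$ to $H[Y]$ if $af\in L^1$ and $P(af)\in H[Y]$ for every $f\in H[X]$, and $\|P(af)\|_Y\le C\|f\|_X$ with a constant $C<\infty$ independent of $f$; the least such $C$ is $\|T_a\|_{H[X]\to H[Y]}$. **Theorem.** Let $X,Y$ be r.i. Banach function spaces on $\mathbb T$ such that $X\subset Y$, and suppose that $Y$ has nontrivial Boyd indices and the Fatou property. Then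 $P$ is bounded on $Y$ and, for every $a\in L^0$, the Toeplitz operator $T_a:f\mapsto P(af)$ is bounded from $H[X]$ to $H[Y]$ if and only if $a\in M(X,Y)$, and in this case $$\|a\|_{M(X,Y)}\le\|T_a\|_{H[X]\to H[Y]}\le\|P\|_{Y\to Y}\,\|a\|_{M(X,Y)}.$$ -/

import Mathlib

open MeasureTheory Filter Topology
open scoped ENNReal NNReal Real ComplexOrder

noncomputable section

namespace ToeplitzRI

/-- The unit circle, written additively: `θ` modulo `2π` stands for the point `e^{iθ}`. -/
abbrev Torus : Type := AddCircle (2 * π)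

instance instFactTwoPi : Fact (0 < 2 * π) := ⟨Real.two_pi_pos⟩

/-- Normalized Lebesgue measure on the circle. -/
abbrev m : Measure Torus := AddCircle.haarAddCircle

/-- `L⁰`: complex-valued measurable functions on the circle modulo equality a.e. -/
abbrev L0 : Type := Torus →ₘ[m] ℂ

/-- `0 ≤ f_n ↑ f` a.e. (`≤` on `ℂ` is the order in which `0 ≤ z` means that `z` is real and
nonnegative). -/
def IncreasesTo (u : ℕ → L0) (f : L0) : Prop :=
  ∀ᵐ t ∂m, (∀ n, 0 ≤ u n t) ∧ Monotone (fun n => u n t) ∧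
    Tendsto (fun n => u n t) atTop (𝓝 (f t))

/-- A Banach function space on the circle, given by its norm, which is extended by the value `∞`
to all of `L⁰`; the space itself is `{f | N f < ∞}`. It is a complete normed space, has the ideal
property, contains `L^∞` and has the semi-Fatou property. -/
structure BanachFunctionSpace where
  /-- The norm, with value `∞` exactly off the space. -/
  N : L0 → ℝ≥0∞
  eq_zero_of_norm_eq_zero : ∀ f, N f = 0 → f = 0
  norm_smul : ∀ (c : ℂ) (f : L0), N (c • f) = ‖c‖ₑ * N f
  norm_add_le : ∀ f g, N (f + g) ≤ N f + N g
  complete : ∀ u : ℕ → L0, (∀ n, N (u n) < ∞) →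
    (∀ ε : ℝ≥0∞, 0 < ε → ∃ n₀, ∀ k ≥ n₀, ∀ l ≥ n₀, N (u k - u l) < ε) →
    ∃ f, N f < ∞ ∧ Tendsto (fun n => N (u n - f)) atTop (𝓝 0)
  ideal : ∀ f g : L0, (∀ᵐ t ∂m, ‖g t‖ ≤ ‖f t‖) → N g ≤ N f
  norm_lt_top_of_memLp_top : ∀ f : L0, MemLp f ∞ m → N f < ∞
  semiFatou : ∀ (u : ℕ → L0) (f : L0), (∀ n, N (u n) < ∞) → N f < ∞ →
    IncreasesTo u f → N f = ⨆ n, N (u n)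

namespace BanachFunctionSpace

/-- The underlying set of functions. -/
def space (X : BanachFunctionSpace) : Set L0 := {f | X.N f < ∞}

/-- The Fatou property. -/
def HasFatou (X : BanachFunctionSpace) : Prop :=
  ∀ (u : ℕ → L0) (f : L0), (∀ n, u n ∈ X.space) → IncreasesTo u f → (⨆ n, X.N (u n)) < ∞ →
    f ∈ X.space ∧ X.N f = ⨆ n, X.N (u n)

end BanachFunctionSpace

/-- The distribution function `λ ↦ m {|f| > λ}`. -/
def distribution (f : L0) (lam : ℝ) : ℝ≥0∞ := m {t | lam < ‖f t‖}

def Equimeasurable (f g : L0) : Prop :=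
  ∀ lam : ℝ, 0 ≤ lam → distribution f lam = distribution g lam

/-- Rearrangement invariance. -/
def BanachFunctionSpace.IsRI (X : BanachFunctionSpace) : Prop :=
  ∀ f g : L0, Equimeasurable f g → f ∈ X.space → g ∈ X.space ∧ X.N f = X.N g

/-- The representative in `[0, 2π)` of a point of the circle. -/
def arg (x : Torus) : ℝ := (AddCircle.equivIco (2 * π) 0 x : ℝ)

theorem measurable_arg : Measurable arg :=
  measurable_subtype_coe.comp (AddCircle.measurableEquivIco (2 * π) 0).measurable

/-- `(D_s f)(e^{iθ}) = f(e^{isθ})` if `sθ ∈ [0, 2π)` and `0` otherwise, for `θ ∈ [0, 2π)`. -/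
def dilationFun (s : ℝ) (f : L0) (x : Torus) : ℂ :=
  open Classical in
  if s * arg x ∈ Set.Ico 0 (2 * π) then f ((s * arg x : ℝ) : Torus) else 0

theorem measurable_dilationFun (s : ℝ) (f : L0) : Measurable (dilationFun s f) := by
  have h : Measurable fun x => s * arg x := measurable_arg.const_mul s
  exact Measurable.ite (h measurableSet_Ico)
    (f.stronglyMeasurable.measurable.comp (AddCircle.measurable_mk'.comp h)) measurable_const

/-- The dilation operator `D_s` on `L⁰`. -/
def dilation (s : ℝ) (f : L0) : L0 :=
  AEEqFun.mk (dilationFun s f) (measurable_dilationFun s f).aestronglyMeasurable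

namespace BanachFunctionSpace

/-- The operator norm of `D_s` on `X`. -/
def dilationNorm (X : BanachFunctionSpace) (s : ℝ) : ℝ≥0∞ :=
  ⨆ (f : L0) (_ : X.N f ≤ 1), X.N (dilation s f)

/-- `α` is the lower Boyd index of `X`. -/
def IsLowerBoydIndex (X : BanachFunctionSpace) (α : ℝ) : Prop :=
  Tendsto (fun s : ℝ => Real.log (X.dilationNorm (1 / s)).toReal / Real.log s) (𝓝[>] 0) (𝓝 α)

/-- `β` is the upper Boyd index of `X`. -/
def IsUpperBoydIndex (X : BanachFunctionSpace) (β : ℝ) : Prop :=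
  Tendsto (fun s : ℝ => Real.log (X.dilationNorm (1 / s)).toReal / Real.log s) atTop (𝓝 β)

/-- Both Boyd indices lie in `(0, 1)`. -/
def HasNontrivialBoydIndices (X : BanachFunctionSpace) : Prop :=
  ∃ α β : ℝ, X.IsLowerBoydIndex α ∧ X.IsUpperBoydIndex β ∧
    α ∈ Set.Ioo (0 : ℝ) 1 ∧ β ∈ Set.Ioo (0 : ℝ) 1

/-- The Hardy space `H[X]` of those `f ∈ X` (hence in `L¹`, when `X` is rearrangement invariant)
whose Fourier coefficients of negative index vanish. -/
def hardy (X : BanachFunctionSpace) : Set L0 :=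
  {f | f ∈ X.space ∧ ∀ n : ℤ, n < 0 → fourierCoeff f n = 0}

end BanachFunctionSpace

/-- The space `M(X, Y)` of pointwise multipliers. -/
def multipliers (X Y : BanachFunctionSpace) : Set L0 :=
  {a | ∀ g ∈ X.space, a * g ∈ Y.space}

/-- The norm of `M(X, Y)`. -/
def multiplierNorm (X Y : BanachFunctionSpace) (a : L0) : ℝ≥0∞ :=
  ⨆ (g : L0) (_ : X.N g ≤ 1), Y.N (a * g)

/-- The conjugate Poisson kernel `Q_r(θ) = 2 r sin θ / (1 - 2 r cos θ + r²)`, written as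
`Im ((1 + z) / (1 - z))` with `z = r e^{iθ}`. -/
def conjPoissonKernel (r : ℝ) (x : Torus) : ℝ :=
  ((1 + (r : ℂ) * fourier 1 x) / (1 - (r : ℂ) * fourier 1 x)).im

/-- The conjugate Poisson integral of `f` at the point `r e^{ix}` of the disc. -/
def conjPoisson (f : L0) (r : ℝ) (x : Torus) : ℂ :=
  ∫ t, (conjPoissonKernel r (x - t) : ℂ) * f t ∂m

/-- `g` is the conjugate function of the integrable function `f`: the radial boundary function of
the conjugate Poisson integral of `f`. -/
def IsConjugateFunction (f g : L0) : Prop :=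
  ∀ᵐ x ∂m, Tendsto (fun r : ℝ => conjPoisson f r x) (𝓝[<] 1) (𝓝 (g x))

/-- `g = P f` for the Riesz projection `P : f ↦ (f + i f~ + f^(0)) / 2`, `f ∈ L¹`, where `f~` is
the conjugate function of `f`. -/
def IsRieszProjection (f g : L0) : Prop :=
  Integrable f m ∧ ∃ h : L0, IsConjugateFunction f h ∧
    g = (1 / 2 : ℂ) • (f + Complex.I • h + AEEqFun.const Torus (fourierCoeff f 0))

/-- `C` bounds the Riesz projection on `Y`. -/
def RieszBoundedBy (Y : BanachFunctionSpace) (C : ℝ≥0∞) : Prop :=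
  ∀ f ∈ Y.space, ∃ g ∈ Y.space, IsRieszProjection f g ∧ Y.N g ≤ C * Y.N f

/-- `‖P‖_{Y → Y}`, the least bound (`∞` if `P` is not bounded on `Y`). -/
def rieszNorm (Y : BanachFunctionSpace) : ℝ≥0∞ := sInf {C | RieszBoundedBy Y C}

/-- `C` bounds the Toeplitz operator `T_a : f ↦ P (a f)` from `H[X]` to `H[Y]`; in particular
`a f ∈ L¹` and `P (a f) ∈ H[Y]` for every `f ∈ H[X]`. -/
def ToeplitzBoundedBy (X Y : BanachFunctionSpace) (a : L0) (C : ℝ≥0∞) : Prop :=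
  ∀ f ∈ X.hardy, ∃ g ∈ Y.hardy, IsRieszProjection (a * f) g ∧ Y.N g ≤ C * X.N f

/-- `T_a` is a bounded operator from `H[X]` to `H[Y]`. -/
def ToeplitzBounded (X Y : BanachFunctionSpace) (a : L0) : Prop :=
  ∃ C : ℝ≥0, ToeplitzBoundedBy X Y a C

/-- `‖T_a‖_{H[X] → H[Y]}`, the least bound (`∞` if `T_a` is not bounded). -/
def toeplitzNorm (X Y : BanachFunctionSpace) (a : L0) : ℝ≥0∞ :=
  sInf {C | ToeplitzBoundedBy X Y a C}

end ToeplitzRI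

end

/-!
By the Herglotz representation, the Cauchy integral of an `L¹` function satisfies a weak type
`(1, 1)` bound and has radial limits almost everywhere, and these limits are the Riesz projection.
Taking the real part of `F ^ (2k)` at the origin, `F` the Herglotz integral of a nonnegative
function, gives M. Riesz's `L^{2k}` bound. Splitting a function at the levels of its decreasing
rearrangement turns the weak `(1, 1)` and `L^{2k}` bounds into a pointwise estimate of the
rearrangement of the Cauchy integral by a sum over dyadic dilations, which is summable in `Y` when
the Boyd indices are nontrivial; so `P` is bounded on `Y`, and `‖T_a‖ ≤ ‖P‖ ‖a‖`.

Conversely `z̄ⁿ P(zⁿ h) → h` in measure for `h ∈ L¹`, so that the Fatou property yields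
`‖a f‖ ≤ ‖T_a‖ ‖f‖` for `f ∈ H[X]`. Outer functions with prescribed modulus extend this to all
`f ∈ X`.
-/

noncomputable section

namespace ToeplitzRI

/-! ### The circle as the boundary of the disc -/

section Fourier

variable {T : ℝ}

lemma norm_fourier_apply (n : ℤ) (x : AddCircle T) : ‖fourier n x‖ = 1 := by
  rw [fourier_apply, Circle.norm_coe]

lemma fourier_one_pow (n : ℕ) (x : AddCircle T) : (fourier 1 x : ℂ) ^ n = fourier n x := by
  rw [fourier_one, fourier_apply, AddCircle.toCircle_zsmul, zpow_natCast, Circle.coe_pow]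

lemma fourier_neg_one_pow (n : ℕ) (x : AddCircle T) :
    (fourier (-1) x : ℂ) ^ n = fourier (-(n : ℤ)) x := by
  rw [fourier_neg, fourier_neg, ← fourier_one_pow, map_pow]

lemma fourier_sub_apply (n : ℤ) (x t : AddCircle T) :
    (fourier n (x - t) : ℂ) = fourier n x * fourier (-n) t := by
  rw [fourier_apply, fourier_apply, fourier_apply, smul_sub, sub_eq_add_neg,
    AddCircle.toCircle_add, Circle.coe_mul, neg_smul]

lemma fourier_mul_fourier_neg (n : ℤ) (x : AddCircle T) :
    (fourier n x : ℂ) * fourier (-n) x = 1 := by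
  rw [← fourier_add, add_neg_cancel, fourier_zero]

lemma norm_mul_fourier {r : ℝ} (hr : 0 ≤ r) (n : ℤ) (x : AddCircle T) :
    ‖(r : ℂ) * fourier n x‖ = r := by
  rw [norm_mul, norm_fourier_apply, mul_one, Complex.norm_real, Real.norm_of_nonneg hr]

lemma mul_fourier_mem_ball {r : ℝ} (hr : r ∈ Set.Ico (0 : ℝ) 1) (n : ℤ) (x : AddCircle T) :
    (r : ℂ) * fourier n x ∈ Metric.ball (0 : ℂ) 1 := by
  rw [mem_ball_zero_iff, norm_mul_fourier hr.1]
  exact hr.2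

lemma continuous_comp_mul_fourier {Φ : ℂ → ℂ} (hΦ : ContinuousOn Φ (Metric.ball 0 1))
    {r : ℝ} (hr : r ∈ Set.Ico (0 : ℝ) 1) :
    Continuous fun x : AddCircle T => Φ (r * fourier 1 x) :=
  hΦ.comp_continuous (continuous_const.mul (fourier 1).continuous)
    fun x => mul_fourier_mem_ball hr 1 x

lemma one_sub_mul_fourier_ne_zero {z : ℂ} (hz : ‖z‖ < 1) (n : ℤ) (t : AddCircle T) :
    1 - z * fourier n t ≠ 0 := by
  intro h
  have hnorm := congrArg norm (sub_eq_zero.1 h)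
  rw [norm_mul, norm_fourier_apply, norm_one, mul_one] at hnorm
  exact hz.ne' hnorm

lemma norm_fourierCoeff_le [Fact (0 < T)] {E : Type*} [NormedAddCommGroup E] [NormedSpace ℂ E]
    (f : AddCircle T → E) (n : ℤ) :
    ‖fourierCoeff f n‖ ≤ ∫ t, ‖f t‖ ∂AddCircle.haarAddCircle :=
  (norm_integral_le_integral_norm _).trans_eq <| by
    simp only [norm_smul, norm_fourier_apply, one_mul]

end Fourier

lemma integral_comp_mul_fourier_eq_circleAverage (Φ : ℂ → ℂ) (r : ℝ) :
    ∫ x, Φ (r * fourier 1 x) ∂m = Real.circleAverage Φ 0 r := by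
  rw [AddCircle.integral_haarAddCircle, Real.circleAverage_def,
    ← AddCircle.intervalIntegral_preimage (2 * π) 0, zero_add]
  congr 1
  refine intervalIntegral.integral_congr fun x _ => congrArg Φ ?_
  rw [fourier_coe_apply, circleMap]
  push_cast
  field_simp
  simp

theorem integral_comp_mul_fourier {Φ : ℂ → ℂ} (hΦ : DifferentiableOn ℂ Φ (Metric.ball 0 1))
    {r : ℝ} (hr : r ∈ Set.Ico (0 : ℝ) 1) : ∫ x, Φ (r * fourier 1 x) ∂m = Φ 0 := by
  rw [integral_comp_mul_fourier_eq_circleAverage]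
  refine (hΦ.mono ?_).diffContOnCl.circleAverage
  rw [abs_of_nonneg hr.1]
  exact Metric.closure_ball_subset_closedBall.trans (Metric.closedBall_subset_ball hr.2)

theorem integral_fourier_mul_comp {Φ : ℂ → ℂ} (hΦ : DifferentiableOn ℂ Φ (Metric.ball 0 1))
    {r : ℝ} (hr : r ∈ Set.Ioo (0 : ℝ) 1) {n : ℕ} (hn : n ≠ 0) :
    ∫ x, fourier n x * Φ (r * fourier 1 x) ∂m = 0 := by
  have h := integral_comp_mul_fourier (Φ := fun z => z ^ n * Φ z)
    ((differentiableOn_id.pow n).mul hΦ) ⟨hr.1.le, hr.2⟩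
  simp only [mul_pow, fourier_one_pow, zero_pow hn, zero_mul, mul_assoc, integral_const_mul] at h
  exact (mul_eq_zero.1 h).resolve_left (pow_ne_zero _ (by exact_mod_cast hr.1.ne'))

/-! ### Cauchy integrals -/

/-- The Cauchy integral `z ↦ ∫ f(t) / (1 - z e^{-it}) dm(t)` of `f`, the analytic function in the
disc whose Taylor coefficients are the Fourier coefficients of `f` of nonnegative index. -/
def cauchyInt (f : Torus → ℂ) (z : ℂ) : ℂ := ∫ t, (1 - z * fourier (-1) t)⁻¹ * f t ∂m

lemma norm_cauchyKernel_le {z : ℂ} (hz : ‖z‖ < 1) (t : Torus) :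
    ‖(1 - z * fourier (-1) t)⁻¹‖ ≤ (1 - ‖z‖)⁻¹ := by
  rw [norm_inv]
  refine inv_anti₀ (by linarith) ?_
  simpa only [norm_mul, norm_fourier_apply, norm_one, mul_one] using
    norm_sub_norm_le (1 : ℂ) (z * fourier (-1) t)

lemma continuous_cauchyKernel {z : ℂ} (hz : ‖z‖ < 1) :
    Continuous fun t : Torus => (1 - z * fourier (-1) t)⁻¹ :=
  (continuous_const.sub (continuous_const.mul (fourier (-1)).continuous)).inv₀
    fun t => one_sub_mul_fourier_ne_zero hz (-1) t

lemma integrable_cauchyKernel_mul {f : Torus → ℂ} (hf : Integrable f m) {z : ℂ}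
    (hz : ‖z‖ < 1) : Integrable (fun t => (1 - z * fourier (-1) t)⁻¹ * f t) m :=
  hf.bdd_mul (continuous_cauchyKernel hz).aestronglyMeasurable
    (Eventually.of_forall fun t => norm_cauchyKernel_le hz t)

theorem hasSum_cauchyInt {f : Torus → ℂ} (hf : Integrable f m) {z : ℂ} (hz : ‖z‖ < 1) :
    HasSum (fun n : ℕ => fourierCoeff f n * z ^ n) (cauchyInt f z) := by
  have hnorm (n : ℕ) (t : Torus) : ‖(z * fourier (-1) t) ^ n‖ = ‖z‖ ^ n := by
    rw [norm_pow, norm_mul, norm_fourier_apply, mul_one]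
  have hgeom : cauchyInt f z = ∫ t, ∑' n : ℕ, (z * fourier (-1) t) ^ n * f t ∂m := by
    refine integral_congr_ae (Eventually.of_forall fun t => ?_)
    have hlt : ‖z * fourier (-1) t‖ < 1 := by rwa [norm_mul, norm_fourier_apply, mul_one]
    simp only [tsum_mul_right, tsum_geometric_of_norm_lt_one hlt]
  have hcoeff (n : ℕ) : fourierCoeff f n * z ^ n = ∫ t, (z * fourier (-1) t) ^ n * f t ∂m := by
    rw [fourierCoeff, mul_comm (integral _ _), ← integral_const_mul]
    simp only [mul_pow, fourier_neg_one_pow, smul_eq_mul, mul_assoc]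
  simp only [hgeom, hcoeff]
  refine hasSum_integral_of_summable_integral_norm (fun n => ?_) ?_
  · exact hf.bdd_mul
      ((continuous_const.mul (fourier (-1)).continuous).pow n).aestronglyMeasurable
      (Eventually.of_forall fun t => (hnorm n t).le)
  · simp only [norm_mul (_ ^ _), hnorm, integral_const_mul]
    exact (summable_geometric_of_lt_one (norm_nonneg _) hz).mul_right _

lemma differentiableOn_tsum_mul_pow {a : ℕ → ℂ} {B : ℝ} (ha : ∀ n, ‖a n‖ ≤ B) :
    DifferentiableOn ℂ (fun z => ∑' n, a n * z ^ n) (Metric.ball 0 1) := by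
  intro z hz
  obtain ⟨R, hzR, hR⟩ := exists_between (mem_ball_zero_iff.1 hz)
  have hR0 : 0 ≤ R := (norm_nonneg z).trans hzR.le
  have hdiff : DifferentiableOn ℂ (fun z => ∑' n, a n * z ^ n) (Metric.ball 0 R) := by
    refine Complex.differentiableOn_tsum_of_summable_norm
      ((summable_geometric_of_lt_one hR0 hR).mul_left B)
      (fun n => by fun_prop) Metric.isOpen_ball fun n w hw => ?_
    rw [norm_mul, norm_pow]
    exact mul_le_mul (ha n) (by gcongr; exact (mem_ball_zero_iff.1 hw).le) (by positivity)
      ((norm_nonneg _).trans (ha n))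
  exact (hdiff.differentiableAt
    (Metric.isOpen_ball.mem_nhds (mem_ball_zero_iff.2 hzR))).differentiableWithinAt

theorem differentiableOn_cauchyInt {f : Torus → ℂ} (hf : Integrable f m) :
    DifferentiableOn ℂ (cauchyInt f) (Metric.ball 0 1) :=
  (differentiableOn_tsum_mul_pow fun n : ℕ => norm_fourierCoeff_le f n).congr fun _ hz =>
    (hasSum_cauchyInt hf (mem_ball_zero_iff.1 hz)).tsum_eq.symm

lemma cauchyInt_zero (f : Torus → ℂ) : cauchyInt f 0 = fourierCoeff f 0 := by
  simp [cauchyInt, fourierCoeff]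

lemma cauchyInt_add {f g : Torus → ℂ} (hf : Integrable f m) (hg : Integrable g m) {z : ℂ}
    (hz : ‖z‖ < 1) : cauchyInt (fun t => f t + g t) z = cauchyInt f z + cauchyInt g z := by
  simp only [cauchyInt, mul_add]
  exact integral_add (integrable_cauchyKernel_mul hf hz) (integrable_cauchyKernel_mul hg hz)

lemma cauchyInt_const_mul (c : ℂ) (f : Torus → ℂ) (z : ℂ) :
    cauchyInt (fun t => c * f t) z = c * cauchyInt f z := by
  simp only [cauchyInt, ← integral_const_mul, mul_left_comm c]

lemma cauchyInt_congr {f g : Torus → ℂ} (h : f =ᵐ[m] g) (z : ℂ) :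
    cauchyInt f z = cauchyInt g z :=
  integral_congr_ae (h.mono fun t ht => by simp only [ht])

/-! ### Poisson integrals -/

/-- The Poisson kernel `P_r(x) = Re ((1 + z) / (1 - z))`, `z = r e^{ix}`: the value at `(z, 1)` of
the Poisson kernel of the unit disc. It is the real counterpart of `conjPoissonKernel`. -/
def circlePoissonKernel (r : ℝ) (x : Torus) : ℝ := poissonKernel 0 (r * fourier 1 x) 1

lemma circlePoissonKernel_eq_re (r : ℝ) (x : Torus) :
    circlePoissonKernel r x =
      ((1 + (r : ℂ) * fourier 1 x) / (1 - (r : ℂ) * fourier 1 x)).re := by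
  rw [circlePoissonKernel, poissonKernel_eq_re_herglotzRieszKernel, Function.comp_apply,
    herglotzRieszKernel_def, sub_zero, sub_zero]

lemma re_fourier_one (x : Torus) : (fourier 1 x : ℂ).re = Real.cos ‖x‖ := by
  induction x using QuotientAddGroup.induction_on with
  | H y =>
  rw [AddCircle.norm_eq, Real.cos_abs, Real.cos_sub_int_mul_two_pi, fourier_coe_apply,
    ← Complex.exp_ofReal_mul_I_re]
  push_cast
  field_simp

lemma norm_torus_le_pi (x : Torus) : ‖x‖ ≤ π := by
  simpa [abs_of_pos Real.pi_pos] using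
    AddCircle.norm_le_half_period (2 * π) (x := x) Real.two_pi_pos.ne'

lemma norm_sq_one_sub_mul_fourier (r : ℝ) (x : Torus) :
    ‖(1 : ℂ) - r * fourier 1 x‖ ^ 2 = 1 - 2 * r * Real.cos ‖x‖ + r ^ 2 := by
  have hunit : Complex.normSq (fourier 1 x : ℂ) = 1 := by
    rw [Complex.normSq_eq_norm_sq, norm_fourier_apply, one_pow]
  rw [← re_fourier_one, ← Complex.normSq_eq_norm_sq]
  rw [Complex.normSq_apply] at hunit ⊢
  simp only [Complex.sub_re, Complex.sub_im, Complex.one_re, Complex.one_im,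
    Complex.re_ofReal_mul, Complex.im_ofReal_mul]
  linear_combination r ^ 2 * hunit

lemma circlePoissonKernel_eq (r : ℝ) (x : Torus) :
    circlePoissonKernel r x = (1 - r ^ 2) / (1 - 2 * r * Real.cos ‖x‖ + r ^ 2) := by
  rw [circlePoissonKernel, poissonKernel_def, sub_zero, sub_zero, norm_sq_one_sub_mul_fourier,
    norm_mul, norm_fourier_apply, mul_one, Complex.norm_real, Real.norm_eq_abs, sq_abs, norm_one,
    one_pow]

lemma one_sub_two_mul_cos_add_sq_pos {r : ℝ} (hr : r ∈ Set.Ico (0 : ℝ) 1) (c : ℝ) :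
    0 < 1 - 2 * r * Real.cos c + r ^ 2 := by
  nlinarith [mul_nonneg hr.1 (sub_nonneg.2 (Real.cos_le_one c)), sq_pos_of_pos (sub_pos.2 hr.2)]

lemma circlePoissonKernel_nonneg {r : ℝ} (hr : r ∈ Set.Ico (0 : ℝ) 1) (x : Torus) :
    0 ≤ circlePoissonKernel r x := by
  rw [circlePoissonKernel_eq]
  exact div_nonneg (by nlinarith [hr.1, hr.2]) (one_sub_two_mul_cos_add_sq_pos hr _).le

lemma circlePoissonKernel_le {r : ℝ} (hr : r ∈ Set.Ico (0 : ℝ) 1) {δ : ℝ} (hδ : 0 ≤ δ)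
    {x : Torus} (hx : δ ≤ ‖x‖) :
    circlePoissonKernel r x ≤ (1 - r ^ 2) / (1 - 2 * r * Real.cos δ + r ^ 2) := by
  have hcos := Real.cos_le_cos_of_nonneg_of_le_pi hδ (norm_torus_le_pi x) hx
  rw [circlePoissonKernel_eq]
  refine div_le_div_of_nonneg_left (by nlinarith [hr.1, hr.2])
    (one_sub_two_mul_cos_add_sq_pos hr _) ?_
  nlinarith [mul_nonneg hr.1 (sub_nonneg.2 hcos)]

lemma circlePoissonKernel_anti {r : ℝ} (hr : r ∈ Set.Ico (0 : ℝ) 1) {x y : Torus}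
    (h : ‖x‖ ≤ ‖y‖) : circlePoissonKernel r y ≤ circlePoissonKernel r x :=
  (circlePoissonKernel_le hr (norm_nonneg x) h).trans_eq (circlePoissonKernel_eq r x).symm

lemma one_sub_ofReal_mul_fourier_ne_zero {r : ℝ} (hr : r ∈ Set.Ico (0 : ℝ) 1) (x : Torus) :
    1 - (r : ℂ) * fourier 1 x ≠ 0 :=
  one_sub_mul_fourier_ne_zero (by rw [Complex.norm_real, Real.norm_of_nonneg hr.1]; exact hr.2) 1 x

lemma continuous_one_add_div_one_sub {r : ℝ} (hr : r ∈ Set.Ico (0 : ℝ) 1) :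
    Continuous fun x : Torus => (1 + (r : ℂ) * fourier 1 x) / (1 - (r : ℂ) * fourier 1 x) :=
  (continuous_const.add (continuous_const.mul (fourier 1).continuous)).div
    (continuous_const.sub (continuous_const.mul (fourier 1).continuous))
    (one_sub_ofReal_mul_fourier_ne_zero hr)

lemma continuous_circlePoissonKernel {r : ℝ} (hr : r ∈ Set.Ico (0 : ℝ) 1) :
    Continuous (circlePoissonKernel r) :=
  (Complex.continuous_re.comp (continuous_one_add_div_one_sub hr)).congr fun x =>
    (circlePoissonKernel_eq_re r x).symm

lemma continuous_conjPoissonKernel {r : ℝ} (hr : r ∈ Set.Ico (0 : ℝ) 1) :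
    Continuous (conjPoissonKernel r) :=
  Complex.continuous_im.comp (continuous_one_add_div_one_sub hr)

lemma integrable_of_continuous {α E : Type*} [TopologicalSpace α] [CompactSpace α]
    [MeasurableSpace α] [OpensMeasurableSpace α] [NormedAddCommGroup E]
    {μ : Measure α} [IsFiniteMeasureOnCompacts μ] {f : α → E} (hf : Continuous f) :
    Integrable f μ :=
  hf.integrable_of_hasCompactSupport (HasCompactSupport.of_compactSpace _)

theorem integral_circlePoissonKernel {r : ℝ} (hr : r ∈ Set.Ico (0 : ℝ) 1) :
    ∫ x, circlePoissonKernel r x ∂m = 1 := by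
  have hdiff : DifferentiableOn ℂ (fun z : ℂ => (1 + z) / (1 - z)) (Metric.ball 0 1) := by
    refine DifferentiableOn.div (by fun_prop) (by fun_prop) fun z hz h0 => ?_
    rw [mem_ball_zero_iff, ← sub_eq_zero.1 h0, norm_one] at hz
    exact lt_irrefl _ hz
  have hre := integral_re (integrable_of_continuous (μ := m) (continuous_one_add_div_one_sub hr))
  rw [integral_comp_mul_fourier hdiff hr] at hre
  simpa [circlePoissonKernel_eq_re] using hre

lemma integral_circlePoissonKernel_sub {r : ℝ} (hr : r ∈ Set.Ico (0 : ℝ) 1) (x : Torus) :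
    ∫ t, circlePoissonKernel r (x - t) ∂m = 1 := by
  rw [integral_sub_left_eq_self (circlePoissonKernel r) m x, integral_circlePoissonKernel hr]

lemma lintegral_circlePoissonKernel_sub {r : ℝ} (hr : r ∈ Set.Ico (0 : ℝ) 1) (x : Torus) :
    ∫⁻ t, ENNReal.ofReal (circlePoissonKernel r (x - t)) ∂m = 1 := by
  have hcont : Continuous fun t => circlePoissonKernel r (x - t) :=
    (continuous_circlePoissonKernel hr).comp (continuous_sub_left x)
  rw [← ofReal_integral_eq_lintegral_ofReal (integrable_of_continuous hcont)
    (Eventually.of_forall fun t => circlePoissonKernel_nonneg hr _),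
    integral_circlePoissonKernel_sub hr x, ENNReal.ofReal_one]

lemma integrable_kernel_sub_mul {k : Torus → ℂ} (hk : Continuous k) {f : Torus → ℂ}
    (hf : Integrable f m) (x : Torus) : Integrable (fun t => k (x - t) * f t) m := by
  obtain ⟨C, hC⟩ := isCompact_univ.exists_bound_of_continuousOn hk.continuousOn
  exact hf.bdd_mul (hk.comp (continuous_sub_left x)).aestronglyMeasurable
    (Eventually.of_forall fun t => hC _ (Set.mem_univ _))

/-- The Poisson integral of `f` at the point `r e^{ix}` of the disc. -/
def poissonInt (f : Torus → ℂ) (r : ℝ) (x : Torus) : ℂ :=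
  ∫ t, (circlePoissonKernel r (x - t) : ℂ) * f t ∂m

lemma integrable_circlePoissonKernel_mul {r : ℝ} (hr : r ∈ Set.Ico (0 : ℝ) 1) {f : Torus → ℂ}
    (hf : Integrable f m) (x : Torus) :
    Integrable (fun t => (circlePoissonKernel r (x - t) : ℂ) * f t) m :=
  integrable_kernel_sub_mul
    (Complex.continuous_ofReal.comp (continuous_circlePoissonKernel hr)) hf x

lemma mul_fourier_mul_fourier_neg (r : ℝ) (x t : Torus) :
    (r : ℂ) * fourier 1 x * fourier (-1) t = r * fourier 1 (x - t) := by
  rw [fourier_sub_apply, mul_assoc]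

/-- With `w = r e^{i(x - t)}` this is `2 / (1 - w) - 1 = (1 + w) / (1 - w)`, integrated. -/
theorem two_mul_cauchyInt_sub {f : Torus → ℂ} (hf : Integrable f m) {r : ℝ}
    (hr : r ∈ Set.Ico (0 : ℝ) 1) (x : Torus) :
    2 * cauchyInt f (r * fourier 1 x) - fourierCoeff f 0 =
      poissonInt f r x +
        Complex.I * ∫ t, (conjPoissonKernel r (x - t) : ℂ) * f t ∂m := by
  have hz : ‖(r : ℂ) * fourier 1 x‖ < 1 := mem_ball_zero_iff.1 (mul_fourier_mem_ball hr 1 x)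
  have hkernel (t : Torus) : 2 * (1 - (r : ℂ) * fourier 1 (x - t))⁻¹ - 1 =
      circlePoissonKernel r (x - t) + Complex.I * conjPoissonKernel r (x - t) := by
    have hne := one_sub_ofReal_mul_fourier_ne_zero hr (x - t)
    rw [circlePoissonKernel_eq_re, conjPoissonKernel, mul_comm Complex.I, Complex.re_add_im]
    field_simp
    ring
  rw [cauchyInt, fourierCoeff, poissonInt, ← integral_const_mul, ← integral_const_mul,
    ← integral_sub, ← integral_add]
  · refine integral_congr_ae (Eventually.of_forall fun t => ?_)
    simp only [mul_fourier_mul_fourier_neg, neg_zero, fourier_zero, one_smul]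
    linear_combination f t * hkernel t
  · exact integrable_circlePoissonKernel_mul hr hf x
  · exact (integrable_kernel_sub_mul
      (Complex.continuous_ofReal.comp (continuous_conjPoissonKernel hr)) hf x).const_mul _
  · exact (integrable_cauchyKernel_mul hf hz).const_mul _
  · simpa using hf

/-! ### Fatou's theorem on Poisson integrals -/

section LebesguePoint

variable {T : ℝ} [Fact (0 < T)]

lemma ae_haarAddCircle_iff {p : AddCircle T → Prop} :
    (∀ᵐ x ∂AddCircle.haarAddCircle, p x) ↔ ∀ᵐ x : AddCircle T, p x := by
  rw [AddCircle.volume_eq_smul_haarAddCircle, Measure.ae_ennreal_smul_measure_iff]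
  simpa using Fact.out

lemma haarAddCircle_closedBall_eq_ball (x : AddCircle T) (ρ : ℝ) :
    AddCircle.haarAddCircle (Metric.closedBall x ρ) = AddCircle.haarAddCircle (Metric.ball x ρ) :=
  measure_congr (ae_haarAddCircle_iff.2 AddCircle.closedBall_ae_eq_ball)

lemma ae_eventually_lintegral_closedBall_enorm_sub_le {E : Type*} [NormedAddCommGroup E]
    {f : AddCircle T → E} (hf : Integrable f AddCircle.haarAddCircle) :
    ∀ᵐ x ∂AddCircle.haarAddCircle, ∀ ε : ℝ≥0∞, 0 < ε → ∀ᶠ ρ in 𝓝[>] (0 : ℝ),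
      ∫⁻ t in Metric.closedBall x ρ, ‖f t - f x‖ₑ ∂AddCircle.haarAddCircle ≤
        ε * AddCircle.haarAddCircle (Metric.ball x ρ) := by
  have hT : ENNReal.ofReal T ≠ 0 := by simpa using Fact.out
  have hvol : Integrable f volume := by
    rw [AddCircle.volume_eq_smul_haarAddCircle]
    exact hf.smul_measure ENNReal.ofReal_ne_top
  rw [ae_haarAddCircle_iff]
  filter_upwards [(IsUnifLocDoublingMeasure.vitaliFamily
    volume 1).ae_tendsto_lintegral_enorm_sub_div_of_integrable hvol] with x hx ε hε
  have hballs : Tendsto (Metric.closedBall x) (𝓝[>] 0)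
      ((IsUnifLocDoublingMeasure.vitaliFamily volume 1).filterAt x) :=
    IsUnifLocDoublingMeasure.tendsto_closedBall_filterAt volume (fun _ => x) id tendsto_id <| by
      filter_upwards [self_mem_nhdsWithin] with ρ hρ
      simpa using (Set.mem_Ioi.1 hρ).le
  filter_upwards [(hx.comp hballs).eventually (gt_mem_nhds hε), self_mem_nhdsWithin] with ρ hlt hρ
  have hle := (ENNReal.div_le_iff (Metric.measure_closedBall_pos volume x hρ).ne'
    measure_closedBall_lt_top.ne).1 hlt.le
  rw [AddCircle.volume_eq_smul_haarAddCircle, Measure.restrict_smul, lintegral_smul_measure,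
    Measure.smul_apply, smul_eq_mul, smul_eq_mul, mul_left_comm,
    ENNReal.mul_le_mul_iff_right hT ENNReal.ofReal_ne_top] at hle
  rwa [← haarAddCircle_closedBall_eq_ball]

end LebesguePoint

section RadialKernel

variable {α : Type*} [PseudoMetricSpace α] {x : α} {δ : ℝ}

lemma exists_ball_subset_subset_closedBall {A : Set α} (hne : A.Nonempty)
    (hball : A ⊆ Metric.ball x δ) (hA : ∀ s ∈ A, ∀ t, dist t x ≤ dist s x → t ∈ A) :
    ∃ ρ ≤ δ, Metric.ball x ρ ⊆ A ∧ A ⊆ Metric.closedBall x ρ := by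
  have hle : ∀ r ∈ (dist · x) '' A, r ≤ δ := by
    rintro _ ⟨t, ht, rfl⟩
    exact (Metric.mem_ball.1 (hball ht)).le
  refine ⟨sSup ((dist · x) '' A), csSup_le (hne.image _) hle, fun t ht => ?_,
    fun t ht => le_csSup ⟨δ, hle⟩ ⟨t, ht, rfl⟩⟩
  obtain ⟨_, ⟨s, hs, rfl⟩, hlt⟩ := exists_lt_of_lt_csSup (hne.image _) (Metric.mem_ball.1 ht)
  exact hA s hs t hlt.le

/-- The superlevel sets of a radially decreasing kernel are balls, so by the layer cake formula
such a kernel sees a function only through its integrals over balls. -/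
theorem setLIntegral_ball_radial_mul_le [MeasurableSpace α] {μ : Measure α} {k : α → ℝ}
    (hk : Measurable k) (hk0 : ∀ t, 0 ≤ k t) (hanti : ∀ s t, dist s x ≤ dist t x → k t ≤ k s)
    {h : α → ℝ≥0∞} (hh : AEMeasurable h μ) {ε : ℝ≥0∞} (hε : ε ≠ ∞)
    (hball : ∀ ρ ≤ δ, ∫⁻ t in Metric.closedBall x ρ, h t ∂μ ≤ ε * μ (Metric.ball x ρ)) :
    ∫⁻ t in Metric.ball x δ, ENNReal.ofReal (k t) * h t ∂μ ≤
      ε * ∫⁻ t, ENNReal.ofReal (k t) ∂μ := by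
  have hlevel (lam : ℝ) : MeasurableSet {t | lam < k t} := measurableSet_lt measurable_const hk
  have hdensity : ∫⁻ t in Metric.ball x δ, ENNReal.ofReal (k t) * h t ∂μ =
      ∫⁻ t, ENNReal.ofReal (k t) ∂(μ.restrict (Metric.ball x δ)).withDensity h := by
    rw [lintegral_withDensity_eq_lintegral_mul₀ hh.restrict hk.ennreal_ofReal.aemeasurable]
    simp only [Pi.mul_apply, mul_comm]
  rw [hdensity, lintegral_eq_lintegral_meas_lt _ (Eventually.of_forall hk0) hk.aemeasurable,
    lintegral_eq_lintegral_meas_lt μ (Eventually.of_forall hk0) hk.aemeasurable,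
    ← lintegral_const_mul' _ _ hε]
  refine lintegral_mono fun lam => ?_
  rw [withDensity_apply _ (hlevel lam), Measure.restrict_restrict (hlevel lam)]
  rcases ({t | lam < k t} ∩ Metric.ball x δ).eq_empty_or_nonempty with hempty | hne
  · simp [hempty]
  obtain ⟨ρ, hρ, hsub, hsup⟩ := exists_ball_subset_subset_closedBall hne Set.inter_subset_right
    fun s hs t hts => ⟨lt_of_lt_of_le (Set.mem_ofPred.1 hs.1) (hanti t s hts),
      hts.trans_lt (Metric.mem_ball.1 hs.2)⟩
  calc ∫⁻ t in {t | lam < k t} ∩ Metric.ball x δ, h t ∂μ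
      ≤ ∫⁻ t in Metric.closedBall x ρ, h t ∂μ := lintegral_mono_set hsup
    _ ≤ ε * μ (Metric.ball x ρ) := hball ρ hρ
    _ ≤ ε * μ {t | lam < k t} := by
        gcongr
        exact hsub.trans Set.inter_subset_left

end RadialKernel

lemma tendsto_one_sub_sq_div {δ : ℝ} (hδ0 : 0 < δ) (hδ : δ ≤ π) :
    Tendsto (fun r : ℝ => (1 - r ^ 2) / (1 - 2 * r * Real.cos δ + r ^ 2)) (𝓝[<] 1) (𝓝 0) := by
  have hcos : Real.cos δ < 1 := by
    simpa using Real.cos_lt_cos_of_nonneg_of_le_pi le_rfl hδ hδ0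
  have hcont : ContinuousAt (fun r : ℝ => (1 - r ^ 2) / (1 - 2 * r * Real.cos δ + r ^ 2)) 1 :=
    ContinuousAt.div (by fun_prop) (by fun_prop) fun h => by nlinarith
  simpa using hcont.tendsto.mono_left (nhdsWithin_le_nhds (s := Set.Iio 1))

lemma eventually_mem_Ioo_zero_one : ∀ᶠ r : ℝ in 𝓝[<] 1, r ∈ Set.Ioo (0 : ℝ) 1 :=
  Ioo_mem_nhdsLT one_pos

lemma enorm_poissonInt_sub_le {f : Torus → ℂ} (hf : Integrable f m) {r : ℝ}
    (hr : r ∈ Set.Ico (0 : ℝ) 1) (x : Torus) (c : ℂ) :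
    ‖poissonInt f r x - c‖ₑ ≤
      ∫⁻ t, ENNReal.ofReal (circlePoissonKernel r (x - t)) * ‖f t - c‖ₑ ∂m := by
  have hsub : poissonInt f r x - c = ∫ t, (circlePoissonKernel r (x - t) : ℂ) * (f t - c) ∂m := by
    simp only [mul_sub]
    rw [integral_sub (integrable_circlePoissonKernel_mul hr hf x)
      (integrable_circlePoissonKernel_mul hr (integrable_const _) x), integral_mul_const,
      integral_complex_ofReal, integral_circlePoissonKernel_sub hr x, Complex.ofReal_one, one_mul,
      poissonInt]
  rw [hsub]
  refine (enorm_integral_le_lintegral_enorm _).trans_eq (lintegral_congr fun t => ?_)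
  rw [enorm_mul, ← ofReal_norm (circlePoissonKernel r (x - t) : ℂ), Complex.norm_real,
    Real.norm_of_nonneg (circlePoissonKernel_nonneg hr _)]

lemma setLIntegral_ball_circlePoissonKernel_mul_le {r : ℝ} (hr : r ∈ Set.Ico (0 : ℝ) 1)
    {x : Torus} {h : Torus → ℝ≥0∞} (hh : AEMeasurable h m) {ε : ℝ≥0∞} (hε : ε ≠ ∞) {δ : ℝ}
    (hball : ∀ ρ ≤ δ, ∫⁻ t in Metric.closedBall x ρ, h t ∂m ≤ ε * m (Metric.ball x ρ)) :
    ∫⁻ t in Metric.ball x δ, ENNReal.ofReal (circlePoissonKernel r (x - t)) * h t ∂m ≤ ε := by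
  have hcont : Continuous fun t => circlePoissonKernel r (x - t) :=
    (continuous_circlePoissonKernel hr).comp (continuous_sub_left x)
  refine (setLIntegral_ball_radial_mul_le hcont.measurable
    (fun t => circlePoissonKernel_nonneg hr _) (fun s t hst => circlePoissonKernel_anti hr ?_)
    hh hε hball).trans_eq ?_
  · rwa [← dist_eq_norm, ← dist_eq_norm, dist_comm x, dist_comm x]
  · rw [lintegral_circlePoissonKernel_sub hr, mul_one]

lemma setLIntegral_compl_ball_circlePoissonKernel_mul_le {r : ℝ} (hr : r ∈ Set.Ico (0 : ℝ) 1)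
    (x : Torus) {δ : ℝ} (hδ : 0 ≤ δ) (h : Torus → ℝ≥0∞) :
    ∫⁻ t in (Metric.ball x δ)ᶜ, ENNReal.ofReal (circlePoissonKernel r (x - t)) * h t ∂m ≤
      ENNReal.ofReal ((1 - r ^ 2) / (1 - 2 * r * Real.cos δ + r ^ 2)) * ∫⁻ t, h t ∂m := by
  rw [← lintegral_const_mul' _ _ ENNReal.ofReal_ne_top]
  refine (setLIntegral_mono' Metric.isOpen_ball.measurableSet.compl fun t ht => ?_).trans
    (setLIntegral_le_lintegral _ _)
  rw [Set.mem_compl_iff, Metric.mem_ball, not_lt, dist_comm, dist_eq_norm] at ht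
  gcongr
  exact circlePoissonKernel_le hr hδ ht

theorem ae_tendsto_poissonInt {f : Torus → ℂ} (hf : Integrable f m) :
    ∀ᵐ x ∂m, Tendsto (fun r => poissonInt f r x) (𝓝[<] 1) (𝓝 (f x)) := by
  filter_upwards [ae_eventually_lintegral_closedBall_enorm_sub_le hf] with x hx
  rw [tendsto_iff_edist_tendsto_0, ENNReal.tendsto_nhds_zero]
  intro ε hε
  obtain ⟨ε', hε'0, hε'⟩ := exists_between (ENNReal.half_pos hε.ne')
  obtain ⟨δ₀, hδ₀, hball₀⟩ := mem_nhdsGT_iff_exists_Ioc_subset.1 (hx ε' hε'0)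
  obtain ⟨δ, hδ, hδδ₀, hδπ⟩ : ∃ δ, 0 < δ ∧ δ ≤ δ₀ ∧ δ ≤ π :=
    ⟨min δ₀ π, lt_min hδ₀ Real.pi_pos, min_le_left _ _, min_le_right _ _⟩
  have hball : ∀ ρ ≤ δ, ∫⁻ t in Metric.closedBall x ρ, ‖f t - f x‖ₑ ∂m ≤
      ε' * m (Metric.ball x ρ) := by
    intro ρ hρ
    rcases le_or_gt ρ 0 with hρ0 | hρ0
    · rw [Measure.restrict_eq_zero.2] <;>
        simp [haarAddCircle_closedBall_eq_ball, Metric.ball_eq_empty.2 hρ0]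
    · exact hball₀ ⟨hρ0, hρ.trans hδδ₀⟩
  have hInt : Integrable (fun t => f t - f x) m := hf.sub (integrable_const _)
  have htail : ∀ᶠ r : ℝ in 𝓝[<] 1, ENNReal.ofReal ((1 - r ^ 2) /
      (1 - 2 * r * Real.cos δ + r ^ 2)) * ∫⁻ t, ‖f t - f x‖ₑ ∂m ≤ ε / 2 := by
    have hlim := ENNReal.Tendsto.mul_const (b := ∫⁻ t, ‖f t - f x‖ₑ ∂m)
      (ENNReal.tendsto_ofReal (tendsto_one_sub_sq_div hδ hδπ)) (Or.inr hInt.2.ne)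
    rw [ENNReal.ofReal_zero, zero_mul] at hlim
    exact ENNReal.tendsto_nhds_zero.1 hlim _ (ENNReal.half_pos hε.ne')
  filter_upwards [htail, eventually_mem_Ioo_zero_one] with r hr hr01
  have hr' : r ∈ Set.Ico (0 : ℝ) 1 := Set.Ioo_subset_Ico_self hr01
  rw [edist_eq_enorm_sub]
  refine (enorm_poissonInt_sub_le hf hr' x (f x)).trans ?_
  rw [← lintegral_add_compl _ (Metric.isOpen_ball (x := x) (ε := δ)).measurableSet,
    ← ENNReal.add_halves ε]
  exact add_le_add
    ((setLIntegral_ball_circlePoissonKernel_mul_le hr' hInt.1.enorm hε'.ne_top hball).trans hε'.le)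
    ((setLIntegral_compl_ball_circlePoissonKernel_mul_le hr' x hδ.le _).trans hr)

/-! ### Radial limits of bounded analytic functions -/

section BoundedAnalytic

open scoped ComplexConjugate

lemma integrable_conj {α : Type*} [MeasurableSpace α] {μ : Measure α} {g : α → ℂ}
    (hg : Integrable g μ) : Integrable (fun t => conj (g t)) μ :=
  hg.congr' (Complex.continuous_conj.comp_aestronglyMeasurable hg.1)
    (Eventually.of_forall fun _ => (RCLike.norm_conj _).symm)

lemma fourierCoeff_conj {T : ℝ} [Fact (0 < T)] (g : AddCircle T → ℂ) (n : ℤ) :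
    fourierCoeff (fun t => conj (g t)) n = conj (fourierCoeff g (-n)) := by
  simp only [fourierCoeff, ← integral_conj, smul_eq_mul, map_mul, fourier_neg, Complex.conj_conj]

lemma integral_ofReal_mul_conj {α : Type*} [MeasurableSpace α] {μ : Measure α} (k : α → ℝ)
    (g : α → ℂ) : ∫ t, (k t : ℂ) * conj (g t) ∂μ = conj (∫ t, (k t : ℂ) * g t ∂μ) := by
  simp only [← integral_conj, map_mul, Complex.conj_ofReal]

lemma cauchyInt_conj_of_analytic {g : Torus → ℂ} (hg : Integrable g m)
    (hneg : ∀ n : ℤ, n < 0 → fourierCoeff g n = 0) {z : ℂ} (hz : ‖z‖ < 1) :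
    cauchyInt (fun t => conj (g t)) z = conj (fourierCoeff g 0) := by
  refine (hasSum_cauchyInt (integrable_conj hg) hz).unique ?_
  convert hasSum_single (f := fun n : ℕ => fourierCoeff (fun t => conj (g t)) n * z ^ n) 0
    fun n hn => ?_
  · simp [fourierCoeff_conj]
  · rw [fourierCoeff_conj, hneg (-n) (by omega), map_zero, zero_mul]

theorem poissonInt_eq_cauchyInt {g : Torus → ℂ} (hg : Integrable g m)
    (hneg : ∀ n : ℤ, n < 0 → fourierCoeff g n = 0) {r : ℝ} (hr : r ∈ Set.Ico (0 : ℝ) 1)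
    (x : Torus) : poissonInt g r x = cauchyInt g (r * fourier 1 x) := by
  have hz : ‖(r : ℂ) * fourier 1 x‖ < 1 := mem_ball_zero_iff.1 (mul_fourier_mem_ball hr 1 x)
  have hanalytic := two_mul_cauchyInt_sub hg hr x
  have hconj := congrArg conj (two_mul_cauchyInt_sub (integrable_conj hg) hr x)
  rw [cauchyInt_conj_of_analytic hg hneg hz, fourierCoeff_conj, neg_zero, poissonInt,
    integral_ofReal_mul_conj, integral_ofReal_mul_conj, ← poissonInt] at hconj
  simp only [map_sub, map_mul, map_add, map_ofNat, Complex.conj_conj, Complex.conj_I] at hconj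
  linear_combination (-1 / 2 : ℂ) * (hanalytic + hconj)

lemma fourierCoeff_comp_mul_fourier {T : ℝ} [Fact (0 < T)] {Φ : ℂ → ℂ} {a : ℕ → ℂ} {r : ℝ}
    (hr : 0 ≤ r)
    (ha : ∀ x : AddCircle T, HasSum (fun n => a n * (r * fourier 1 x) ^ n) (Φ (r * fourier 1 x)))
    (k : ℤ) : fourierCoeff (fun x : AddCircle T => Φ (r * fourier 1 x)) k =
      if 0 ≤ k then a k.toNat * r ^ k.toNat else 0 := by
  have hnorm (n : ℕ) (x : AddCircle T) :
      ‖fourier (-k) x * (a n * (r * fourier 1 x) ^ n)‖ = ‖a n‖ * r ^ n := by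
    rw [norm_mul, norm_mul, norm_pow, norm_mul_fourier hr, norm_fourier_apply, one_mul]
  have hsummable : Summable fun n => ‖a n‖ * r ^ n := by
    simpa only [norm_mul, norm_pow, norm_mul_fourier hr] using (ha 0).summable.norm
  have hterm (n : ℕ) : ∫ x : AddCircle T, fourier (-k) x * (a n * (r * fourier 1 x) ^ n)
      ∂AddCircle.haarAddCircle = if (n : ℤ) = k then a n * r ^ n else 0 := by
    have hfourier := congrFun (fourierCoeff_fourier (T := T) (n : ℤ)) k
    rw [fourierCoeff, Pi.single_apply] at hfourier
    have hfactor (x : AddCircle T) : fourier (-k) x * (a n * (r * fourier 1 x) ^ n) =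
        (a n * r ^ n) * (fourier (-k) x • fourier n x) := by
      rw [mul_pow, fourier_one_pow, smul_eq_mul]
      ring
    simp only [hfactor, integral_const_mul, hfourier, eq_comm (a := k), mul_ite, mul_one, mul_zero]
  have hsum := hasSum_integral_of_summable_integral_norm (μ := AddCircle.haarAddCircle)
    (F := fun (n : ℕ) (x : AddCircle T) => fourier (-k) x * (a n * (r * fourier 1 x) ^ n))
    (fun n => integrable_of_continuous (by fun_prop))
    (by simpa only [hnorm, integral_const, probReal_univ, one_smul] using hsummable)
  simp only [tsum_mul_left, (ha _).tsum_eq, hterm] at hsum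
  rw [fourierCoeff]
  refine hsum.unique ?_
  split_ifs with hk
  · simpa only [Int.toNat_of_nonneg hk, if_true] using
      hasSum_single (f := fun n : ℕ => if (n : ℤ) = k then a n * (r : ℂ) ^ n else 0) k.toNat
        fun n hn => if_neg (by omega)
  · convert hasSum_zero using 2 with n
    exact if_neg (by omega)

lemma sum_sq_fourierCoeff_le {T : ℝ} [Fact (0 < T)] (φ : C(AddCircle T, ℂ)) {M : ℝ}
    (hM : ∀ x, ‖φ x‖ ≤ M) (s : Finset ℤ) : ∑ k ∈ s, ‖fourierCoeff φ k‖ ^ 2 ≤ M ^ 2 := by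
  have hparseval := hasSum_sq_fourierCoeff (ContinuousMap.toLp (E := ℂ) 2 _ ℂ φ)
  simp only [fourierCoeff_toLp] at hparseval
  refine (sum_le_hasSum s (fun _ _ => by positivity) hparseval).trans ?_
  have hle : ∀ᵐ x ∂AddCircle.haarAddCircle,
      ‖(ContinuousMap.toLp (E := ℂ) 2 AddCircle.haarAddCircle ℂ φ) x‖ ^ 2 ≤ M ^ 2 := by
    filter_upwards [ContinuousMap.coeFn_toLp (E := ℂ) (p := 2) _ (𝕜 := ℂ) φ] with x hx
    rw [hx]
    gcongr
    exact hM x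
  simpa using integral_mono_of_nonneg (Eventually.of_forall fun x => by positivity)
    (integrable_const _) hle

variable {Φ : ℂ → ℂ} (hΦ : DifferentiableOn ℂ Φ (Metric.ball 0 1))

include hΦ

lemma exists_hasSum_mul_pow :
    ∃ a : ℕ → ℂ, ∀ z ∈ Metric.ball (0 : ℂ) 1, HasSum (fun n => a n * z ^ n) (Φ z) := by
  refine ⟨fun n => (n.factorial : ℂ)⁻¹ * iteratedDeriv n Φ 0, fun z hz => ?_⟩
  have htaylor := Complex.hasSum_taylorSeries_on_ball (c := 0) (r := 1) hΦ hz
  simpa only [sub_zero, smul_eq_mul, mul_left_comm, mul_comm, mul_assoc] using htaylor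

/-- Bessel's inequality on the circles of radius `r < 1`, in the limit `r → 1`. -/
lemma sum_sq_coeff_le_of_bounded {a : ℕ → ℂ}
    (ha : ∀ z ∈ Metric.ball (0 : ℂ) 1, HasSum (fun n => a n * z ^ n) (Φ z)) {M : ℝ}
    (hM : ∀ z ∈ Metric.ball (0 : ℂ) 1, ‖Φ z‖ ≤ M) (s : Finset ℤ) :
    ∑ k ∈ s, ‖if 0 ≤ k then a k.toNat else 0‖ ^ 2 ≤ M ^ 2 := by
  have hcont : Continuous fun r : ℝ =>
      ∑ k ∈ s, ‖if 0 ≤ k then a k.toNat * (r : ℂ) ^ k.toNat else 0‖ ^ 2 :=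
    continuous_finsetSum _ fun k _ => by split_ifs <;> fun_prop
  have hlim := (hcont.tendsto 1).mono_left (nhdsWithin_le_nhds (s := Set.Iio 1))
  simp only [Complex.ofReal_one, one_pow, mul_one] at hlim
  refine le_of_tendsto hlim ?_
  filter_upwards [eventually_mem_Ioo_zero_one] with r hr
  have hr' : r ∈ Set.Ico (0 : ℝ) 1 := ⟨hr.1.le, hr.2⟩
  have hbessel := sum_sq_fourierCoeff_le (T := 2 * π)
    ⟨fun x => Φ (r * fourier 1 x), continuous_comp_mul_fourier hΦ.continuousOn hr'⟩
    (fun x => hM _ (mul_fourier_mem_ball hr' 1 x)) s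
  simpa only [ContinuousMap.coe_mk, fourierCoeff_comp_mul_fourier hr'.1
    fun x => ha _ (mul_fourier_mem_ball hr' 1 x)] using hbessel

theorem exists_poissonInt_eq_of_bounded {M : ℝ}
    (hM : ∀ z ∈ Metric.ball (0 : ℂ) 1, ‖Φ z‖ ≤ M) :
    ∃ g : Torus → ℂ, Integrable g m ∧ ∀ r ∈ Set.Ico (0 : ℝ) 1, ∀ x,
      Φ (r * fourier 1 x) = poissonInt g r x := by
  obtain ⟨a, ha⟩ := exists_hasSum_mul_pow hΦ
  have hmem : Memℓp (fun k : ℤ => if 0 ≤ k then a k.toNat else 0) 2 :=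
    memℓp_gen' (C := M ^ 2) (by simpa using sum_sq_coeff_le_of_bounded hΦ ha hM)
  let g : Lp ℂ 2 m := (fourierBasis (T := 2 * π)).repr.symm ⟨_, hmem⟩
  have hint : Integrable g m := (Lp.memLp g).integrable one_le_two
  have hcoeff (k : ℤ) : fourierCoeff g k = if 0 ≤ k then a k.toNat else 0 := by
    rw [← fourierBasis_repr, LinearIsometryEquiv.apply_symm_apply]
  refine ⟨g, hint, fun r hr x => ?_⟩
  have hz := mul_fourier_mem_ball hr 1 x
  rw [poissonInt_eq_cauchyInt hint (fun n hn => by rw [hcoeff, if_neg hn.not_ge]) hr x]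
  refine (ha _ hz).unique ?_
  simpa [hcoeff] using hasSum_cauchyInt hint (mem_ball_zero_iff.1 hz)

theorem ae_exists_tendsto_of_bounded {M : ℝ} (hM : ∀ z ∈ Metric.ball (0 : ℂ) 1, ‖Φ z‖ ≤ M) :
    ∀ᵐ x ∂m, ∃ l, Tendsto (fun r : ℝ => Φ (r * fourier 1 x)) (𝓝[<] 1) (𝓝 l) := by
  obtain ⟨g, hg, hΦg⟩ := exists_poissonInt_eq_of_bounded hΦ hM
  filter_upwards [ae_tendsto_poissonInt hg] with x hx
  refine ⟨g x, hx.congr' ?_⟩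
  filter_upwards [eventually_mem_Ioo_zero_one] with r hr using (hΦg r ⟨hr.1.le, hr.2⟩ x).symm

end BoundedAnalytic

/-! ### Herglotz integrals of nonnegative functions -/

/-- The Herglotz integral `z ↦ ∫ (e^{it} + z) / (e^{it} - z) f(t) dm(t)` of a real function, the
analytic function on the disc with real part the Poisson integral of `f` that is real at `0`. -/
def herglotz (f : Torus → ℝ) (z : ℂ) : ℂ :=
  2 * cauchyInt (fun t => (f t : ℂ)) z - fourierCoeff (fun t => (f t : ℂ)) 0

lemma fourierCoeff_ofReal_zero {T : ℝ} [Fact (0 < T)] (f : AddCircle T → ℝ) :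
    fourierCoeff (fun t => (f t : ℂ)) 0 = ((∫ t, f t ∂AddCircle.haarAddCircle : ℝ) : ℂ) := by
  simp only [fourierCoeff, neg_zero, fourier_zero, one_smul, integral_complex_ofReal]

lemma herglotz_zero (f : Torus → ℝ) : herglotz f 0 = ((∫ t, f t ∂m : ℝ) : ℂ) := by
  rw [herglotz, cauchyInt_zero, fourierCoeff_ofReal_zero]
  ring

lemma differentiableOn_herglotz {f : Torus → ℝ} (hf : Integrable f m) :
    DifferentiableOn ℂ (herglotz f) (Metric.ball 0 1) :=
  ((differentiableOn_cauchyInt hf.ofReal).const_mul 2).sub_const _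

lemma integrable_herglotzKernel_mul {f : Torus → ℝ} (hf : Integrable f m) {z : ℂ}
    (hz : ‖z‖ < 1) :
    Integrable (fun t => (2 * (1 - z * fourier (-1) t)⁻¹ - 1) * (f t : ℂ)) m := by
  refine (((integrable_cauchyKernel_mul hf.ofReal hz).const_mul 2).sub hf.ofReal).congr
    (Eventually.of_forall fun t => ?_)
  simp only [Pi.sub_apply, Complex.coe_algebraMap]
  ring

lemma herglotz_eq_integral {f : Torus → ℝ} (hf : Integrable f m) {z : ℂ} (hz : ‖z‖ < 1) :
    herglotz f z = ∫ t, (2 * (1 - z * fourier (-1) t)⁻¹ - 1) * f t ∂m := by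
  rw [herglotz, cauchyInt, fourierCoeff, ← integral_const_mul, ← integral_sub]
  · refine integral_congr_ae (Eventually.of_forall fun t => ?_)
    simp only [neg_zero, fourier_zero, one_smul]
    ring
  · exact (integrable_cauchyKernel_mul hf.ofReal hz).const_mul _
  · simpa using (hf.ofReal : Integrable (fun t => (f t : ℂ)) m)

lemma re_two_mul_inv_one_sub_sub_one_nonneg {w : ℂ} (hw : ‖w‖ < 1) :
    0 ≤ (2 * (1 - w)⁻¹ - 1).re := by
  have hne : 1 - w ≠ 0 := sub_ne_zero.2 fun h => by simp [← h] at hw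
  have hsq : Complex.normSq w < 1 := by
    rw [Complex.normSq_eq_norm_sq]
    nlinarith [norm_nonneg w]
  rw [Complex.normSq_apply] at hsq
  rw [show 2 * (1 - w)⁻¹ - 1 = (1 + w) / (1 - w) by field_simp; ring, Complex.div_re, ← add_div]
  refine div_nonneg ?_ (Complex.normSq_nonneg _)
  simp only [Complex.sub_re, Complex.sub_im, Complex.one_re, Complex.one_im, Complex.add_re,
    Complex.add_im]
  nlinarith

lemma re_herglotz_nonneg {f : Torus → ℝ} (hf : Integrable f m) (hf0 : ∀ t, 0 ≤ f t) {z : ℂ}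
    (hz : z ∈ Metric.ball (0 : ℂ) 1) : 0 ≤ (herglotz f z).re := by
  rw [mem_ball_zero_iff] at hz
  have hre := integral_re (integrable_herglotzKernel_mul hf hz)
  simp only [RCLike.re_to_complex, Complex.re_mul_ofReal] at hre
  rw [herglotz_eq_integral hf hz, ← hre]
  refine integral_nonneg fun t => mul_nonneg (re_two_mul_inv_one_sub_sub_one_nonneg ?_) (hf0 t)
  rwa [norm_mul, norm_fourier_apply, mul_one]

theorem re_herglotz_eq {f : Torus → ℝ} (hf : Integrable f m) {r : ℝ}
    (hr : r ∈ Set.Ico (0 : ℝ) 1) (x : Torus) :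
    (herglotz f (r * fourier 1 x)).re = ∫ t, circlePoissonKernel r (x - t) * f t ∂m := by
  have hboundary := two_mul_cauchyInt_sub hf.ofReal hr x
  simp only [Complex.coe_algebraMap] at hboundary
  rw [herglotz, hboundary, poissonInt]
  simp only [← Complex.ofReal_mul, integral_complex_ofReal, Complex.add_re, Complex.ofReal_re,
    Complex.I_mul_re, Complex.ofReal_im, neg_zero, add_zero]

/-! ### The weak type `(1, 1)` estimate -/

lemma add_ofReal_ne_zero {F : ℂ} {lam : ℝ} (hl : 0 < lam) (hF : 0 ≤ F.re) : F + lam ≠ 0 := by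
  refine fun hzero => (add_pos_of_nonneg_of_pos hF hl).ne' ?_
  simpa using congrArg Complex.re hzero

lemma re_div_add_ofReal_nonneg {F : ℂ} {lam : ℝ} (hl : 0 < lam) (hF : 0 ≤ F.re) :
    0 ≤ (F / (F + lam)).re := by
  rw [Complex.div_re, ← add_div]
  refine div_nonneg ?_ (Complex.normSq_nonneg _)
  simp only [Complex.add_re, Complex.add_im, Complex.ofReal_re, Complex.ofReal_im, add_zero]
  nlinarith [mul_nonneg hF hl.le]

lemma half_le_re_div_add_ofReal {F : ℂ} {lam : ℝ} (hl : 0 < lam) (hF : 0 ≤ F.re)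
    (hle : lam ≤ ‖F‖) : 1 / 2 ≤ (F / (F + lam)).re := by
  have hsq : lam ^ 2 ≤ Complex.normSq F := by
    rw [Complex.normSq_eq_norm_sq]
    gcongr
  have hpos : 0 < Complex.normSq (F + lam) := Complex.normSq_pos.2 (add_ofReal_ne_zero hl hF)
  rw [Complex.div_re, ← add_div, le_div_iff₀ hpos]
  rw [Complex.normSq_apply] at hsq ⊢
  simp only [Complex.add_re, Complex.add_im, Complex.ofReal_re, Complex.ofReal_im, add_zero]
  nlinarith

section Nonneg

variable {f : Torus → ℝ} (hf : Integrable f m) (hf0 : ∀ t, 0 ≤ f t)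

include hf hf0

/-- The Möbius map `F ↦ F / (F + λ)` sends the right half plane to a disc in the right half plane
and `{λ ≤ |F|}` into `{1/2 ≤ Re}`, so the mean value property and Chebyshev's inequality apply. -/
theorem measure_le_norm_herglotz {r : ℝ} (hr : r ∈ Set.Ico (0 : ℝ) 1) {lam : ℝ} (hl : 0 < lam) :
    m {x : Torus | lam ≤ ‖herglotz f (r * fourier 1 x)‖} ≤
      ENNReal.ofReal (2 * (∫ t, f t ∂m) / lam) := by
  let Φ : ℂ → ℂ := fun z => herglotz f z / (herglotz f z + lam)
  have hre (x : Torus) : 0 ≤ (herglotz f (r * fourier 1 x)).re :=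
    re_herglotz_nonneg hf hf0 (mul_fourier_mem_ball hr 1 x)
  have hΦ : DifferentiableOn ℂ Φ (Metric.ball 0 1) :=
    (differentiableOn_herglotz hf).div ((differentiableOn_herglotz hf).add_const _)
      fun z hz => add_ofReal_ne_zero hl (re_herglotz_nonneg hf hf0 hz)
  have hint : Integrable (fun x : Torus => Φ (r * fourier 1 x)) m :=
    integrable_of_continuous (continuous_comp_mul_fourier hΦ.continuousOn hr)
  have hmean : ∫ x, (Φ (r * fourier 1 x)).re ∂m = (Φ 0).re := by
    rw [← integral_comp_mul_fourier hΦ hr]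
    exact integral_re hint
  have hf_int : 0 ≤ ∫ t, f t ∂m := integral_nonneg hf0
  have hΦ0 : (Φ 0).re ≤ (∫ t, f t ∂m) / lam := by
    simp only [Φ, herglotz_zero, ← Complex.ofReal_add, ← Complex.ofReal_div, Complex.ofReal_re]
    exact div_le_div_of_nonneg_left hf_int hl (by linarith)
  have hchebyshev := mul_meas_ge_le_integral_of_nonneg (μ := m)
    (Eventually.of_forall fun x => re_div_add_ofReal_nonneg hl (hre x)) hint.re (1 / 2)
  have hsubset : m.real {x : Torus | lam ≤ ‖herglotz f (r * fourier 1 x)‖} ≤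
      m.real {x : Torus | 1 / 2 ≤ (Φ (r * fourier 1 x)).re} :=
    measureReal_mono fun x hx => half_le_re_div_add_ofReal hl (hre x) hx
  rw [← ofReal_measureReal, mul_div_assoc]
  refine ENNReal.ofReal_le_ofReal ?_
  linarith [hmean]

theorem measure_lt_norm_cauchyInt {r : ℝ} (hr : r ∈ Set.Ico (0 : ℝ) 1) {lam : ℝ} (hl : 0 < lam) :
    m {x : Torus | lam < ‖cauchyInt (fun t => (f t : ℂ)) (r * fourier 1 x)‖} ≤
      ENNReal.ofReal (2 * (∫ t, f t ∂m) / lam) := by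
  rcases le_or_gt lam (∫ t, f t ∂m) with hle | hlt
  · refine prob_le_one.trans (ENNReal.one_le_ofReal.2 ?_)
    rw [le_div_iff₀ hl]
    linarith
  · refine (measure_mono fun x hx => ?_).trans (measure_le_norm_herglotz hf hf0 hr hl)
    rw [Set.mem_ofPred_eq] at hx ⊢
    have htriangle := norm_sub_norm_le (2 * cauchyInt (fun t => (f t : ℂ)) (r * fourier 1 x))
      ((∫ t, f t ∂m : ℝ) : ℂ)
    rw [norm_mul, Complex.norm_real, Real.norm_of_nonneg (integral_nonneg hf0),
      Complex.norm_ofNat] at htriangle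
    rw [herglotz, fourierCoeff_ofReal_zero]
    linarith

omit hf hf0 in
lemma measure_le_of_eventually_mem {α : Type*} [MeasurableSpace α] {μ : Measure α}
    {A : Set α} {S : ℕ → Set α} {c : ℝ≥0∞} (hA : ∀ x ∈ A, ∀ᶠ n in atTop, x ∈ S n)
    (hS : ∀ n, μ (S n) ≤ c) : μ A ≤ c := by
  have hsubset : A ⊆ ⋃ k, ⋂ n ≥ k, S n := fun x hx => by
    obtain ⟨k, hk⟩ := eventually_atTop.1 (hA x hx)
    exact Set.mem_iUnion.2 ⟨k, Set.mem_iInter₂.2 hk⟩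
  have hmono : Monotone fun k => ⋂ n ≥ k, S n := fun i j hij =>
    Set.biInter_subset_biInter_left fun n hn => le_trans hij hn
  refine (measure_mono hsubset).trans (hmono.measure_iUnion.trans_le ?_)
  exact iSup_le fun k => (measure_mono (Set.biInter_subset_of_mem le_rfl)).trans (hS k)

omit hf hf0 in
lemma exists_seq_tendsto_one : ∃ u : ℕ → ℝ, (∀ n, u n ∈ Set.Ioo (0 : ℝ) 1) ∧
    Tendsto u atTop (𝓝[<] 1) := by
  obtain ⟨u, -, hmem, hlim⟩ := exists_seq_strictMono_tendsto' (zero_lt_one' ℝ)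
  exact ⟨u, hmem, tendsto_nhdsWithin_iff.2 ⟨hlim, Eventually.of_forall fun n => (hmem n).2⟩⟩

lemma ae_not_tendsto_norm_herglotz_atTop :
    ∀ᵐ x ∂m, ¬ Tendsto (fun r : ℝ => ‖herglotz f (r * fourier 1 x)‖) (𝓝[<] 1) atTop := by
  obtain ⟨u, hmem, hu⟩ := exists_seq_tendsto_one
  have hbound (N : ℕ) :
      m {x | ¬ ¬ Tendsto (fun r : ℝ => ‖herglotz f (r * fourier 1 x)‖) (𝓝[<] 1) atTop} ≤
        ENNReal.ofReal (2 * (∫ t, f t ∂m) / ((N : ℝ) + 1)) :=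
    measure_le_of_eventually_mem (fun x hx => ((not_not.1 hx).comp hu).eventually_ge_atTop _)
      fun n => measure_le_norm_herglotz hf hf0 ⟨(hmem n).1.le, (hmem n).2⟩ (by positivity)
  have hlim : Tendsto (fun N : ℕ => ENNReal.ofReal (2 * (∫ t, f t ∂m) / ((N : ℝ) + 1))) atTop
      (𝓝 0) := by
    rw [← ENNReal.ofReal_zero]
    exact ENNReal.tendsto_ofReal (tendsto_const_nhds.div_atTop
      (tendsto_atTop_add_const_right _ _ tendsto_natCast_atTop_atTop))
  exact le_antisymm (ge_of_tendsto' hlim hbound) bot_le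

/-- The bounded analytic function `1 / (herglotz f + 1)` has radial limits a.e., and these are
nonzero a.e. by the weak type estimate. -/
theorem ae_exists_tendsto_cauchyInt_of_nonneg : ∀ᵐ x ∂m, ∃ l,
    Tendsto (fun r : ℝ => cauchyInt (fun t => (f t : ℂ)) (r * fourier 1 x)) (𝓝[<] 1) (𝓝 l) := by
  let G : ℂ → ℂ := fun z => (herglotz f z + (1 : ℝ))⁻¹
  have hG : DifferentiableOn ℂ G (Metric.ball 0 1) :=
    ((differentiableOn_herglotz hf).add_const _).inv fun z hz =>
      add_ofReal_ne_zero one_pos (re_herglotz_nonneg hf hf0 hz)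
  have hGbound : ∀ z ∈ Metric.ball (0 : ℂ) 1, ‖G z‖ ≤ 1 := fun z hz => by
    rw [norm_inv]
    refine inv_le_one_of_one_le₀ (le_trans ?_ (Complex.re_le_norm _))
    rw [Complex.add_re, Complex.ofReal_re]
    linarith [re_herglotz_nonneg hf hf0 hz]
  filter_upwards [ae_exists_tendsto_of_bounded hG hGbound,
    ae_not_tendsto_norm_herglotz_atTop hf hf0] with x ⟨l, hl⟩ hx
  have hherglotz (z : ℂ) : herglotz f z = (G z)⁻¹ - (1 : ℝ) := by simp only [G]; simp
  have hl0 : l ≠ 0 := by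
    rintro rfl
    have hne : ∀ᶠ r : ℝ in 𝓝[<] 1, G (r * fourier 1 x) ≠ 0 := by
      filter_upwards [eventually_mem_Ioo_zero_one] with r hr
      exact inv_ne_zero (add_ofReal_ne_zero one_pos
        (re_herglotz_nonneg hf hf0 (mul_fourier_mem_ball ⟨hr.1.le, hr.2⟩ 1 x)))
    have hinv := tendsto_norm_inv_nhdsNE_zero_atTop.comp
      (tendsto_nhdsWithin_iff.2 ⟨hl, hne⟩)
    refine hx (tendsto_atTop_mono (fun r => ?_) (tendsto_atTop_add_const_right _ (-1) hinv))
    rw [hherglotz, ← sub_eq_add_neg]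
    simpa using norm_sub_norm_le (G (r * fourier 1 x))⁻¹ (1 : ℝ)
  refine ⟨(l⁻¹ - (1 : ℝ) + fourierCoeff (fun t => (f t : ℂ)) 0) / 2, ?_⟩
  refine ((((hl.inv₀ hl0).sub_const _).add_const _).div_const 2).congr fun r => ?_
  rw [← hherglotz, herglotz]
  ring

end Nonneg

/-! ### M. Riesz's inequality for even exponents -/

lemma norm_pow_sub_pow_le {R : Type*} [NormedCommRing R] [NormOneClass R] {a b : R} {M : ℝ}
    (ha : ‖a‖ ≤ M) (hb : ‖b‖ ≤ M) (n : ℕ) : ‖a ^ n - b ^ n‖ ≤ n * ‖a - b‖ * M ^ (n - 1) := by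
  have hM : 0 ≤ M := (norm_nonneg a).trans ha
  have hterm : ∀ i ∈ Finset.range n, ‖a ^ i * b ^ (n - 1 - i)‖ ≤ M ^ (n - 1) := fun i hi => by
    rw [Finset.mem_range] at hi
    calc ‖a ^ i * b ^ (n - 1 - i)‖ ≤ ‖a‖ ^ i * ‖b‖ ^ (n - 1 - i) :=
          (norm_mul_le _ _).trans (mul_le_mul (norm_pow_le _ _) (norm_pow_le _ _)
            (norm_nonneg _) (by positivity))
      _ ≤ M ^ i * M ^ (n - 1 - i) := by gcongr
      _ = M ^ (n - 1) := by rw [← pow_add, Nat.add_sub_cancel' (by omega)]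
  have hsum : ‖∑ i ∈ Finset.range n, a ^ i * b ^ (n - 1 - i)‖ ≤ n * M ^ (n - 1) := by
    simpa using norm_sum_le_of_le _ hterm
  rw [← (Commute.all a b).geom_sum₂_mul]
  calc _ ≤ (n * M ^ (n - 1)) * ‖a - b‖ := norm_mul_le_of_le hsum le_rfl
    _ = _ := by ring

lemma abs_neg_one_pow_mul_re_pow_sub_le (k : ℕ) (z : ℂ) :
    |(-1) ^ k * (z ^ (2 * k)).re - z.im ^ (2 * k)| ≤ 2 * k * |z.re| * ‖z‖ ^ (2 * k - 1) := by
  have himI : ‖(z.im : ℂ) * Complex.I‖ ≤ ‖z‖ := by simpa using Complex.abs_im_le_norm z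
  have hre : z - (z.im : ℂ) * Complex.I = (z.re : ℂ) := sub_eq_of_eq_add (Complex.re_add_im z).symm
  have hpow : (-1) ^ k * ((z.im : ℂ) * Complex.I) ^ (2 * k) = ((z.im ^ (2 * k) : ℝ) : ℂ) := by
    rw [mul_pow, pow_mul Complex.I, Complex.I_sq, mul_left_comm, ← mul_pow, neg_one_mul, neg_neg,
      one_pow, mul_one, Complex.ofReal_pow]
  have hle := norm_pow_sub_pow_le (le_refl ‖z‖) himI (2 * k)
  rw [hre, Complex.norm_real, Real.norm_eq_abs] at hle
  calc |(-1) ^ k * (z ^ (2 * k)).re - z.im ^ (2 * k)|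
      = |((-1) ^ k * (z ^ (2 * k) - ((z.im : ℂ) * Complex.I) ^ (2 * k))).re| := by
        rw [mul_sub, hpow, Complex.sub_re, Complex.ofReal_re]
        congr 2
        exact_mod_cast (Complex.re_ofReal_mul ((-1) ^ k) (z ^ (2 * k))).symm
    _ ≤ ‖z ^ (2 * k) - ((z.im : ℂ) * Complex.I) ^ (2 * k)‖ := by
        simpa using Complex.abs_re_le_norm
          ((-1) ^ k * (z ^ (2 * k) - ((z.im : ℂ) * Complex.I) ^ (2 * k)))
    _ ≤ _ := by exact_mod_cast hle

lemma norm_pow_sub_im_pow_le (k : ℕ) (z : ℂ) :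
    ‖z‖ ^ (2 * k) - z.im ^ (2 * k) ≤ 2 * k * |z.re| * ‖z‖ ^ (2 * k - 1) := by
  have hle := norm_pow_sub_pow_le (a := ‖z‖) (b := |z.im|) (M := ‖z‖) (by simp)
    (by simpa using Complex.abs_im_le_norm z) (2 * k)
  have hdist : ‖‖z‖ - |z.im|‖ ≤ |z.re| := by
    rw [Real.norm_of_nonneg (sub_nonneg.2 (Complex.abs_im_le_norm z))]
    linarith [Complex.norm_le_abs_re_add_abs_im z]
  rw [(even_two_mul k).pow_abs] at hle
  refine (le_abs_self _).trans (hle.trans ?_)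
  push_cast
  gcongr

/-- If `|Re z|` is at most a small multiple of `|z|`, then `z` is nearly imaginary and
`(-1)^k z^(2k)` nearly equal to `|z|^(2k)`; otherwise the second term dominates. -/
lemma norm_pow_le_re_pow_add {k : ℕ} (hk : k ≠ 0) (z : ℂ) :
    ‖z‖ ^ (2 * k) ≤ 2 * ((-1) ^ k * (z ^ (2 * k)).re) +
      3 * (8 * k) ^ (2 * k) * z.re ^ (2 * k) := by
  rcases le_or_gt (8 * k * |z.re|) ‖z‖ with hle | hlt
  · have hsmall : 2 * k * |z.re| * ‖z‖ ^ (2 * k - 1) ≤ ‖z‖ ^ (2 * k) / 4 := by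
      rw [← mul_pow_sub_one (by omega : 2 * k ≠ 0) ‖z‖]
      nlinarith [pow_nonneg (norm_nonneg z) (2 * k - 1)]
    have hpos : 0 ≤ 3 * (8 * (k : ℝ)) ^ (2 * k) * z.re ^ (2 * k) :=
      mul_nonneg (by positivity) ((even_two_mul k).pow_nonneg _)
    linarith [(abs_le.1 (abs_neg_one_pow_mul_re_pow_sub_le k z)).1, norm_pow_sub_im_pow_le k z]
  · have hlarge : ‖z‖ ^ (2 * k) ≤ (8 * k) ^ (2 * k) * z.re ^ (2 * k) := by
      rw [← (even_two_mul k).pow_abs z.re, ← mul_pow]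
      gcongr
    have hre : |(-1 : ℝ) ^ k * (z ^ (2 * k)).re| ≤ ‖z‖ ^ (2 * k) := by
      rw [abs_mul, abs_neg_one_pow, one_mul, ← norm_pow]
      exact Complex.abs_re_le_norm _
    linarith [(abs_le.1 hre).1]

section Jensen

variable {α : Type*} [MeasurableSpace α] {μ : Measure α} {f : α → ℝ} {M : ℝ}

lemma integrable_of_nonneg_of_le [IsFiniteMeasure μ] (hf : Measurable f) (hf0 : ∀ t, 0 ≤ f t)
    (hfM : ∀ t, f t ≤ M) : Integrable f μ :=
  Integrable.of_bound hf.aestronglyMeasurable M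
    (Eventually.of_forall fun t => (Real.norm_of_nonneg (hf0 t)).trans_le (hfM t))

lemma pow_integral_le_integral_pow [IsProbabilityMeasure μ] (hf : Measurable f)
    (hf0 : ∀ t, 0 ≤ f t) (hfM : ∀ t, f t ≤ M) (p : ℕ) :
    (∫ t, f t ∂μ) ^ p ≤ ∫ t, f t ^ p ∂μ :=
  (convexOn_pow p).map_integral_le (continuous_pow p).continuousOn isClosed_Ici
    (Eventually.of_forall hf0) (integrable_of_nonneg_of_le hf hf0 hfM)
    (integrable_of_nonneg_of_le (hf.pow_const p) (fun t => pow_nonneg (hf0 t) p)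
      fun t => pow_le_pow_left₀ (hf0 t) (hfM t) p)

lemma pow_integral_mul_le_integral_mul_pow {w : α → ℝ} (hw : Measurable w) (hw0 : ∀ t, 0 ≤ w t)
    (hw1 : ∫ t, w t ∂μ = 1) (hf : Measurable f) (hf0 : ∀ t, 0 ≤ f t) (hfM : ∀ t, f t ≤ M)
    (p : ℕ) : (∫ t, w t * f t ∂μ) ^ p ≤ ∫ t, w t * f t ^ p ∂μ := by
  have hint : Integrable w μ := .of_integral_ne_zero (by simp [hw1])
  let ν := μ.withDensity fun t => ENNReal.ofReal (w t)
  have : IsProbabilityMeasure ν := ⟨by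
    rw [withDensity_apply _ .univ, setLIntegral_univ,
      ← ofReal_integral_eq_lintegral_ofReal hint (Eventually.of_forall hw0), hw1,
      ENNReal.ofReal_one]⟩
  have hν (g : α → ℝ) : ∫ t, g t ∂ν = ∫ t, w t * g t ∂μ := by
    rw [integral_withDensity_eq_integral_toReal_smul hw.ennreal_ofReal (by simp)]
    simp only [ENNReal.toReal_ofReal (hw0 _), smul_eq_mul]
  simpa only [hν] using pow_integral_le_integral_pow (μ := ν) hf hf0 hfM p

end Jensen

section EvenExponent

variable {f : Torus → ℝ} (hf : Measurable f) {M : ℝ} (hf0 : ∀ t, 0 ≤ f t) (hfM : ∀ t, f t ≤ M)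
  {r : ℝ} (hr : r ∈ Set.Ico (0 : ℝ) 1)

include hf hf0 hfM hr

lemma integrable_circlePoissonKernel_sub_mul_pow (p : ℕ) :
    Integrable (fun y : Torus × Torus => circlePoissonKernel r (y.1 - y.2) * f y.2 ^ p)
      (m.prod m) := by
  have hpow := integrable_of_nonneg_of_le (μ := m) (hf.pow_const p)
    (fun t => pow_nonneg (hf0 t) p) fun t => pow_le_pow_left₀ (hf0 t) (hfM t) p
  have hcont : Continuous fun y : Torus × Torus => circlePoissonKernel r (y.1 - y.2) :=
    (continuous_circlePoissonKernel hr).comp continuous_sub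
  obtain ⟨C, hC⟩ := isCompact_univ.exists_bound_of_continuousOn hcont.continuousOn
  exact (hpow.comp_snd m).bdd_mul hcont.aestronglyMeasurable
    (Eventually.of_forall fun y => hC y (Set.mem_univ y))

lemma integral_re_herglotz_pow_le (p : ℕ) :
    ∫ x, (herglotz f (r * fourier 1 x)).re ^ p ∂m ≤ ∫ t, f t ^ p ∂m := by
  have hfi : Integrable f m := integrable_of_nonneg_of_le hf hf0 hfM
  have hprod := integrable_circlePoissonKernel_sub_mul_pow hf hf0 hfM hr p
  have hcont := (continuous_comp_mul_fourier (T := 2 * π)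
    (differentiableOn_herglotz hfi).continuousOn hr)
  have hkernel (x : Torus) : Measurable fun t => circlePoissonKernel r (x - t) :=
    ((continuous_circlePoissonKernel hr).comp (continuous_sub_left x)).measurable
  calc ∫ x, (herglotz f (r * fourier 1 x)).re ^ p ∂m
      ≤ ∫ x, (∫ t, circlePoissonKernel r (x - t) * f t ^ p ∂m) ∂m := by
        refine integral_mono (integrable_of_continuous
          ((Complex.continuous_re.comp hcont).pow p)) hprod.integral_prod_left fun x => ?_
        rw [re_herglotz_eq hfi hr]
        exact pow_integral_mul_le_integral_mul_pow (hkernel x)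
          (fun t => circlePoissonKernel_nonneg hr _) (integral_circlePoissonKernel_sub hr x)
          hf hf0 hfM p
    _ = ∫ t, (∫ x, circlePoissonKernel r (x - t) * f t ^ p ∂m) ∂m := integral_integral_swap hprod
    _ = ∫ t, f t ^ p ∂m := by
        simp only [integral_mul_const, integral_sub_right_eq_self (circlePoissonKernel r),
          integral_circlePoissonKernel hr, one_mul]

omit hf0 hfM hf in
lemma integral_re_herglotz_pow (hf : Integrable f m) (n : ℕ) :
    ∫ x, (herglotz f (r * fourier 1 x) ^ n).re ∂m = (∫ t, f t ∂m) ^ n := by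
  have hdiff := (differentiableOn_herglotz hf).pow n
  have hre := integral_re (integrable_of_continuous (μ := m)
    (continuous_comp_mul_fourier (T := 2 * π) hdiff.continuousOn hr))
  rw [integral_comp_mul_fourier hdiff hr] at hre
  simpa [herglotz_zero, ← Complex.ofReal_pow] using hre

lemma integral_norm_herglotz_pow_le {k : ℕ} (hk : k ≠ 0) :
    ∫ x, ‖herglotz f (r * fourier 1 x)‖ ^ (2 * k) ∂m ≤
      (2 + 3 * (8 * k) ^ (2 * k)) * ∫ t, f t ^ (2 * k) ∂m := by
  have hfi : Integrable f m := integrable_of_nonneg_of_le hf hf0 hfM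
  have hcont := (continuous_comp_mul_fourier (T := 2 * π)
    (differentiableOn_herglotz hfi).continuousOn hr)
  have hint₁ : Integrable (fun x : Torus => (herglotz f (r * fourier 1 x) ^ (2 * k)).re) m :=
    integrable_of_continuous (Complex.continuous_re.comp (hcont.pow _))
  have hint₂ : Integrable (fun x : Torus => (herglotz f (r * fourier 1 x)).re ^ (2 * k)) m :=
    integrable_of_continuous ((Complex.continuous_re.comp hcont).pow _)
  have hmean : (-1) ^ k * (∫ t, f t ∂m) ^ (2 * k) ≤ ∫ t, f t ^ (2 * k) ∂m := by
    refine le_trans ?_ (pow_integral_le_integral_pow hf hf0 hfM _)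
    refine (le_abs_self _).trans_eq ?_
    rw [abs_mul, abs_neg_one_pow, one_mul, abs_of_nonneg ((even_two_mul k).pow_nonneg _)]
  calc ∫ x, ‖herglotz f (r * fourier 1 x)‖ ^ (2 * k) ∂m
      ≤ ∫ x, (2 * ((-1) ^ k * (herglotz f (r * fourier 1 x) ^ (2 * k)).re) +
          3 * (8 * k) ^ (2 * k) * (herglotz f (r * fourier 1 x)).re ^ (2 * k)) ∂m :=
        integral_mono (integrable_of_continuous (hcont.norm.pow _))
          (((hint₁.const_mul _).const_mul _).add (hint₂.const_mul _))
          fun x => norm_pow_le_re_pow_add hk _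
    _ = 2 * ((-1) ^ k * (∫ t, f t ∂m) ^ (2 * k)) +
          3 * (8 * k) ^ (2 * k) * ∫ x, (herglotz f (r * fourier 1 x)).re ^ (2 * k) ∂m := by
        rw [integral_add ((hint₁.const_mul _).const_mul _) (hint₂.const_mul _)]
        simp only [integral_const_mul, integral_re_herglotz_pow hr hfi]
    _ ≤ 2 * ∫ t, f t ^ (2 * k) ∂m + 3 * (8 * k) ^ (2 * k) * ∫ t, f t ^ (2 * k) ∂m := by
        exact add_le_add (mul_le_mul_of_nonneg_left hmean zero_le_two)
          (mul_le_mul_of_nonneg_left (integral_re_herglotz_pow_le hf hf0 hfM hr _)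
            (by positivity))
    _ = _ := by ring

omit hf hfM hr in
lemma norm_cauchyInt_pow_le (p : ℕ) (z : ℂ) :
    ‖cauchyInt (fun t => (f t : ℂ)) z‖ ^ p ≤ ‖herglotz f z‖ ^ p + (∫ t, f t ∂m) ^ p := by
  have hmean : 0 ≤ ∫ t, f t ∂m := integral_nonneg hf0
  have hcauchy : 2 * cauchyInt (fun t => (f t : ℂ)) z = herglotz f z + (∫ t, f t ∂m : ℝ) := by
    rw [herglotz, fourierCoeff_ofReal_zero, sub_add_cancel]
  have hnorm : 2 * ‖cauchyInt (fun t => (f t : ℂ)) z‖ ≤ ‖herglotz f z‖ + ∫ t, f t ∂m := by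
    have htriangle := norm_add_le (herglotz f z) ((∫ t, f t ∂m : ℝ) : ℂ)
    rwa [← hcauchy, norm_mul, Complex.norm_ofNat, Complex.norm_real,
      Real.norm_of_nonneg hmean] at htriangle
  rcases le_total ‖herglotz f z‖ (∫ t, f t ∂m) with hle | hle
  · exact (pow_le_pow_left₀ (norm_nonneg _) (by linarith) p).trans
      (le_add_of_nonneg_left (by positivity))
  · exact (pow_le_pow_left₀ (norm_nonneg _) (by linarith) p).trans
      (le_add_of_nonneg_right (by positivity))

theorem integral_norm_cauchyInt_pow_le {k : ℕ} (hk : k ≠ 0) :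
    ∫ x, ‖cauchyInt (fun t => (f t : ℂ)) (r * fourier 1 x)‖ ^ (2 * k) ∂m ≤
      (3 + 3 * (8 * k) ^ (2 * k)) * ∫ t, f t ^ (2 * k) ∂m := by
  have hfi : Integrable f m := integrable_of_nonneg_of_le hf hf0 hfM
  have hherglotz : Integrable (fun x : Torus => ‖herglotz f (r * fourier 1 x)‖ ^ (2 * k)) m :=
    integrable_of_continuous ((continuous_comp_mul_fourier
      (differentiableOn_herglotz hfi).continuousOn hr).norm.pow _)
  have hcauchy : Integrable (fun x : Torus =>
      ‖cauchyInt (fun t => (f t : ℂ)) (r * fourier 1 x)‖ ^ (2 * k)) m :=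
    integrable_of_continuous ((continuous_comp_mul_fourier
      (differentiableOn_cauchyInt hfi.ofReal).continuousOn hr).norm.pow _)
  have hle := integral_mono hcauchy (hherglotz.add (integrable_const _))
    fun x => norm_cauchyInt_pow_le hf0 (2 * k) _
  simp only [Pi.add_apply, integral_add hherglotz (integrable_const _), integral_const,
    probReal_univ, one_smul] at hle
  linarith [integral_norm_herglotz_pow_le hf hf0 hfM hr hk,
    pow_integral_le_integral_pow (μ := m) hf hf0 hfM (2 * k)]

end EvenExponent

/-! ### Riesz projections of integrable functions -/

/-- The four nonnegative parts of a complex number, `z = ∑ k, I ^ k * part k z`; they reduce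
estimates for the linear operator `f ↦ cauchyInt f` to nonnegative functions. -/
def part (k : Fin 4) (z : ℂ) : ℝ := max ((-Complex.I) ^ (k : ℕ) * z).re 0

lemma part_nonneg (k : Fin 4) (z : ℂ) : 0 ≤ part k z := le_max_right _ _

lemma part_le_norm (k : Fin 4) (z : ℂ) : part k z ≤ ‖z‖ := by
  refine max_le ((Complex.re_le_norm _).trans_eq ?_) (norm_nonneg z)
  rw [norm_mul, norm_pow, norm_neg, Complex.norm_I, one_pow, one_mul]

lemma continuous_part (k : Fin 4) : Continuous (part k) :=
  (Complex.continuous_re.comp (continuous_const.mul continuous_id)).max continuous_const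

lemma sum_I_pow_mul_part (z : ℂ) : ∑ k : Fin 4, Complex.I ^ (k : ℕ) * (part k z : ℂ) = z := by
  have hsub (a : ℝ) : max a 0 - max (-a) 0 = a := by
    rcases le_total a 0 with ha | ha <;> simp [ha]
  have hsq : (-Complex.I) ^ 2 = -1 := by rw [neg_sq, Complex.I_sq]
  have hneg_cube : (-Complex.I) ^ 3 = Complex.I := by rw [pow_succ, hsq]; ring
  have hcube : Complex.I ^ 3 = -Complex.I := by rw [pow_succ, Complex.I_sq]; ring
  rw [Fin.sum_univ_four]
  apply Complex.ext
  · simp [part, hsq, hneg_cube, hcube]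
    linarith [hsub z.re]
  · simp [part, hsq, hneg_cube, hcube]
    linarith [hsub z.im]

lemma integrable_part {α : Type*} [MeasurableSpace α] {μ : Measure α} {f : α → ℂ}
    (hf : Integrable f μ) (k : Fin 4) : Integrable (fun t => part k (f t)) μ :=
  hf.mono ((continuous_part k).comp_aestronglyMeasurable hf.1)
    (Eventually.of_forall fun t => by
      rw [Real.norm_of_nonneg (part_nonneg _ _)]
      exact part_le_norm _ _)

lemma norm_mul_fourier_lt_one {r : ℝ} (hr : r ∈ Set.Ioo (0 : ℝ) 1) (x : Torus) :
    ‖(r : ℂ) * fourier 1 x‖ < 1 :=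
  mem_ball_zero_iff.1 (mul_fourier_mem_ball ⟨hr.1.le, hr.2⟩ 1 x)

/-- `g` is the radial boundary function of the Cauchy integral of `f`; for integrable `f` this
means that `g` is the Riesz projection of `f`. -/
def IsCauchyLimit (f g : Torus → ℂ) : Prop :=
  ∀ᵐ x ∂m, Tendsto (fun r : ℝ => cauchyInt f (r * fourier 1 x)) (𝓝[<] 1) (𝓝 (g x))

section CauchyLimit

variable {f : Torus → ℂ} (hf : Integrable f m)

include hf

lemma cauchyInt_eq_sum_part {z : ℂ} (hz : ‖z‖ < 1) :
    cauchyInt f z =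
      ∑ k : Fin 4, Complex.I ^ (k : ℕ) * cauchyInt (fun t => (part k (f t) : ℂ)) z := by
  simp only [cauchyInt, ← integral_const_mul]
  rw [← integral_finsetSum]
  swap
  · exact fun k _ =>
      (integrable_cauchyKernel_mul (integrable_part hf k).ofReal hz).const_mul _
  refine integral_congr_ae (Eventually.of_forall fun t => ?_)
  simp only
  nth_rewrite 1 [← sum_I_pow_mul_part (f t)]
  simp only [Finset.mul_sum, mul_left_comm]

theorem ae_exists_tendsto_cauchyInt :
    ∀ᵐ x ∂m, ∃ l, Tendsto (fun r : ℝ => cauchyInt f (r * fourier 1 x)) (𝓝[<] 1) (𝓝 l) := by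
  have hparts : ∀ᵐ x ∂m, ∀ k : Fin 4, ∃ l, Tendsto (fun r : ℝ =>
      cauchyInt (fun t => (part k (f t) : ℂ)) (r * fourier 1 x)) (𝓝[<] 1) (𝓝 l) :=
    ae_all_iff.2 fun k => ae_exists_tendsto_cauchyInt_of_nonneg (integrable_part hf k)
      fun t => part_nonneg _ _
  filter_upwards [hparts] with x hx
  choose l hl using hx
  refine ⟨∑ k : Fin 4, Complex.I ^ (k : ℕ) * l k,
    (tendsto_finsetSum _ fun k _ => (hl k).const_mul _).congr' ?_⟩
  filter_upwards [eventually_mem_Ioo_zero_one] with r hr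
  exact (cauchyInt_eq_sum_part hf (norm_mul_fourier_lt_one hr x)).symm

lemma continuous_cauchyInt_circle {r : ℝ} (hr : r ∈ Set.Ico (0 : ℝ) 1) :
    Continuous fun x : Torus => cauchyInt f (r * fourier 1 x) :=
  continuous_comp_mul_fourier (differentiableOn_cauchyInt hf).continuousOn hr

theorem exists_isCauchyLimit : ∃ g : L0, IsCauchyLimit f g := by
  obtain ⟨u, hmem, hu⟩ := exists_seq_tendsto_one
  have hradial := ae_exists_tendsto_cauchyInt hf
  obtain ⟨g, hg, hlim⟩ := measurable_limit_of_tendsto_metrizable_ae (μ := m) (L := atTop)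
    (f := fun (n : ℕ) (x : Torus) => cauchyInt f (u n * fourier 1 x))
    (fun n => (continuous_cauchyInt_circle hf ⟨(hmem n).1.le, (hmem n).2⟩).aemeasurable)
    (hradial.mono fun x ⟨l, hl⟩ => ⟨l, hl.comp hu⟩)
  refine ⟨AEEqFun.mk g hg.aestronglyMeasurable, ?_⟩
  filter_upwards [hradial, hlim, AEEqFun.coeFn_mk g hg.aestronglyMeasurable] with x ⟨l, hl⟩ hx hgx
  rw [hgx, tendsto_nhds_unique hx (hl.comp hu)]
  exact hl

lemma measure_lt_norm_cauchyInt_le {r : ℝ} (hr : r ∈ Set.Ioo (0 : ℝ) 1) {lam : ℝ}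
    (hlam : 0 < lam) :
    m {x : Torus | 4 * lam < ‖cauchyInt f (r * fourier 1 x)‖} ≤
      ENNReal.ofReal (8 * (∫ t, ‖f t‖ ∂m) / lam) := by
  let S (k : Fin 4) : Set Torus :=
    {x | lam < ‖cauchyInt (fun t => (part k (f t) : ℂ)) (r * fourier 1 x)‖}
  have hsubset : {x : Torus | 4 * lam < ‖cauchyInt f (r * fourier 1 x)‖} ⊆ ⋃ k, S k := by
    intro x hx
    by_contra hnot
    simp only [S, Set.mem_iUnion, Set.mem_ofPred_eq, not_exists, not_lt] at hnot hx
    rw [cauchyInt_eq_sum_part hf (norm_mul_fourier_lt_one hr x)] at hx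
    refine hx.not_ge ((norm_sum_le _ _).trans
      ((Finset.sum_le_card_nsmul _ _ lam fun k _ => ?_).trans_eq (by simp)))
    rw [norm_mul, norm_pow, Complex.norm_I, one_pow, one_mul]
    exact hnot k
  have hS (k : Fin 4) : m (S k) ≤ ENNReal.ofReal (2 * (∫ t, ‖f t‖ ∂m) / lam) := by
    refine (measure_lt_norm_cauchyInt (integrable_part hf k) (fun t => part_nonneg _ _)
      ⟨hr.1.le, hr.2⟩ hlam).trans (ENNReal.ofReal_le_ofReal ?_)
    have hle := integral_mono (integrable_part hf k) hf.norm fun t => part_le_norm k (f t)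
    gcongr
  refine (measure_mono hsubset).trans ((measure_iUnion_fintype_le _ _).trans
    ((Finset.sum_le_card_nsmul _ _ _ fun k _ => hS k).trans_eq ?_))
  rw [← ENNReal.ofReal_nsmul, Finset.card_univ, Fintype.card_fin, nsmul_eq_mul]
  congr 1
  push_cast
  ring

theorem measure_lt_norm_of_isCauchyLimit {g : Torus → ℂ} (hg : IsCauchyLimit f g) {lam : ℝ}
    (hlam : 0 < lam) :
    m {x | 4 * lam < ‖g x‖} ≤ ENNReal.ofReal (8 * (∫ t, ‖f t‖ ∂m) / lam) := by
  obtain ⟨u, hmem, hu⟩ := exists_seq_tendsto_one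
  rw [← measure_inter_conull (s := {x | 4 * lam < ‖g x‖}) hg]
  exact measure_le_of_eventually_mem
    (fun x hx => ((hx.2.comp hu).norm).eventually (lt_mem_nhds hx.1))
    fun n => measure_lt_norm_cauchyInt_le hf (hmem n) hlam

end CauchyLimit

lemma tendsto_cauchyInt_iff {f : L0} (hf : Integrable f m) {x : Torus}
    (hx : Tendsto (fun r : ℝ => poissonInt f r x) (𝓝[<] 1) (𝓝 (f x))) (l : ℂ) :
    Tendsto (fun r : ℝ => cauchyInt f (r * fourier 1 x)) (𝓝[<] 1)
        (𝓝 (1 / 2 * (f x + Complex.I * l + fourierCoeff f 0))) ↔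
      Tendsto (fun r : ℝ => conjPoisson f r x) (𝓝[<] 1) (𝓝 l) := by
  have hcauchy : ∀ᶠ r : ℝ in 𝓝[<] 1, 2 * cauchyInt f (r * fourier 1 x) - fourierCoeff f 0 =
      poissonInt f r x + Complex.I * conjPoisson f r x := by
    filter_upwards [eventually_mem_Ioo_zero_one] with r hr
    exact two_mul_cauchyInt_sub hf ⟨hr.1.le, hr.2⟩ x
  constructor <;> intro h
  · have hlim := (((h.const_mul 2).sub_const (fourierCoeff f 0)).sub hx).const_mul (-Complex.I)
    have hval : -Complex.I * (2 * (1 / 2 * (f x + Complex.I * l + fourierCoeff f 0)) -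
        fourierCoeff f 0 - f x) = l := by
      linear_combination (-l) * Complex.I_mul_I
    rw [hval] at hlim
    refine hlim.congr' ?_
    filter_upwards [hcauchy] with r hr
    rw [hr]
    linear_combination (-conjPoisson f r x) * Complex.I_mul_I
  · refine (((hx.add (h.const_mul Complex.I)).add_const _).const_mul _).congr' ?_
    filter_upwards [hcauchy] with r hr
    rw [← hr]
    ring

lemma isCauchyLimit_iff_isConjugateFunction {f : L0} (hf : Integrable f m) (h : L0) :
    IsCauchyLimit f
        ((1 / 2 : ℂ) • (f + Complex.I • h + AEEqFun.const Torus (fourierCoeff f 0)) : L0) ↔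
      IsConjugateFunction f h := by
  refine eventually_congr ?_
  filter_upwards [ae_tendsto_poissonInt hf,
    AEEqFun.coeFn_smul (1 / 2 : ℂ) (f + Complex.I • h + AEEqFun.const Torus (fourierCoeff f 0)),
    AEEqFun.coeFn_add (f + Complex.I • h) (AEEqFun.const Torus (fourierCoeff f 0)),
    AEEqFun.coeFn_add f (Complex.I • h), AEEqFun.coeFn_smul Complex.I h,
    AEEqFun.coeFn_const (μ := m) Torus (fourierCoeff f 0)] with x hx hhalf hsum hadd hI hconst
  rw [hhalf, Pi.smul_apply, hsum, Pi.add_apply, hadd, Pi.add_apply, hI, Pi.smul_apply, hconst,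
    Function.const_apply, smul_eq_mul, smul_eq_mul]
  exact tendsto_cauchyInt_iff hf hx (h x)

theorem isRieszProjection_iff {f g : L0} :
    IsRieszProjection f g ↔ Integrable f m ∧ IsCauchyLimit f g := by
  refine and_congr_right fun hf => ⟨?_, fun hg => ?_⟩
  · rintro ⟨h, hh, rfl⟩
    exact (isCauchyLimit_iff_isConjugateFunction hf h).2 hh
  · let h : L0 := (-Complex.I) • ((2 : ℂ) • g - f - AEEqFun.const Torus (fourierCoeff f 0))
    have hgh :
        g = (1 / 2 : ℂ) • (f + Complex.I • h + AEEqFun.const Torus (fourierCoeff f 0)) := by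
      simp only [h, smul_smul, mul_neg, Complex.I_mul_I, neg_neg, one_smul]
      module
    refine ⟨h, (isCauchyLimit_iff_isConjugateFunction hf h).1 ?_, hgh⟩
    rwa [← hgh]

/-! ### Shifted Riesz projections recover the function -/

/-- `p` is reproduced by the Riesz projection after multiplication by any high power of `e^{ix}`,
as trigonometric polynomials are. -/
def IsShiftAnalytic (p : Torus → ℂ) : Prop :=
  ∃ n₀ : ℕ, ∀ n : ℕ, n₀ ≤ n →
    IsCauchyLimit (fun t => fourier n t * p t) (fun x => fourier n x * p x)

lemma cauchyInt_fourier (n : ℕ) {z : ℂ} (hz : ‖z‖ < 1) :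
    cauchyInt (fun t => fourier n t) z = z ^ n := by
  have hint : Integrable (fun t : Torus => fourier n t) m :=
    integrable_of_continuous (fourier n).continuous
  have hcoeff (k : ℕ) :
      fourierCoeff (fun t : Torus => fourier n t) k * z ^ k = if k = n then z ^ n else 0 := by
    rw [show (fun t : Torus => fourier n t) = fourier (n : ℤ) from rfl, fourierCoeff_fourier]
    rcases eq_or_ne k n with rfl | hk
    · simp
    · simp [hk]
  refine (hasSum_cauchyInt hint hz).unique ?_
  simpa only [hcoeff] using hasSum_ite_eq n (z ^ n)

lemma isShiftAnalytic_fourier (k : ℤ) : IsShiftAnalytic (fun t => fourier k t) := by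
  refine ⟨k.natAbs, fun n hn => Eventually.of_forall fun x => ?_⟩
  obtain ⟨j, hj⟩ : ∃ j : ℕ, (n : ℤ) + k = j := ⟨((n : ℤ) + k).toNat, by omega⟩
  simp only [← fourier_add, hj]
  have hcont : ContinuousAt (fun r : ℝ => ((r : ℂ) * fourier 1 x) ^ j) 1 := by fun_prop
  have hlim := hcont.tendsto.mono_left (nhdsWithin_le_nhds (s := Set.Iio 1))
  rw [Complex.ofReal_one, one_mul, fourier_one_pow] at hlim
  refine hlim.congr' ?_
  filter_upwards [eventually_mem_Ioo_zero_one] with r hr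
  exact (cauchyInt_fourier j (norm_mul_fourier_lt_one hr x)).symm

lemma integrable_fourier_mul {T : ℝ} (n : ℤ) {μ : Measure (AddCircle T)}
    {f : AddCircle T → ℂ} (hf : Integrable f μ) : Integrable (fun t => fourier n t * f t) μ :=
  hf.bdd_mul (c := 1) (fourier n).continuous.aestronglyMeasurable
    (Eventually.of_forall fun t => (norm_fourier_apply n t).le)

lemma IsCauchyLimit.add {f g f' g' : Torus → ℂ} (hf : Integrable f m) (hf' : Integrable f' m)
    (h : IsCauchyLimit f g) (h' : IsCauchyLimit f' g') :
    IsCauchyLimit (fun t => f t + f' t) (fun x => g x + g' x) := by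
  filter_upwards [h, h'] with x hx hx'
  refine (hx.add hx').congr' ?_
  filter_upwards [eventually_mem_Ioo_zero_one] with r hr
  exact (cauchyInt_add hf hf' (norm_mul_fourier_lt_one hr x)).symm

lemma IsCauchyLimit.const_mul {f g : Torus → ℂ} (c : ℂ) (h : IsCauchyLimit f g) :
    IsCauchyLimit (fun t => c * f t) (fun x => c * g x) := by
  filter_upwards [h] with x hx
  simp only [cauchyInt_const_mul]
  exact hx.const_mul c

lemma isShiftAnalytic_of_mem_span {p : C(Torus, ℂ)}
    (hp : p ∈ Submodule.span ℂ (Set.range (fourier (T := 2 * π)))) : IsShiftAnalytic p := by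
  have hint (n : ℕ) (p : C(Torus, ℂ)) : Integrable (fun t => fourier n t * p t) m :=
    integrable_fourier_mul n (integrable_of_continuous p.continuous)
  induction hp using Submodule.span_induction with
  | mem p hp =>
    obtain ⟨k, rfl⟩ := hp
    exact isShiftAnalytic_fourier k
  | zero =>
    refine ⟨0, fun n _ => Eventually.of_forall fun x => ?_⟩
    simp [cauchyInt]
  | add p q _ _ hp hq =>
    obtain ⟨n₀, hp⟩ := hp
    obtain ⟨n₁, hq⟩ := hq
    refine ⟨max n₀ n₁, fun n hn => ?_⟩
    simpa only [ContinuousMap.add_apply, mul_add] using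
      (hp n ((le_max_left _ _).trans hn)).add (hint n p) (hint n q)
        (hq n ((le_max_right _ _).trans hn))
  | smul c p _ hp =>
    obtain ⟨n₀, hp⟩ := hp
    refine ⟨n₀, fun n hn => ?_⟩
    simpa only [ContinuousMap.smul_apply, smul_eq_mul, mul_left_comm c] using
      (hp n hn).const_mul c

lemma exists_isShiftAnalytic_integral_norm_sub_le {h : Torus → ℂ} (hh : Integrable h m) {η : ℝ}
    (hη : 0 < η) : ∃ p : C(Torus, ℂ), IsShiftAnalytic p ∧ ∫ t, ‖h t - p t‖ ∂m ≤ η := by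
  obtain ⟨g, hg, hgi⟩ := hh.exists_boundedContinuous_integral_sub_le (half_pos hη)
  have hmem : g.toContinuousMap ∈
      (Submodule.span ℂ (Set.range (fourier (T := 2 * π)))).topologicalClosure := by
    rw [span_fourier_closure_eq_top]
    trivial
  obtain ⟨p, hp, hpg⟩ := Metric.mem_closure_iff.1 hmem (η / 2) (half_pos hη)
  have hdist (t : Torus) : ‖g t - p t‖ ≤ η / 2 := by
    rw [← dist_eq_norm]
    exact (ContinuousMap.dist_apply_le_dist (f := g.toContinuousMap) (g := p) t).trans hpg.le
  have hhg : Integrable (fun t => ‖h t - g t‖) m := (hh.sub hgi).norm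
  refine ⟨p, isShiftAnalytic_of_mem_span hp, ?_⟩
  calc ∫ t, ‖h t - p t‖ ∂m ≤ ∫ t, (‖h t - g t‖ + η / 2) ∂m :=
        integral_mono (hh.sub (integrable_of_continuous p.continuous)).norm
          (hhg.add (integrable_const _)) fun t =>
            (norm_sub_le_norm_sub_add_norm_sub (h t) (g t) (p t)).trans
              (add_le_add le_rfl (hdist t))
    _ = (∫ t, ‖h t - g t‖ ∂m) + η / 2 := by
        rw [integral_add hhg (integrable_const _)]
        simp
    _ ≤ η := by linarith

lemma measure_le_norm_shift_sub_le {h p q : Torus → ℂ} (hh : Integrable h m)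
    (hp : Integrable p m) {n : ℕ}
    (hpn : IsCauchyLimit (fun t => fourier n t * p t) (fun x => fourier n x * p x))
    (hq : IsCauchyLimit (fun t => fourier n t * h t) q) {ε : ℝ} (hε : 0 < ε) :
    m {x | ε ≤ ‖fourier (-(n : ℤ)) x * q x - h x‖} ≤
      ENNReal.ofReal (130 * (∫ t, ‖h t - p t‖ ∂m) / ε) := by
  have hhp : Integrable (fun t => h t - p t) m := hh.sub hp
  have hdiff : IsCauchyLimit (fun t => fourier n t * (h t - p t))
      (fun x => q x - fourier n x * p x) := by
    have hadd := hq.add (integrable_fourier_mul n hh)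
      ((integrable_fourier_mul n hp).const_mul (-1)) (hpn.const_mul (-1))
    simpa only [neg_one_mul, ← sub_eq_add_neg, ← mul_sub] using hadd
  have hweak := measure_lt_norm_of_isCauchyLimit (integrable_fourier_mul n hhp) hdiff
    (lam := ε / 16) (by positivity)
  simp only [norm_mul, norm_fourier_apply, one_mul] at hweak
  have hmarkov : m {x | ε / 2 ≤ ‖h x - p x‖} ≤
      ENNReal.ofReal (2 * (∫ t, ‖h t - p t‖ ∂m) / ε) := by
    have hle := mul_meas_ge_le_integral_of_nonneg (μ := m)
      (Eventually.of_forall fun t => norm_nonneg (h t - p t)) hhp.norm (ε / 2)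
    rw [← ofReal_measureReal]
    refine ENNReal.ofReal_le_ofReal ((le_div_iff₀ hε).2 ?_)
    linarith
  have hsubset : {x | ε ≤ ‖fourier (-(n : ℤ)) x * q x - h x‖} ⊆
      {x | 4 * (ε / 16) < ‖q x - fourier n x * p x‖} ∪ {x | ε / 2 ≤ ‖h x - p x‖} := by
    intro x hx
    by_contra hnot
    simp only [Set.mem_union, Set.mem_ofPred_eq, not_or, not_lt, not_le] at hnot hx
    have hsplit : fourier (-(n : ℤ)) x * q x - h x =
        fourier (-(n : ℤ)) x * (q x - fourier n x * p x) - (h x - p x) := by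
      linear_combination p x * fourier_mul_fourier_neg n x
    have htriangle := norm_sub_le (fourier (-(n : ℤ)) x * (q x - fourier n x * p x)) (h x - p x)
    rw [norm_mul, norm_fourier_apply, one_mul, ← hsplit] at htriangle
    linarith [hnot.1, hnot.2]
  refine (measure_mono hsubset).trans ((measure_union_le _ _).trans
    ((add_le_add hweak hmarkov).trans_eq ?_))
  rw [← ENNReal.ofReal_add (by positivity) (by positivity)]
  congr 1
  field_simp
  norm_num

theorem tendstoInMeasure_shift {h : Torus → ℂ} (hh : Integrable h m) {q : ℕ → Torus → ℂ}
    (hq : ∀ n : ℕ, IsCauchyLimit (fun t => fourier n t * h t) (q n)) :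
    TendstoInMeasure m (fun (n : ℕ) x => fourier (-(n : ℤ)) x * q n x) atTop h := by
  rw [tendstoInMeasure_iff_norm]
  intro ε hε
  rw [ENNReal.tendsto_atTop_zero]
  intro δ hδ
  obtain ⟨δ', hδ'0, hδ'⟩ := ENNReal.lt_iff_exists_nnreal_btwn.1 hδ
  have hδ'0 : (0 : ℝ) < δ' := by exact_mod_cast hδ'0
  obtain ⟨p, ⟨n₀, hp⟩, hpη⟩ :=
    exists_isShiftAnalytic_integral_norm_sub_le hh (η := δ' * ε / 130) (by positivity)
  refine ⟨n₀, fun n hn => (measure_le_norm_shift_sub_le hh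
    (integrable_of_continuous p.continuous) (hp n hn) (hq n) hε).trans (le_trans ?_ hδ'.le)⟩
  rw [← ENNReal.ofReal_coe_nnreal]
  refine ENNReal.ofReal_le_ofReal ((div_le_iff₀ hε).2 ?_)
  linarith

/-! ### Banach function spaces -/

/-- The modulus of an element of `L⁰`. -/
def absL0 (f : L0) : L0 :=
  AEEqFun.mk (fun t => ((‖f t‖ : ℝ) : ℂ))
    (Complex.continuous_ofReal.comp_aestronglyMeasurable f.aestronglyMeasurable.norm)

lemma absL0_ae (f : L0) : ∀ᵐ t ∂m, absL0 f t = ((‖f t‖ : ℝ) : ℂ) := AEEqFun.coeFn_mk _ _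

lemma coeFn_sum_ae {α β ι : Type*} [MeasurableSpace α] {μ : Measure α} [TopologicalSpace β]
    [AddCommMonoid β] [ContinuousAdd β] (s : Finset ι) (u : ι → α →ₘ[μ] β) :
    ∀ᵐ t ∂μ, (∑ i ∈ s, u i) t = ∑ i ∈ s, u i t := by
  classical
  induction s using Finset.induction_on with
  | empty =>
    filter_upwards [AEEqFun.coeFn_zero (μ := μ) (β := β)] with t ht
    simp [ht]
  | insert i s hi ih =>
    rw [Finset.sum_insert hi]
    filter_upwards [ih, AEEqFun.coeFn_add (u i) (∑ i ∈ s, u i)] with t hs hadd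
    rw [hadd, Pi.add_apply, hs, Finset.sum_insert hi]

namespace BanachFunctionSpace

variable (X : BanachFunctionSpace)

lemma N_zero : X.N 0 = 0 := by
  have hsmul := X.norm_smul 0 0
  rwa [zero_smul ℂ (0 : L0), enorm_zero, zero_mul] at hsmul

lemma N_congr {f g : L0} (h : ∀ᵐ t ∂m, ‖f t‖ = ‖g t‖) : X.N f = X.N g :=
  le_antisymm (X.ideal g f (h.mono fun _ ht => ht.le)) (X.ideal f g (h.mono fun _ ht => ht.ge))

lemma N_absL0 (f : L0) : X.N (absL0 f) = X.N f :=
  X.N_congr ((absL0_ae f).mono fun t ht => by rw [ht, Complex.norm_real, norm_norm])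

lemma N_sub_comm (f g : L0) : X.N (f - g) = X.N (g - f) := by
  refine X.N_congr ?_
  filter_upwards [AEEqFun.coeFn_sub f g, AEEqFun.coeFn_sub g f] with t hfg hgf
  rw [hfg, hgf, Pi.sub_apply, Pi.sub_apply, norm_sub_rev]

lemma N_sum_le {ι : Type*} (s : Finset ι) (u : ι → L0) :
    X.N (∑ i ∈ s, u i) ≤ ∑ i ∈ s, X.N (u i) := by
  classical
  induction s using Finset.induction_on with
  | empty => simp [X.N_zero]
  | insert i s hi ih =>
    rw [Finset.sum_insert hi, Finset.sum_insert hi]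
    exact (X.norm_add_le _ _).trans (by gcongr)

lemma N_one_ne_zero : X.N (AEEqFun.const Torus (1 : ℂ)) ≠ 0 := by
  intro hN
  have hfalse : ∀ᵐ _ : Torus ∂m, False := by
    filter_upwards [AEEqFun.coeFn_const (μ := m) Torus (1 : ℂ),
      AEEqFun.coeFn_zero (μ := m) (β := ℂ) (α := Torus)] with t hone hzero
    rw [X.eq_zero_of_norm_eq_zero _ hN, hzero] at hone
    exact zero_ne_one hone
  rw [eventually_false_iff_eq_bot, ae_eq_bot] at hfalse
  exact NeZero.ne _ hfalse

lemma N_one_ne_top : X.N (AEEqFun.const Torus (1 : ℂ)) ≠ ∞ :=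
  (X.norm_lt_top_of_memLp_top _ ((memLp_congr_ae (AEEqFun.coeFn_const Torus (1 : ℂ))).2
    (memLp_const 1))).ne

section Limit

variable {X} {S : ℕ → L0} {G : L0} (hG : Tendsto (fun n => X.N (S n - G)) atTop (𝓝 0))

include hG

lemma N_le_of_tendsto {C : ℝ≥0∞} (hS : ∀ n, X.N (S n) ≤ C) : X.N G ≤ C := by
  have hle (n : ℕ) : X.N G ≤ C + X.N (S n - G) := by
    calc X.N G = X.N (S n + (G - S n)) := by rw [add_sub_cancel]
      _ ≤ X.N (S n) + X.N (G - S n) := X.norm_add_le _ _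
      _ ≤ C + X.N (S n - G) := by
        rw [X.N_sub_comm G]
        exact add_le_add (hS n) le_rfl
  have hlim := hG.const_add C
  rw [add_zero] at hlim
  exact ge_of_tendsto' hlim hle

lemma ae_norm_le_of_tendsto {f : L0} (hf : ∀ᶠ n in atTop, ∀ᵐ t ∂m, ‖f t‖ ≤ ‖S n t‖) :
    ∀ᵐ t ∂m, ‖f t‖ ≤ ‖G t‖ := by
  let w : L0 := AEEqFun.mk (fun t => ((max (‖f t‖ - ‖G t‖) 0 : ℝ) : ℂ))
    (Complex.continuous_ofReal.comp_aestronglyMeasurable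
      ((f.aestronglyMeasurable.norm.sub G.aestronglyMeasurable.norm).sup
        aestronglyMeasurable_const))
  have hw_ae : ∀ᵐ t ∂m, w t = ((max (‖f t‖ - ‖G t‖) 0 : ℝ) : ℂ) := AEEqFun.coeFn_mk _ _
  have hw : X.N w = 0 := by
    refine le_antisymm (ge_of_tendsto hG ?_) bot_le
    filter_upwards [hf] with n hn
    refine X.ideal _ _ ?_
    filter_upwards [hn, hw_ae, AEEqFun.coeFn_sub (S n) G] with t hle hwt hsub
    rw [hwt, hsub, Pi.sub_apply, Complex.norm_real, Real.norm_of_nonneg (le_max_right _ _)]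
    exact max_le ((sub_le_sub_right hle _).trans (norm_sub_norm_le _ _)) (norm_nonneg _)
  rw [X.eq_zero_of_norm_eq_zero w hw] at hw_ae
  filter_upwards [hw_ae, AEEqFun.coeFn_zero (μ := m) (β := ℂ) (α := Torus)] with t hwt hzero
  rw [hzero, Pi.zero_apply, eq_comm, Complex.ofReal_eq_zero] at hwt
  linarith [le_max_left (‖f t‖ - ‖G t‖) 0]

end Limit

lemma exists_tendsto_sum_range {v : ℕ → L0} (hv : ∑' k, X.N (v k) ≠ ∞) :
    ∃ G : L0, Tendsto (fun n => X.N (∑ k ∈ Finset.range n, v k - G)) atTop (𝓝 0) := by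
  have hdiff {k l : ℕ} (hkl : k ≤ l) :
      X.N (∑ j ∈ Finset.range l, v j - ∑ j ∈ Finset.range k, v j) ≤ ∑' j, X.N (v (j + k)) := by
    rw [← Finset.sum_Ico_eq_sub v hkl, Finset.sum_Ico_eq_sum_range]
    simp only [add_comm k]
    exact (X.N_sum_le _ _).trans (ENNReal.sum_le_tsum _)
  obtain ⟨G, -, hG⟩ := X.complete (fun n => ∑ k ∈ Finset.range n, v k)
    (fun n => (X.N_sum_le _ _).trans_lt ((ENNReal.sum_le_tsum _).trans_lt hv.lt_top))
    fun ε hε => by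
      obtain ⟨n₀, hn₀⟩ := eventually_atTop.1
        ((ENNReal.tendsto_sum_nat_add _ hv).eventually (gt_mem_nhds hε))
      refine ⟨n₀, fun k hk l hl => ?_⟩
      rcases le_total k l with hkl | hlk
      · rw [X.N_sub_comm]
        exact (hdiff hkl).trans_lt (hn₀ k hk)
      · exact (hdiff hlk).trans_lt (hn₀ l hl)
  exact ⟨G, hG⟩

theorem exists_dominating {u : ℕ → L0} (hu : ∑' k, X.N (u k) ≠ ∞) :
    ∃ G : L0, X.N G ≤ ∑' k, X.N (u k) ∧
      ∀ᵐ t ∂m, ∀ n, ∑ k ∈ Finset.range n, ‖u k t‖ ≤ ‖G t‖ := by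
  let S (n : ℕ) : L0 := ∑ k ∈ Finset.range n, absL0 (u k)
  obtain ⟨G, hG⟩ := X.exists_tendsto_sum_range (v := fun k => absL0 (u k))
    (by simpa only [N_absL0] using hu)
  have hSN (n : ℕ) : X.N (S n) ≤ ∑' k, X.N (u k) :=
    (X.N_sum_le _ _).trans (by simp only [N_absL0]; exact ENNReal.sum_le_tsum _)
  have hS_ae : ∀ᵐ t ∂m, ∀ n, ‖S n t‖ = ∑ k ∈ Finset.range n, ‖u k t‖ := by
    filter_upwards [ae_all_iff.2 fun n => coeFn_sum_ae (Finset.range n) fun k => absL0 (u k),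
      ae_all_iff.2 fun k => absL0_ae (u k)] with t hsum habs n
    rw [hsum n, Finset.sum_congr rfl fun k _ => habs k, ← Complex.ofReal_sum, Complex.norm_real,
      Real.norm_of_nonneg (Finset.sum_nonneg fun _ _ => norm_nonneg _)]
  have hmono (n : ℕ) : ∀ᶠ l in atTop, ∀ᵐ t ∂m, ‖S n t‖ ≤ ‖S l t‖ := by
    filter_upwards [eventually_ge_atTop n] with l hl
    filter_upwards [hS_ae] with t ht
    rw [ht, ht]
    exact Finset.sum_le_sum_of_subset_of_nonneg (Finset.range_subset_range.2 hl)
      fun _ _ _ => norm_nonneg _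
  refine ⟨G, N_le_of_tendsto hG hSN, ?_⟩
  filter_upwards [ae_all_iff.2 fun n => ae_norm_le_of_tendsto hG (hmono n), hS_ae] with t hle ht n
  rw [← ht]
  exact hle n

end BanachFunctionSpace

/-! ### Decreasing rearrangements -/

/-- The decreasing rearrangement of `f` on `(0, ∞)`, extended by zero. -/
def rearr (f : L0) (t : ℝ) : ℝ :=
  open Classical in
  if 0 < t then sInf {lam | 0 ≤ lam ∧ distribution f lam ≤ ENNReal.ofReal t} else 0

section Rearrangement

variable (f : L0)

lemma distribution_anti {a b : ℝ} (hab : a ≤ b) : distribution f b ≤ distribution f a :=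
  measure_mono fun _ ht => lt_of_le_of_lt hab ht

lemma tendsto_distribution : Tendsto (fun n : ℕ => distribution f n) atTop (𝓝 0) := by
  have hlim := tendsto_measure_iInter_atTop (μ := m) (s := fun n : ℕ => {t | (n : ℝ) < ‖f t‖})
    (fun n => (measurableSet_lt measurable_const
      f.stronglyMeasurable.measurable.norm).nullMeasurableSet)
    (fun i j hij t (ht : (j : ℝ) < ‖f t‖) =>
      show (i : ℝ) < ‖f t‖ from lt_of_le_of_lt (Nat.cast_le.2 hij) ht) ⟨0, measure_ne_top _ _⟩
  have hempty : ⋂ n : ℕ, {t | (n : ℝ) < ‖f t‖} = ∅ :=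
    Set.eq_empty_of_forall_notMem fun t ht =>
      let ⟨n, hn⟩ := exists_nat_ge ‖f t‖
      hn.not_gt (Set.mem_iInter.1 ht n)
  rwa [hempty, measure_empty] at hlim

lemma exists_distribution_le {t : ℝ} (ht : 0 < t) :
    {lam | 0 ≤ lam ∧ distribution f lam ≤ ENNReal.ofReal t}.Nonempty := by
  obtain ⟨n, hn⟩ := ((tendsto_distribution f).eventually
    (gt_mem_nhds (ENNReal.ofReal_pos.2 ht))).exists
  exact ⟨n, Nat.cast_nonneg n, hn.le⟩

lemma rearr_nonneg (t : ℝ) : 0 ≤ rearr f t := by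
  rw [rearr]
  split_ifs
  · exact Real.sInf_nonneg fun _ h => h.1
  · exact le_rfl

variable {f} in
lemma rearr_le {t lam : ℝ} (hlam : 0 ≤ lam) (h : distribution f lam ≤ ENNReal.ofReal t) :
    rearr f t ≤ lam := by
  rw [rearr]
  split_ifs
  · exact csInf_le ⟨0, fun _ h => h.1⟩ ⟨hlam, h⟩
  · exact hlam

lemma distribution_rearr_le {t : ℝ} (ht : 0 < t) :
    distribution f (rearr f t) ≤ ENNReal.ofReal t := by
  refine measure_le_of_eventually_mem
    (S := fun n : ℕ => {x | rearr f t + 1 / ((n : ℝ) + 1) < ‖f x‖}) (fun x hx => ?_) fun n => ?_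
  · have hlim : Tendsto (fun n : ℕ => rearr f t + 1 / ((n : ℝ) + 1)) atTop (𝓝 (rearr f t)) := by
      simpa using tendsto_one_div_add_atTop_nhds_zero_nat.const_add (rearr f t)
    exact hlim.eventually (gt_mem_nhds hx)
  · have hlt : sInf {lam | 0 ≤ lam ∧ distribution f lam ≤ ENNReal.ofReal t} <
        rearr f t + 1 / ((n : ℝ) + 1) := by
      rw [rearr, if_pos ht]
      exact lt_add_of_pos_right _ (by positivity)
    obtain ⟨lam, ⟨-, hle⟩, hlam⟩ := exists_lt_of_csInf_lt (exists_distribution_le f ht) hlt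
    exact (distribution_anti f hlam.le).trans hle

variable {f} in
lemma lt_rearr_iff {t lam : ℝ} (ht : 0 < t) (hlam : 0 ≤ lam) :
    lam < rearr f t ↔ ENNReal.ofReal t < distribution f lam := by
  rw [← not_le, ← not_le, not_iff_not]
  exact ⟨fun h => (distribution_anti f h).trans (distribution_rearr_le f ht), rearr_le hlam⟩

lemma rearr_anti {s t : ℝ} (hs : 0 < s) (hst : s ≤ t) : rearr f t ≤ rearr f s :=
  rearr_le (rearr_nonneg f s)
    ((distribution_rearr_le f hs).trans (ENNReal.ofReal_le_ofReal hst))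

lemma rearr_eq_zero {t : ℝ} (ht : 1 ≤ t) : rearr f t = 0 :=
  (rearr_le le_rfl (prob_le_one.trans (ENNReal.one_le_ofReal.2 ht))).antisymm (rearr_nonneg f t)

lemma measurable_rearr : Measurable (rearr f) := by
  refine measurable_of_Ioi fun lam => ?_
  rcases lt_or_ge lam 0 with hlam | hlam
  · convert MeasurableSet.univ
    ext t
    simpa using hlam.trans_le (rearr_nonneg f t)
  · have hpreimage : rearr f ⁻¹' Set.Ioi lam =
        Set.Ioi 0 ∩ {t | ENNReal.ofReal t < distribution f lam} := by
      ext t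
      simp only [Set.mem_preimage, Set.mem_Ioi, Set.mem_inter_iff, Set.mem_ofPred_eq]
      rcases lt_or_ge 0 t with ht | ht
      · simp [lt_rearr_iff ht hlam, ht]
      · simp [rearr, hlam.not_gt, ht.not_gt]
    rw [hpreimage]
    exact measurableSet_Ioi.inter (measurableSet_lt ENNReal.measurable_ofReal measurable_const)

end Rearrangement

lemma arg_coe {y : ℝ} (hy : y ∈ Set.Ico 0 (2 * π)) : arg (y : Torus) = y :=
  congrArg Subtype.val
    ((AddCircle.equivIco (2 * π) 0).apply_symm_apply ⟨y, by rwa [zero_add]⟩)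

lemma measure_arg_preimage {A : Set ℝ} (hA : MeasurableSet A) :
    m (arg ⁻¹' A) = (ENNReal.ofReal (2 * π))⁻¹ * volume (A ∩ Set.Ioo 0 (2 * π)) := by
  have hvolume : volume (arg ⁻¹' A) = volume (A ∩ Set.Ioo 0 (2 * π)) := by
    have hae : (QuotientAddGroup.mk ⁻¹' (arg ⁻¹' A) ∩ Set.Ioc 0 (2 * π) : Set ℝ) =ᵐ[volume]
        (QuotientAddGroup.mk ⁻¹' (arg ⁻¹' A) ∩ Set.Ioo 0 (2 * π) : Set ℝ) :=
      (ae_eq_refl _).inter Ioo_ae_eq_Ioc.symm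
    rw [AddCircle.add_projection_respects_measure (2 * π) 0 (measurable_arg hA), zero_add,
      measure_congr hae]
    congr 1
    ext y
    simp only [Set.mem_inter_iff, Set.mem_preimage, and_congr_left_iff]
    intro hy
    rw [show arg (QuotientAddGroup.mk y) = y from arg_coe ⟨hy.1.le, hy.2⟩]
  rw [← hvolume, AddCircle.volume_eq_smul_haarAddCircle, Measure.smul_apply, smul_eq_mul,
    ← mul_assoc, ENNReal.inv_mul_cancel (by simp [Real.pi_pos]) ENNReal.ofReal_ne_top, one_mul]

lemma measure_arg_lt {c : ℝ} (hc : c ≤ 1) :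
    m {x | arg x < 2 * π * c} = ENNReal.ofReal c := by
  have hinter : Set.Iio (2 * π * c) ∩ Set.Ioo 0 (2 * π) = Set.Ioo 0 (2 * π * c) := by
    rw [Set.inter_comm, Set.Ioo_inter_Iio,
      min_eq_right (mul_le_of_le_one_right Real.two_pi_pos.le hc)]
  rw [show {x | arg x < 2 * π * c} = arg ⁻¹' Set.Iio (2 * π * c) from rfl,
    measure_arg_preimage measurableSet_Iio, hinter, Real.volume_Ioo, sub_zero,
    ENNReal.ofReal_mul Real.two_pi_pos.le, ← mul_assoc,
    ENNReal.inv_mul_cancel (by simp [Real.pi_pos]) ENNReal.ofReal_ne_top, one_mul]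

lemma ae_arg_pos : ∀ᵐ x ∂m, 0 < arg x := by
  have hempty : Set.Iic 0 ∩ Set.Ioo 0 (2 * π) = ∅ :=
    Set.eq_empty_of_forall_notMem fun y hy => hy.2.1.not_ge hy.1
  rw [ae_iff, show {x | ¬ 0 < arg x} = arg ⁻¹' Set.Iic 0 by ext x; simp,
    measure_arg_preimage measurableSet_Iic, hempty, measure_empty, mul_zero]

/-- The decreasing rearrangement of `f`, dilated by `a` and moved to the circle. -/
def rdil (f : L0) (a : ℝ) : L0 :=
  AEEqFun.mk (fun x => ((rearr f (a * arg x / (2 * π)) : ℝ) : ℂ))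
    (Complex.measurable_ofReal.comp ((measurable_rearr f).comp
      ((measurable_arg.const_mul a).div_const _))).aestronglyMeasurable

lemma rdil_ae (f : L0) (a : ℝ) :
    ∀ᵐ x ∂m, rdil f a x = ((rearr f (a * arg x / (2 * π)) : ℝ) : ℂ) := AEEqFun.coeFn_mk _ _

theorem equimeasurable_rdil_one (f : L0) : Equimeasurable (rdil f 1) f := by
  intro lam hlam
  have hfin : distribution f lam ≠ ∞ := measure_ne_top _ _
  have hset : distribution (rdil f 1) lam =
      m {x | arg x < 2 * π * (distribution f lam).toReal} := by
    refine measure_congr ?_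
    filter_upwards [rdil_ae f 1, ae_arg_pos] with x hx hpos
    have hdiv := div_pos hpos Real.two_pi_pos
    refine propext (?_ : lam < ‖rdil f 1 x‖ ↔ arg x < 2 * π * (distribution f lam).toReal)
    rw [hx, Complex.norm_real, Real.norm_of_nonneg (rearr_nonneg _ _), one_mul,
      lt_rearr_iff hdiv hlam, ENNReal.ofReal_lt_iff_lt_toReal hdiv.le hfin,
      div_lt_iff₀' Real.two_pi_pos]
  rw [hset, measure_arg_lt (ENNReal.toReal_le_of_le_ofReal zero_le_one
    (by rw [ENNReal.ofReal_one]; exact prob_le_one)), ENNReal.ofReal_toReal hfin]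

theorem dilation_ae {s : ℝ} (hs : 0 < s) {f : L0} {φ : Torus → ℂ} (h : f =ᵐ[m] φ) :
    ∀ᵐ x ∂m, dilation s f x = open Classical in
      if s * arg x ∈ Set.Ico 0 (2 * π) then φ ((s * arg x : ℝ) : Torus) else 0 := by
  let Z : Set Torus := toMeasurable m {y | ¬ f y = φ y}
  have hZ : MeasurableSet Z := measurableSet_toMeasurable _ _
  let B : Set ℝ := QuotientAddGroup.mk ⁻¹' Z ∩ Set.Ioc 0 (2 * π)
  have hB : MeasurableSet B := (AddCircle.measurable_mk' hZ).inter measurableSet_Ioc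
  have hvolume : volume B = 0 := by
    have hproj := AddCircle.add_projection_respects_measure (2 * π) 0 hZ
    rwa [AddCircle.volume_eq_smul_haarAddCircle, Measure.smul_apply, measure_toMeasurable,
      show m {y | ¬ f y = φ y} = 0 from h, smul_zero, zero_add, eq_comm] at hproj
  have hnull : m (arg ⁻¹' ((fun y => s * y) ⁻¹' B)) = 0 := by
    rw [measure_arg_preimage (measurable_const_mul s hB), measure_mono_null Set.inter_subset_left,
      mul_zero]
    rw [Real.volume_preimage_mul_left hs.ne', hvolume, mul_zero]
  filter_upwards [AEEqFun.coeFn_mk (dilationFun s f)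
    (measurable_dilationFun s f).aestronglyMeasurable, ae_arg_pos,
    measure_eq_zero_iff_ae_notMem.1 hnull] with x hx hpos hnotMem
  rw [dilation, hx, dilationFun]
  split_ifs with hmem
  · by_contra hne
    exact hnotMem ⟨subset_toMeasurable m _ hne, mul_pos hs hpos, hmem.2.le⟩
  · rfl

theorem dilation_rdil_one {s : ℝ} (hs : 0 < s) (f : L0) : dilation s (rdil f 1) = rdil f s := by
  refine AEEqFun.ext ?_
  filter_upwards [dilation_ae hs (rdil_ae f 1), rdil_ae f s, ae_arg_pos] with x hdil hx hpos
  rw [hdil, hx]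
  split_ifs with hmem
  · rw [arg_coe hmem, one_mul]
  · rw [rearr_eq_zero, Complex.ofReal_zero]
    rw [one_le_div Real.two_pi_pos]
    by_contra hlt
    exact hmem ⟨(mul_pos hs hpos).le, not_le.1 hlt⟩

lemma dilation_smul {s : ℝ} (hs : 0 < s) (c : ℂ) (f : L0) :
    dilation s (c • f) = c • dilation s f := by
  refine AEEqFun.ext ?_
  filter_upwards [dilation_ae hs (AEEqFun.coeFn_smul c f), dilation_ae hs (ae_eq_refl f),
    AEEqFun.coeFn_smul c (dilation s f)] with x hcf hf hsmul
  rw [hcf, hsmul]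
  change _ = c • dilation s f x
  rw [hf]
  split_ifs
  · rfl
  · rw [smul_zero]

/-! ### Boyd indices and dilated rearrangements -/

namespace BanachFunctionSpace

lemma N_dilation_le (X : BanachFunctionSpace) {s : ℝ} (hs : 0 < s) {f : L0} (hf : X.N f ≠ ∞) :
    X.N (dilation s f) ≤ X.dilationNorm s * X.N f := by
  rcases eq_or_ne (X.N f) 0 with hzero | hzero
  · have hdil := dilation_smul hs 0 f
    simp only [zero_smul ℂ (_ : L0)] at hdil
    rw [X.eq_zero_of_norm_eq_zero f hzero, hdil, X.N_zero]
    exact zero_le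
  · let c : ℂ := ((X.N f).toReal⁻¹ : ℝ)
    have hpos : 0 < (X.N f).toReal := ENNReal.toReal_pos hzero hf
    have hc : ‖c‖ₑ = (X.N f)⁻¹ := by
      rw [← ofReal_norm, Complex.norm_real, Real.norm_of_nonneg (inv_nonneg.2 hpos.le),
        ENNReal.ofReal_inv_of_pos hpos, ENNReal.ofReal_toReal hf]
    have hle : X.N (dilation s (c • f)) ≤ X.dilationNorm s :=
      le_iSup₂_of_le (c • f)
        (by rw [X.norm_smul, hc, ENNReal.inv_mul_cancel hzero hf]) le_rfl
    rwa [dilation_smul hs, X.norm_smul, hc, ENNReal.inv_mul_le_iff hzero hf, mul_comm] at hle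

/-- `log D.toReal ≠ 0` excludes the junk values at `D = 0` and `D = ∞`. -/
lemma le_ofReal_rpow_of_log_le {D : ℝ≥0∞} {s c : ℝ} (hs : 0 < s)
    (hne : Real.log D.toReal ≠ 0) (hle : Real.log D.toReal ≤ c * Real.log s) :
    D ≤ ENNReal.ofReal (s ^ c) := by
  have hD : D.toReal ≠ 0 := fun h => hne (by rw [h, Real.log_zero])
  have hfin : D ≠ ∞ := fun h => hD (by rw [h, ENNReal.toReal_top])
  rw [← Real.log_rpow hs, Real.log_le_log_iff (ENNReal.toReal_nonneg.lt_of_ne' hD)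
    (Real.rpow_pos_of_pos hs c)] at hle
  rw [← ENNReal.ofReal_toReal hfin]
  exact ENNReal.ofReal_le_ofReal hle

lemma eventually_dilationNorm_le_of_isLowerBoydIndex {Y : BanachFunctionSpace} {α γ : ℝ}
    (hα : Y.IsLowerBoydIndex α) (hγ : 0 < γ) (hγα : γ < α) :
    ∀ᶠ s in atTop, Y.dilationNorm s ≤ ENNReal.ofReal (s ^ (-γ)) := by
  filter_upwards [(hα.comp tendsto_inv_atTop_nhdsGT_zero).eventually (lt_mem_nhds hγα),
    eventually_gt_atTop 1] with s hlt hs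
  have hlog := Real.log_pos hs
  simp only [Function.comp, one_div, inv_inv, Real.log_inv] at hlt
  rw [div_neg, lt_neg, div_lt_iff₀ hlog] at hlt
  exact le_ofReal_rpow_of_log_le (by linarith) (by nlinarith) hlt.le

lemma eventually_dilationNorm_inv_le_of_isUpperBoydIndex {Y : BanachFunctionSpace} {β γ : ℝ}
    (hβ : Y.IsUpperBoydIndex β) (hβ0 : 0 < β) (hβγ : β < γ) :
    ∀ᶠ s in atTop, Y.dilationNorm s⁻¹ ≤ ENNReal.ofReal (s ^ γ) := by
  filter_upwards [Tendsto.eventually hβ (lt_mem_nhds hβ0),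
    Tendsto.eventually hβ (gt_mem_nhds hβγ), eventually_gt_atTop 1] with s hpos hlt hs
  rw [one_div, div_lt_iff₀ (Real.log_pos hs)] at hlt
  rw [one_div] at hpos
  exact le_ofReal_rpow_of_log_le (by linarith)
    (fun hzero => by rw [hzero, zero_div] at hpos; exact lt_irrefl _ hpos) hlt.le

lemma exists_dilationNorm_two_pow_le {Y : BanachFunctionSpace}
    (h : Y.HasNontrivialBoydIndices) :
    ∃ θ τ : ℝ≥0, (0 < θ ∧ θ < 1) ∧ (1 ≤ τ ∧ τ < 2) ∧ ∃ k₀ : ℕ, ∀ k ≥ k₀,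
      Y.dilationNorm (2 ^ k) ≤ θ ^ k ∧ Y.dilationNorm (2 ^ k)⁻¹ ≤ τ ^ k := by
  obtain ⟨α, β, hα, hβ, ⟨hα0, hα1⟩, ⟨hβ0, hβ1⟩⟩ := h
  have hpow : Tendsto (fun k : ℕ => (2 : ℝ) ^ k) atTop atTop :=
    tendsto_pow_atTop_atTop_of_one_lt one_lt_two
  have hrpow (c : ℝ) (k : ℕ) :
      ENNReal.ofReal (((2 : ℝ) ^ k) ^ c) = (((2 : ℝ≥0) ^ c : ℝ≥0) : ℝ≥0∞) ^ k := by
    rw [← Real.rpow_pow_comm zero_le_two, ENNReal.ofReal_pow (by positivity),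
      ← ENNReal.ofReal_coe_nnreal, NNReal.coe_rpow, NNReal.coe_ofNat]
  have hlower := hpow.eventually
    (eventually_dilationNorm_le_of_isLowerBoydIndex hα (half_pos hα0) (half_lt_self hα0))
  have hupper := hpow.eventually (eventually_dilationNorm_inv_le_of_isUpperBoydIndex hβ hβ0
    (show β < (1 + β) / 2 by linarith))
  simp only [hrpow] at hlower hupper
  refine ⟨2 ^ (-(α / 2)), 2 ^ ((1 + β) / 2), ⟨by positivity, ?_⟩, ⟨?_, ?_⟩,
    eventually_atTop.1 (hlower.and hupper)⟩
  · exact NNReal.rpow_lt_one_of_one_lt_of_neg one_lt_two (by linarith)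
  · exact NNReal.one_le_rpow one_le_two (by linarith)
  · calc (2 : ℝ≥0) ^ ((1 + β) / 2) < 2 ^ (1 : ℝ) :=
        NNReal.rpow_lt_rpow_of_exponent_lt one_lt_two (by linarith)
      _ = 2 := NNReal.rpow_one 2

lemma N_rdil_anti (X : BanachFunctionSpace) (f : L0) {a b : ℝ} (ha : 0 < a) (hab : a ≤ b) :
    X.N (rdil f b) ≤ X.N (rdil f a) := by
  refine X.ideal _ _ ?_
  filter_upwards [rdil_ae f a, rdil_ae f b, ae_arg_pos] with x hxa hxb hpos
  rw [hxa, hxb, Complex.norm_real, Complex.norm_real, Real.norm_of_nonneg (rearr_nonneg _ _),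
    Real.norm_of_nonneg (rearr_nonneg _ _)]
  exact rearr_anti f (by positivity) (by gcongr)

section RearrangementInvariant

variable {Y : BanachFunctionSpace} (hY : Y.IsRI)

include hY

lemma N_rdil_one {f : L0} (hf : Y.N f < ∞) : Y.N (rdil f 1) = Y.N f :=
  ((hY f (rdil f 1) (fun lam hl => (equimeasurable_rdil_one f lam hl).symm) hf).2).symm

lemma N_eq_of_N_rdil_lt_top {f : L0} (hf : Y.N (rdil f 1) < ∞) : Y.N f = Y.N (rdil f 1) :=
  ((hY (rdil f 1) f (equimeasurable_rdil_one f) hf).2).symm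

lemma N_rdil_le {f : L0} (hf : Y.N f < ∞) {a : ℝ} (ha : 0 < a) :
    Y.N (rdil f a) ≤ Y.dilationNorm a * Y.N f := by
  have hone := N_rdil_one hY hf
  have hle := Y.N_dilation_le ha (f := rdil f 1) (hone ▸ hf.ne)
  rwa [dilation_rdil_one ha, hone] at hle

lemma N_rdil_two_pow_le {θ : ℝ≥0} (hθ0 : 0 < θ) (hθ1 : θ ≤ 1) {k₀ : ℕ}
    (h : ∀ k ≥ k₀, Y.dilationNorm (2 ^ k) ≤ θ ^ k) {f : L0} (hf : Y.N f < ∞) (k : ℕ) :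
    Y.N (rdil f (2 ^ k)) ≤ ((θ ^ k₀)⁻¹ * θ ^ k : ℝ≥0) * Y.N f := by
  rcases le_total k₀ k with hk | hk
  · refine (N_rdil_le hY hf (by positivity)).trans ?_
    gcongr
    refine (h k hk).trans ?_
    exact_mod_cast le_mul_of_one_le_left zero_le
      ((one_le_inv₀ (by positivity)).2 (pow_le_one₀ zero_le hθ1))
  · refine (Y.N_rdil_anti f one_pos (one_le_pow₀ one_le_two)).trans ?_
    rw [N_rdil_one hY hf]
    refine le_mul_of_one_le_left zero_le ?_
    exact_mod_cast (one_le_inv_mul₀ (by positivity)).2 (pow_le_pow_of_le_one zero_le hθ1 hk)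

lemma N_rdil_two_pow_inv_le {τ : ℝ≥0} (hτ : 1 ≤ τ) {k₀ : ℕ}
    (h : ∀ k ≥ k₀, Y.dilationNorm (2 ^ k)⁻¹ ≤ τ ^ k) {f : L0} (hf : Y.N f < ∞) (k : ℕ) :
    Y.N (rdil f (2 ^ k)⁻¹) ≤ (τ ^ k₀ * τ ^ k : ℝ≥0) * Y.N f := by
  rcases le_total k₀ k with hk | hk
  · refine (N_rdil_le hY hf (by positivity)).trans ?_
    gcongr
    refine (h k hk).trans ?_
    exact_mod_cast le_mul_of_one_le_left zero_le (one_le_pow₀ hτ)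
  · refine (Y.N_rdil_anti f (a := (2 ^ k₀)⁻¹) (by positivity) ?_).trans
      ((N_rdil_le hY hf (by positivity)).trans ?_)
    · gcongr
      norm_num
    · gcongr
      refine (h k₀ le_rfl).trans ?_
      exact_mod_cast le_mul_of_one_le_right zero_le (one_le_pow₀ hτ)

end RearrangementInvariant

/-- The dyadic dilations of rearrangements are geometrically controlled on `Y`. For an r.i. space
with nontrivial Boyd indices one may take `θ < 1` and `τ < 2`. -/
def HasDilationBounds (Y : BanachFunctionSpace) (K θ τ : ℝ≥0) : Prop :=
  ∀ f, Y.N f < ∞ → ∀ k : ℕ,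
    Y.N (rdil f (2 ^ k)) ≤ K * θ ^ k * Y.N f ∧ Y.N (rdil f (2 ^ k)⁻¹) ≤ K * τ ^ k * Y.N f

theorem exists_hasDilationBounds {Y : BanachFunctionSpace} (hY : Y.IsRI)
    (h : Y.HasNontrivialBoydIndices) :
    ∃ K θ τ : ℝ≥0, θ < 1 ∧ τ < 2 ∧ Y.HasDilationBounds K θ τ := by
  obtain ⟨θ, τ, ⟨hθ0, hθ1⟩, ⟨hτ1, hτ2⟩, k₀, hk₀⟩ := exists_dilationNorm_two_pow_le h
  refine ⟨max (θ ^ k₀)⁻¹ (τ ^ k₀), θ, τ, hθ1, hτ2, fun f hf k => ⟨?_, ?_⟩⟩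
  · refine (N_rdil_two_pow_le hY hθ0 hθ1.le (fun k hk => (hk₀ k hk).1) hf k).trans ?_
    rw [← ENNReal.coe_pow, ← ENNReal.coe_mul]
    gcongr
    exact le_max_left _ _
  · refine (N_rdil_two_pow_inv_le hY hτ1 (fun k hk => (hk₀ k hk).2) hf k).trans ?_
    rw [← ENNReal.coe_pow, ← ENNReal.coe_mul]
    gcongr
    exact le_max_right _ _

end BanachFunctionSpace

/-! ### Dyadic estimates of integrals by the rearrangement -/

lemma measurableSet_lt_norm (f : L0) (c : ℝ) : MeasurableSet {x | c < ‖f x‖} :=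
  measurableSet_lt measurable_const f.stronglyMeasurable.measurable.norm

lemma setLIntegral_le_tsum_mul_ofReal (f : L0) {c : ℕ → ℝ≥0∞} {t : ℕ → ℝ} (ht : ∀ k, 0 < t k)
    {A : Set Torus} (hA : MeasurableSet A) {g : Torus → ℝ≥0∞}
    (h : ∀ᵐ x ∂m, x ∈ A → g x ≠ 0 → ∃ k, g x ≤ c k ∧ rearr f (t k) < ‖f x‖) :
    ∫⁻ x in A, g x ∂m ≤ ∑' k, c k * ENNReal.ofReal (t k) := by
  let E (k : ℕ) : Set Torus := {x | rearr f (t k) < ‖f x‖}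
  have hE (k : ℕ) : MeasurableSet (E k) := measurableSet_lt_norm f _
  have hle : ∀ᵐ x ∂m, x ∈ A → g x ≤ ∑' k, (E k).indicator (fun _ => c k) x := by
    filter_upwards [h] with x hx hxA
    rcases eq_or_ne (g x) 0 with hg | hg
    · rw [hg]
      exact zero_le
    · obtain ⟨k, hgc, hxE⟩ := hx hxA hg
      refine hgc.trans (le_trans ?_ (ENNReal.le_tsum k))
      rw [Set.indicator_of_mem (show x ∈ E k from hxE)]
  calc ∫⁻ x in A, g x ∂m
      ≤ ∫⁻ x, ∑' k, (E k).indicator (fun _ => c k) x ∂m :=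
        (setLIntegral_mono_ae' hA hle).trans (setLIntegral_le_lintegral _ _)
    _ = ∑' k, c k * distribution f (rearr f (t k)) := by
        rw [lintegral_tsum fun k => (measurable_const.indicator (hE k)).aemeasurable]
        exact tsum_congr fun k => lintegral_indicator_const (hE k) _
    _ ≤ ∑' k, c k * ENNReal.ofReal (t k) := by
        gcongr with k
        exact distribution_rearr_le f (ht k)

lemma ae_exists_norm_le_rearr (f : L0) {s : ℝ} (hs : 0 < s) :
    ∀ᵐ x ∂m, ∃ k : ℕ, ‖f x‖ ≤ rearr f ((2 ^ k)⁻¹ * s) := by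
  have hlim : Tendsto (fun k : ℕ => ENNReal.ofReal ((2 ^ k)⁻¹ * s)) atTop (𝓝 0) := by
    have hinv : Tendsto (fun k : ℕ => ((2 : ℝ) ^ k)⁻¹) atTop (𝓝 0) :=
      tendsto_inv_atTop_zero.comp (tendsto_pow_atTop_atTop_of_one_lt one_lt_two)
    simpa using ENNReal.tendsto_ofReal (hinv.mul_const s)
  rw [ae_iff]
  refine le_antisymm (ge_of_tendsto' hlim fun k => ?_) bot_le
  refine (measure_mono fun x hx => ?_).trans
    (distribution_rearr_le f (t := (2 ^ k)⁻¹ * s) (by positivity))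
  simp only [Set.mem_ofPred_eq, not_exists, not_le] at hx
  exact hx k

lemma setLIntegral_lt_norm_le (f : L0) {s : ℝ} (hs : 0 < s) :
    ∫⁻ x in {x | rearr f s < ‖f x‖}, ‖f x‖ₑ ∂m ≤
      ∑' k : ℕ, ENNReal.ofReal (rearr f ((2 ^ (k + 1))⁻¹ * s)) *
        ENNReal.ofReal ((2 ^ k)⁻¹ * s) := by
  refine setLIntegral_le_tsum_mul_ofReal f (fun k => by positivity) (measurableSet_lt_norm f _) ?_
  filter_upwards [ae_exists_norm_le_rearr f hs] with x hx hxs _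
  obtain ⟨j, hlt, hle⟩ := Nat.exists_not_and_succ_of_not_zero_of_exists
    (by simpa only [pow_zero, inv_one, one_mul, not_le] using hxs) hx
  refine ⟨j, ?_, not_le.1 hlt⟩
  rw [← ofReal_norm]
  exact ENNReal.ofReal_le_ofReal hle

lemma setLIntegral_compl_lt_norm_le (f : L0) {s : ℝ} (hs : 0 < s) {p : ℕ} (hp : p ≠ 0) :
    ∫⁻ x in {x | rearr f s < ‖f x‖}ᶜ, ‖f x‖ₑ ^ p ∂m ≤
      ∑' k : ℕ, ENNReal.ofReal (rearr f (2 ^ k * s)) ^ p *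
        ENNReal.ofReal (2 ^ (k + 1) * s) := by
  refine setLIntegral_le_tsum_mul_ofReal f (fun k => by positivity)
    (measurableSet_lt_norm f _).compl (Eventually.of_forall fun x hxs hx => ?_)
  have hex : ∃ k : ℕ, rearr f (2 ^ k * s) < ‖f x‖ := by
    obtain ⟨k, hk⟩ := pow_unbounded_of_one_lt s⁻¹ (one_lt_two (α := ℝ))
    refine ⟨k, ?_⟩
    rw [rearr_eq_zero f ((inv_lt_iff_one_lt_mul₀ hs).1 hk).le, norm_pos_iff]
    exact fun h0 => hx (by rw [h0, enorm_zero, zero_pow hp])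
  obtain ⟨j, hle, hlt⟩ := Nat.exists_not_and_succ_of_not_zero_of_exists
    (by rwa [pow_zero, one_mul]) hex
  refine ⟨j, ?_, hlt⟩
  rw [← ofReal_norm]
  gcongr
  exact not_lt.1 hle

lemma tsum_pow_le_pow_tsum (a : ℕ → ℝ≥0∞) {p : ℕ} (hp : p ≠ 0) :
    ∑' k, a k ^ p ≤ (∑' k, a k) ^ p := by
  obtain ⟨q, rfl⟩ := Nat.exists_eq_succ_of_ne_zero hp
  calc ∑' k, a k ^ (q + 1) ≤ ∑' k, (∑' j, a j) ^ q * a k := by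
        refine ENNReal.tsum_le_tsum fun k => ?_
        rw [pow_succ]
        gcongr
        exact ENNReal.le_tsum k
    _ = (∑' k, a k) ^ (q + 1) := by rw [ENNReal.tsum_mul_left, pow_succ]

/-! ### The Calderón estimate for Cauchy integrals -/

/-- A dyadic form of `t⁻¹ ∫₀ᵗ f*`, one half of the Calderón operator applied to `f`. -/
def calderonLow (f : L0) (t : ℝ) : ℝ≥0∞ :=
  ∑' k : ℕ, ((2⁻¹ ^ k : ℝ≥0) : ℝ≥0∞) * ENNReal.ofReal (rearr f ((2 ^ k)⁻¹ * t))

/-- A dyadic form of `t ^ (-1 / p) ∫_t^∞ f*(u) u ^ (1 / p - 1) du`, where `ρ ^ p = 2`; the case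
`ρ = 1` would be the other half of the Calderón operator. -/
def calderonHigh (ρ : ℝ≥0) (f : L0) (t : ℝ) : ℝ≥0∞ :=
  ∑' k : ℕ, ((ρ ^ k : ℝ≥0) : ℝ≥0∞) * ENNReal.ofReal (rearr f (2 ^ k * t))

lemma setLIntegral_lt_norm_le_calderonLow (f : L0) {s : ℝ} (hs : 0 < s) :
    ∫⁻ x in {x | rearr f s < ‖f x‖}, ‖f x‖ₑ ∂m ≤ ENNReal.ofReal (2 * s) * calderonLow f s := by
  have hweight (k : ℕ) : ENNReal.ofReal ((2 ^ k)⁻¹ * s) =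
      ENNReal.ofReal (2 * s) * ((2⁻¹ ^ (k + 1) : ℝ≥0) : ℝ≥0∞) := by
    rw [← ENNReal.ofReal_coe_nnreal, ← ENNReal.ofReal_mul (by positivity)]
    congr 1
    push_cast
    rw [pow_succ, inv_pow]
    ring
  refine (setLIntegral_lt_norm_le f hs).trans ?_
  rw [calderonLow, ← ENNReal.tsum_mul_left]
  refine le_trans (le_of_eq (tsum_congr fun k => ?_))
    (ENNReal.tsum_comp_le_tsum_of_injective (add_left_injective 1) _)
  rw [hweight, mul_comm, mul_assoc]

lemma setLIntegral_compl_lt_norm_le_calderonHigh (f : L0) {s : ℝ} (hs : 0 < s) {p : ℕ}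
    (hp : p ≠ 0) {ρ : ℝ≥0} (hρ : ρ ^ p = 2) :
    ∫⁻ x in {x | rearr f s < ‖f x‖}ᶜ, ‖f x‖ₑ ^ p ∂m ≤
      ENNReal.ofReal (2 * s) * calderonHigh ρ f s ^ p := by
  refine (setLIntegral_compl_lt_norm_le f hs hp).trans ?_
  refine le_trans (le_of_eq ?_) (mul_le_mul_right (tsum_pow_le_pow_tsum _ hp) _)
  rw [← ENNReal.tsum_mul_left]
  refine tsum_congr fun k => ?_
  have hweight : (((ρ ^ k : ℝ≥0) : ℝ≥0∞)) ^ p = ENNReal.ofReal (2 ^ k) := by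
    rw [← ENNReal.coe_pow, pow_right_comm, hρ, ← ENNReal.ofReal_coe_nnreal]
    norm_num
  rw [mul_pow, hweight, mul_comm, ← mul_assoc, ← ENNReal.ofReal_mul (by positivity)]
  congr 2
  rw [pow_succ]
  ring

/-- The restriction of `|f|` to the set where it exceeds `rearr f t`. -/
def upperPart (f : L0) (t : ℝ) : Torus → ℝ := {x | rearr f t < ‖f x‖}.indicator fun x => ‖f x‖

/-- The restriction of `|f|` to the set where it is at most `rearr f t`. -/
def lowerPart (f : L0) (t : ℝ) : Torus → ℝ := {x | rearr f t < ‖f x‖}ᶜ.indicator fun x => ‖f x‖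

lemma integral_indicator_norm_pow {α E : Type*} [MeasurableSpace α] {μ : Measure α}
    [NormedAddCommGroup E] {f : α → E} (hf : AEStronglyMeasurable f μ) {s : Set α}
    (hs : MeasurableSet s) {p : ℕ} (hp : p ≠ 0) :
    ∫ x, s.indicator (fun x => ‖f x‖) x ^ p ∂μ = (∫⁻ x in s, ‖f x‖ₑ ^ p ∂μ).toReal := by
  have hpow : (fun x => s.indicator (fun x => ‖f x‖) x ^ p) =
      s.indicator fun x => ‖f x‖ ^ p := by
    ext x
    by_cases hx : x ∈ s
    · simp only [Set.indicator_of_mem hx]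
    · simp only [Set.indicator_of_notMem hx, zero_pow hp]
  rw [hpow, integral_indicator hs, integral_eq_lintegral_of_nonneg_ae
    (Eventually.of_forall fun x => pow_nonneg (norm_nonneg _) _) (by fun_prop)]
  simp only [ENNReal.ofReal_pow (norm_nonneg _), ofReal_norm]

section CalderonEstimate

variable (f : L0) (t : ℝ)

lemma upperPart_nonneg (x : Torus) : 0 ≤ upperPart f t x :=
  Set.indicator_nonneg (fun _ _ => norm_nonneg _) x

lemma lowerPart_nonneg (x : Torus) : 0 ≤ lowerPart f t x :=
  Set.indicator_nonneg (fun _ _ => norm_nonneg _) x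

lemma lowerPart_le (x : Torus) : lowerPart f t x ≤ rearr f t :=
  Set.indicator_le' (g := fun _ => rearr f t) (fun _ hy => not_lt.1 hy)
    (fun _ _ => rearr_nonneg f t) x

lemma measurable_lowerPart : Measurable (lowerPart f t) :=
  f.stronglyMeasurable.measurable.norm.indicator (measurableSet_lt_norm f _).compl

variable {f} in
lemma integrable_upperPart (hf : Integrable f m) : Integrable (upperPart f t) m :=
  hf.norm.indicator (measurableSet_lt_norm f _)

lemma integrable_lowerPart : Integrable (lowerPart f t) m :=
  integrable_of_nonneg_of_le (measurable_lowerPart f t) (lowerPart_nonneg f t) (lowerPart_le f t)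

lemma upperPart_add_lowerPart (x : Torus) : upperPart f t x + lowerPart f t x = ‖f x‖ :=
  Set.indicator_self_add_compl_apply _ _ _

variable {f t} (ht : 0 < t) {S : ℝ} (hS0 : 0 ≤ S)

include ht hS0

lemma integral_upperPart_le (hS : calderonLow f t ≤ ENNReal.ofReal S) :
    ∫ x, upperPart f t x ∂m ≤ 2 * t * S := by
  have hintegral := integral_indicator_norm_pow f.aestronglyMeasurable
    (measurableSet_lt_norm f (rearr f t)) one_ne_zero
  simp only [pow_one] at hintegral
  rw [upperPart, hintegral]
  refine ENNReal.toReal_le_of_le_ofReal (by positivity) ?_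
  rw [ENNReal.ofReal_mul (by positivity)]
  refine (setLIntegral_lt_norm_le_calderonLow f ht).trans ?_
  gcongr

lemma integral_lowerPart_pow_le {p : ℕ} (hp : p ≠ 0) {ρ : ℝ≥0} (hρ : ρ ^ p = 2)
    (hS : calderonHigh ρ f t ≤ ENNReal.ofReal S) :
    ∫ x, lowerPart f t x ^ p ∂m ≤ 2 * t * S ^ p := by
  rw [lowerPart, integral_indicator_norm_pow f.aestronglyMeasurable
    (measurableSet_lt_norm f (rearr f t)).compl hp]
  refine ENNReal.toReal_le_of_le_ofReal (by positivity) ?_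
  rw [ENNReal.ofReal_mul (by positivity), ENNReal.ofReal_pow hS0]
  refine (setLIntegral_compl_lt_norm_le_calderonHigh f ht hp hρ).trans ?_
  gcongr

variable {r : ℝ} (hr : r ∈ Set.Ioo (0 : ℝ) 1) {lam : ℝ} (hlam : 0 < lam)

include hr hlam

lemma measure_lt_norm_cauchyInt_upperPart_le (hf : Integrable f m)
    (hS : calderonLow f t ≤ ENNReal.ofReal S) (hle : 8 * S ≤ lam) :
    m {x : Torus | lam < ‖cauchyInt (fun y => (upperPart f t y : ℂ)) (r * fourier 1 x)‖} ≤
      ENNReal.ofReal (t / 2) := by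
  refine (measure_lt_norm_cauchyInt (integrable_upperPart t hf) (upperPart_nonneg f t)
    ⟨hr.1.le, hr.2⟩ hlam).trans (ENNReal.ofReal_le_ofReal ?_)
  rw [div_le_iff₀ hlam]
  linarith [integral_upperPart_le ht hS0 hS, mul_le_mul_of_nonneg_left hle ht.le]

lemma measure_lt_norm_cauchyInt_lowerPart_le {k : ℕ} (hk : k ≠ 0) {ρ : ℝ≥0}
    (hρ : ρ ^ (2 * k) = 2) (hS : calderonHigh ρ f t ≤ ENNReal.ofReal S)
    (hle : 4 * (3 + 3 * (8 * k) ^ (2 * k)) * S ^ (2 * k) ≤ lam ^ (2 * k)) :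
    m {x : Torus | lam < ‖cauchyInt (fun y => (lowerPart f t y : ℂ)) (r * fourier 1 x)‖} ≤
      ENNReal.ofReal (t / 2) := by
  let F (x : Torus) : ℝ := ‖cauchyInt (fun y => (lowerPart f t y : ℂ)) (r * fourier 1 x)‖ ^ (2 * k)
  have hrIco : r ∈ Set.Ico (0 : ℝ) 1 := ⟨hr.1.le, hr.2⟩
  have hF : Integrable F m := integrable_of_continuous
    ((continuous_cauchyInt_circle (integrable_lowerPart f t).ofReal hrIco).norm.pow _)
  have hmarkov : lam ^ (2 * k) * m.real {x | lam ^ (2 * k) ≤ F x} ≤ lam ^ (2 * k) * (t / 2) :=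
    calc lam ^ (2 * k) * m.real {x | lam ^ (2 * k) ≤ F x}
        ≤ ∫ x, F x ∂m :=
          mul_meas_ge_le_integral_of_nonneg (Eventually.of_forall fun x => by positivity) hF _
      _ ≤ (3 + 3 * (8 * k) ^ (2 * k)) * (2 * t * S ^ (2 * k)) := by
          refine (integral_norm_cauchyInt_pow_le (measurable_lowerPart f t) (lowerPart_nonneg f t)
            (lowerPart_le f t) hrIco hk).trans ?_
          gcongr
          exact integral_lowerPart_pow_le ht hS0 (by omega) hρ hS
      _ = 4 * (3 + 3 * (8 * k) ^ (2 * k)) * S ^ (2 * k) * (t / 2) := by ring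
      _ ≤ lam ^ (2 * k) * (t / 2) := by gcongr
  refine (measure_mono (t := {x | lam ^ (2 * k) ≤ F x})
    fun x hx => pow_le_pow_left₀ hlam.le (le_of_lt hx) _).trans ?_
  rw [← ofReal_measureReal]
  exact ENNReal.ofReal_le_ofReal (le_of_mul_le_mul_left hmarkov (by positivity))

omit ht hS0 hlam in
lemma cauchyInt_norm_eq (hf : Integrable f m) (x : Torus) :
    cauchyInt (fun y => ((‖f y‖ : ℝ) : ℂ)) (r * fourier 1 x) =
      cauchyInt (fun y => (upperPart f t y : ℂ)) (r * fourier 1 x) +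
        cauchyInt (fun y => (lowerPart f t y : ℂ)) (r * fourier 1 x) := by
  have hupper : Integrable (fun y => (upperPart f t y : ℂ)) m := (integrable_upperPart t hf).ofReal
  have hlower : Integrable (fun y => (lowerPart f t y : ℂ)) m := (integrable_lowerPart f t).ofReal
  rw [← cauchyInt_add hupper hlower (norm_mul_fourier_lt_one hr x)]
  simp only [← Complex.ofReal_add, upperPart_add_lowerPart]

lemma rearr_le_of_calderon_le (hf : Integrable f m) {k : ℕ} (hk : k ≠ 0) {ρ : ℝ≥0}
    (hρ : ρ ^ (2 * k) = 2) (hlow : calderonLow f t ≤ ENNReal.ofReal S)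
    (hhigh : calderonHigh ρ f t ≤ ENNReal.ofReal S) (hle8 : 8 * S ≤ lam)
    (hle : 4 * (3 + 3 * (8 * k) ^ (2 * k)) * S ^ (2 * k) ≤ lam ^ (2 * k)) {g : L0}
    (hg : ∀ᵐ x ∂m, g x = cauchyInt (fun y => ((‖f y‖ : ℝ) : ℂ)) (r * fourier 1 x)) :
    rearr g t ≤ 2 * lam := by
  refine rearr_le (by positivity) ?_
  calc distribution g (2 * lam)
      ≤ m ({x : Torus | lam < ‖cauchyInt (fun y => (upperPart f t y : ℂ)) (r * fourier 1 x)‖} ∪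
          {x : Torus | lam < ‖cauchyInt (fun y => (lowerPart f t y : ℂ)) (r * fourier 1 x)‖}) := by
        refine measure_mono_ae ?_
        filter_upwards [hg] with x hx
        intro (hlt : 2 * lam < ‖g x‖)
        rw [hx, cauchyInt_norm_eq (t := t) hr hf] at hlt
        rw [two_mul] at hlt
        exact lt_or_lt_of_add_lt_add (hlt.trans_le (norm_add_le _ _))
    _ ≤ ENNReal.ofReal (t / 2) + ENNReal.ofReal (t / 2) :=
        (measure_union_le _ _).trans (add_le_add
          (measure_lt_norm_cauchyInt_upperPart_le ht hS0 hr hlam hf hlow hle8)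
          (measure_lt_norm_cauchyInt_lowerPart_le ht hS0 hr hlam hk hρ hhigh hle))
    _ = ENNReal.ofReal t := by
        rw [← ENNReal.ofReal_add (by positivity) (by positivity), add_halves]

end CalderonEstimate

theorem exists_rearr_cauchyInt_le {k : ℕ} (hk : k ≠ 0) : ∃ A : ℝ≥0,
    ∀ (ρ : ℝ≥0), ρ ^ (2 * k) = 2 → ∀ f : L0, Integrable f m → ∀ r ∈ Set.Ioo (0 : ℝ) 1,
      ∀ g : L0, (∀ᵐ x ∂m, g x = cauchyInt (fun y => ((‖f y‖ : ℝ) : ℂ)) (r * fourier 1 x)) →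
      ∀ t : ℝ, 0 < t → ENNReal.ofReal (rearr g t) ≤
        A * (calderonLow f t + calderonHigh ρ f t) := by
  let B : ℝ≥0 := 8 + 4 * (3 + 3 * (8 * k) ^ (2 * k))
  have hB8 : (8 : ℝ) ≤ B := by
    have hnonneg : (0 : ℝ) ≤ 4 * (3 + 3 * (8 * k) ^ (2 * k)) := by positivity
    simpa [B] using hnonneg
  have hB : 4 * (3 + 3 * (8 * k) ^ (2 * k)) ≤ (B : ℝ) ^ (2 * k) := by
    refine le_trans ?_ (le_self_pow₀ (by linarith) (by omega))
    simp [B]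
  refine ⟨2 * B, fun ρ hρ f hf r hr g hg t ht => ?_⟩
  rcases eq_or_ne (calderonLow f t + calderonHigh ρ f t) ∞ with htop | htop
  · rw [htop, ENNReal.mul_top (by simp [B])]
    exact le_top
  · lift calderonLow f t + calderonHigh ρ f t to ℝ≥0 using htop with S hS
    have hrearr : rearr g t ≤ 2 * (B * S) := by
      refine le_of_forall_pos_le_add fun ε hε => ?_
      have hlow : calderonLow f t ≤ ENNReal.ofReal S := by
        rw [ENNReal.ofReal_coe_nnreal, hS]
        exact le_self_add
      have hhigh : calderonHigh ρ f t ≤ ENNReal.ofReal S := by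
        rw [ENNReal.ofReal_coe_nnreal, hS]
        exact le_add_self
      have hle : (B : ℝ) * S ≤ B * S + ε / 2 := by linarith
      have hle8 : 8 * (S : ℝ) ≤ B * S + ε / 2 :=
        (mul_le_mul_of_nonneg_right hB8 S.coe_nonneg).trans hle
      refine (rearr_le_of_calderon_le (lam := B * S + ε / 2) ht S.coe_nonneg hr (by positivity) hf
        hk hρ hlow hhigh hle8 ?_ hg).trans_eq (by ring)
      calc 4 * (3 + 3 * (8 * k) ^ (2 * k)) * (S : ℝ) ^ (2 * k)
          ≤ (B : ℝ) ^ (2 * k) * (S : ℝ) ^ (2 * k) := by gcongr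
        _ = (B * S : ℝ) ^ (2 * k) := (mul_pow _ _ _).symm
        _ ≤ (B * S + ε / 2) ^ (2 * k) := by gcongr
    refine (ENNReal.ofReal_le_ofReal hrearr).trans_eq ?_
    rw [← ENNReal.coe_mul, ← ENNReal.ofReal_coe_nnreal]
    push_cast
    rw [mul_assoc]

lemma enorm_complex_ofReal {a : ℝ} (ha : 0 ≤ a) : ‖(a : ℂ)‖ₑ = ENNReal.ofReal a := by
  rw [← ofReal_norm, Complex.norm_real, Real.norm_of_nonneg ha]

lemma enorm_complex_coe_nnreal (c : ℝ≥0) : ‖((c : ℝ) : ℂ)‖ₑ = c := by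
  rw [enorm_complex_ofReal c.coe_nonneg, ENNReal.ofReal_coe_nnreal]

lemma tsum_pow_mul_le {K b c : ℝ≥0} (hcb : c * b < 1) {a : ℕ → ℝ≥0∞} {N : ℝ≥0∞}
    (ha : ∀ k, a k ≤ K * b ^ k * N) :
    ∑' k, ((c ^ k : ℝ≥0) : ℝ≥0∞) * a k ≤ (K * (1 - c * b)⁻¹ : ℝ≥0) * N := by
  calc ∑' k, ((c ^ k : ℝ≥0) : ℝ≥0∞) * a k
      ≤ ∑' k, K * ((c * b : ℝ≥0) : ℝ≥0∞) ^ k * N := by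
        refine ENNReal.tsum_le_tsum fun k => (mul_le_mul_right (ha k) _).trans_eq ?_
        push_cast
        rw [mul_pow]
        ring
    _ = (K * (1 - c * b)⁻¹ : ℝ≥0) * N := by
        rw [ENNReal.tsum_mul_right, ENNReal.tsum_mul_left, ENNReal.tsum_geometric,
          ENNReal.coe_mul K, ENNReal.coe_inv (tsub_pos_of_lt hcb).ne', ENNReal.coe_sub,
          ENNReal.coe_one]

namespace BanachFunctionSpace

variable {Y : BanachFunctionSpace} {K θ τ : ℝ≥0}

lemma exists_dominating_rdil (f : L0) (c : ℕ → ℝ≥0) (a : ℕ → ℝ)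
    (hsum : ∑' k, (c k : ℝ≥0∞) * Y.N (rdil f (a k)) ≠ ∞) :
    ∃ G : L0, Y.N G ≤ ∑' k, (c k : ℝ≥0∞) * Y.N (rdil f (a k)) ∧ ∀ᵐ x ∂m,
      ∑' k, (c k : ℝ≥0∞) * ENNReal.ofReal (rearr f (a k * (arg x / (2 * π)))) ≤ ‖G x‖ₑ := by
  let u (k : ℕ) : L0 := ((c k : ℝ) : ℂ) • rdil f (a k)
  have hu (k : ℕ) : Y.N (u k) = c k * Y.N (rdil f (a k)) := by
    rw [Y.norm_smul, enorm_complex_coe_nnreal]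
  simp only [← hu] at hsum ⊢
  obtain ⟨G, hGN, hG⟩ := Y.exists_dominating hsum
  refine ⟨G, hGN, ?_⟩
  filter_upwards [hG, ae_all_iff.2 fun k => rdil_ae f (a k),
    ae_all_iff.2 fun k => AEEqFun.coeFn_smul ((c k : ℝ) : ℂ) (rdil f (a k))] with x hGx hrdil hsmul
  have hterm (k : ℕ) : (c k : ℝ≥0∞) * ENNReal.ofReal (rearr f (a k * (arg x / (2 * π)))) =
      ENNReal.ofReal ‖u k x‖ := by
    rw [hsmul k, Pi.smul_apply, hrdil k, ofReal_norm, enorm_smul, enorm_complex_coe_nnreal,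
      enorm_complex_ofReal (rearr_nonneg _ _), mul_div_assoc]
  simp only [hterm]
  rw [ENNReal.tsum_eq_iSup_nat, ← ofReal_norm]
  refine iSup_le fun n => ?_
  rw [← ENNReal.ofReal_sum_of_nonneg fun _ _ => norm_nonneg _]
  exact ENNReal.ofReal_le_ofReal (hGx n)

theorem exists_dominating_calderon (hD : Y.HasDilationBounds K θ τ) (hτ : τ < 2) {ρ : ℝ≥0}
    (hρθ : ρ * θ < 1) : ∃ M : ℝ≥0, ∀ f : L0, Y.N f < ∞ → ∃ G : L0, Y.N G ≤ M * Y.N f ∧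
      ∀ᵐ x ∂m, calderonLow f (arg x / (2 * π)) + calderonHigh ρ f (arg x / (2 * π)) ≤ ‖G x‖ₑ := by
  have hτ' : 2⁻¹ * τ < 1 := (inv_mul_lt_one₀ two_pos).2 hτ
  refine ⟨K * (1 - 2⁻¹ * τ)⁻¹ + K * (1 - ρ * θ)⁻¹, fun f hf => ?_⟩
  have hlow := tsum_pow_mul_le hτ' fun k => (hD f hf k).2
  have hhigh := tsum_pow_mul_le hρθ fun k => (hD f hf k).1
  obtain ⟨G, hGN, hG⟩ := exists_dominating_rdil f _ _
    (hlow.trans_lt (ENNReal.mul_lt_top ENNReal.coe_lt_top hf)).ne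
  obtain ⟨H, hHN, hH⟩ := exists_dominating_rdil f _ _
    (hhigh.trans_lt (ENNReal.mul_lt_top ENNReal.coe_lt_top hf)).ne
  refine ⟨absL0 G + absL0 H, ?_, ?_⟩
  · refine (Y.norm_add_le _ _).trans ?_
    rw [Y.N_absL0, Y.N_absL0, ENNReal.coe_add, add_mul]
    exact add_le_add (hGN.trans hlow) (hHN.trans hhigh)
  · filter_upwards [hG, hH, absL0_ae G, absL0_ae H, AEEqFun.coeFn_add (absL0 G) (absL0 H)]
      with x hGx hHx habsG habsH hadd
    rw [hadd, Pi.add_apply, habsG, habsH, ← Complex.ofReal_add,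
      enorm_complex_ofReal (by positivity), ENNReal.ofReal_add (norm_nonneg _) (norm_nonneg _),
      ofReal_norm, ofReal_norm]
    exact add_le_add hGx hHx

lemma exists_pow_eq_two_mul_lt_one (hθ : θ < 1) :
    ∃ k ≠ 0, ∃ ρ : ℝ≥0, ρ ^ (2 * k) = 2 ∧ ρ * θ < 1 := by
  obtain ⟨k, hk⟩ := exists_pow_lt_of_lt_one (show (0 : ℝ≥0) < 2⁻¹ by positivity)
    (pow_lt_one₀ zero_le hθ two_ne_zero)
  have hk0 : k ≠ 0 := by
    rintro rfl
    rw [pow_zero] at hk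
    exact hk.not_ge (inv_le_one_of_one_le₀ one_le_two)
  have h2k : 2 * k ≠ 0 := mul_ne_zero two_ne_zero hk0
  have hpow : ((2 : ℝ≥0) ^ (((2 * k : ℕ) : ℝ)⁻¹)) ^ (2 * k) = 2 :=
    NNReal.rpow_inv_natCast_pow _ h2k
  refine ⟨k, hk0, 2 ^ (((2 * k : ℕ) : ℝ)⁻¹), hpow, ?_⟩
  rw [← pow_lt_one_iff_of_nonneg zero_le h2k, mul_pow, hpow, pow_mul]
  exact (lt_inv_mul_iff₀ two_pos).1 (by rwa [mul_one])

theorem exists_N_cauchyInt_norm_le (hY : Y.IsRI) (hθ : θ < 1) (hτ : τ < 2)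
    (hD : Y.HasDilationBounds K θ τ) : ∃ M : ℝ≥0, ∀ f : L0, Y.N f < ∞ → Integrable f m →
      ∀ r ∈ Set.Ioo (0 : ℝ) 1, ∀ g : L0,
        (∀ᵐ x ∂m, g x = cauchyInt (fun y => ((‖f y‖ : ℝ) : ℂ)) (r * fourier 1 x)) →
        Y.N g ≤ M * Y.N f := by
  obtain ⟨k, hk, ρ, hρ, hρθ⟩ := exists_pow_eq_two_mul_lt_one hθ
  obtain ⟨A, hA⟩ := exists_rearr_cauchyInt_le hk
  obtain ⟨M, hM⟩ := exists_dominating_calderon hD hτ hρθ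
  refine ⟨A * M, fun f hf hfi r hr g hg => ?_⟩
  obtain ⟨G, hGN, hG⟩ := hM f hf
  have hrdil : Y.N (rdil g 1) ≤ Y.N (((A : ℝ) : ℂ) • G) := by
    refine Y.ideal _ _ ?_
    filter_upwards [rdil_ae g 1, hG, ae_arg_pos, AEEqFun.coeFn_smul ((A : ℝ) : ℂ) G]
      with x hx hGx hpos hsmul
    rw [← enorm_le_iff_norm_le, hx, hsmul, Pi.smul_apply, enorm_smul, enorm_complex_coe_nnreal,
      enorm_complex_ofReal (rearr_nonneg _ _), one_mul]
    exact (hA ρ hρ f hfi r hr g hg _ (div_pos hpos Real.two_pi_pos)).trans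
      (mul_le_mul_right hGx _)
  have hle : Y.N (rdil g 1) ≤ (A * M : ℝ≥0) * Y.N f := by
    rw [Y.norm_smul, enorm_complex_coe_nnreal] at hrdil
    rw [ENNReal.coe_mul, mul_assoc]
    exact hrdil.trans (mul_le_mul_right hGN _)
  rwa [N_eq_of_N_rdil_lt_top hY (hle.trans_lt (ENNReal.mul_lt_top ENNReal.coe_lt_top hf))]

end BanachFunctionSpace

/-! ### Uniform integrability and the Riesz projection on `Y` -/

lemma arg_lt_two_pi (x : Torus) : arg x < 2 * π := by
  have hlt : arg x < 0 + 2 * π := (AddCircle.equivIco (2 * π) 0 x).2.2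
  rwa [zero_add] at hlt

lemma rearr_le_calderonLow (f : L0) (s : ℝ) : ENNReal.ofReal (rearr f s) ≤ calderonLow f s := by
  have hle := ENNReal.le_tsum (f := fun k : ℕ => ((2⁻¹ ^ k : ℝ≥0) : ℝ≥0∞) *
    ENNReal.ofReal (rearr f ((2 ^ k)⁻¹ * s))) 0
  simpa only [calderonLow, pow_zero, inv_one, one_mul, ENNReal.coe_one] using hle

lemma setLIntegral_le_calderonLow (f : L0) {s : ℝ} (hs : 0 < s) {E : Set Torus}
    (hE : MeasurableSet E) (hmE : m E ≤ ENNReal.ofReal s) :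
    ∫⁻ x in E, ‖f x‖ₑ ∂m ≤ ENNReal.ofReal (3 * s) * calderonLow f s := by
  let L : Set Torus := {x | rearr f s < ‖f x‖}
  have hL : MeasurableSet L := measurableSet_lt_norm f _
  have hsmall : ∫⁻ x in E \ L, ‖f x‖ₑ ∂m ≤ ENNReal.ofReal s * calderonLow f s :=
    calc ∫⁻ x in E \ L, ‖f x‖ₑ ∂m
        ≤ ∫⁻ _ in E \ L, ENNReal.ofReal (rearr f s) ∂m := by
          refine setLIntegral_mono' (hE.diff hL) fun x hx => ?_
          rw [← ofReal_norm]
          exact ENNReal.ofReal_le_ofReal (not_lt.1 hx.2)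
      _ = m (E \ L) * ENNReal.ofReal (rearr f s) := by rw [setLIntegral_const, mul_comm]
      _ ≤ ENNReal.ofReal s * calderonLow f s :=
          mul_le_mul' ((measure_mono Set.sdiff_subset).trans hmE) (rearr_le_calderonLow f s)
  calc ∫⁻ x in E, ‖f x‖ₑ ∂m
      = ∫⁻ x in E ∩ L, ‖f x‖ₑ ∂m + ∫⁻ x in E \ L, ‖f x‖ₑ ∂m :=
        (lintegral_inter_add_sdiff (fun x => ‖f x‖ₑ) E hL).symm
    _ ≤ ENNReal.ofReal (2 * s) * calderonLow f s + ENNReal.ofReal s * calderonLow f s :=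
        add_le_add ((lintegral_mono_set Set.inter_subset_right).trans
          (setLIntegral_lt_norm_le_calderonLow f hs)) hsmall
    _ = ENNReal.ofReal (3 * s) * calderonLow f s := by
        rw [← add_mul, ← ENNReal.ofReal_add (by positivity) hs.le]
        congr 2
        ring

lemma tendsto_iInf_add {a : ℕ → ℝ} {l : ℝ} (ha : Tendsto a atTop (𝓝 l))
    (hbdd : BddBelow (Set.range a)) : Tendsto (fun n => ⨅ k, a (n + k)) atTop (𝓝 l) := by
  have hbdd_add (n : ℕ) : BddBelow (Set.range fun k => a (n + k)) :=
    hbdd.mono (Set.range_comp_subset_range (n + ·) a)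
  refine tendsto_order.2 ⟨fun c hc => ?_, fun c hc => ?_⟩
  · obtain ⟨c', hcc', hc'⟩ := exists_between hc
    obtain ⟨n₀, hn₀⟩ := eventually_atTop.1 (ha.eventually (lt_mem_nhds hc'))
    filter_upwards [eventually_ge_atTop n₀] with n hn
    exact hcc'.trans_le (le_ciInf fun k => (hn₀ (n + k) (by omega)).le)
  · filter_upwards [ha.eventually (gt_mem_nhds hc)] with n hn
    exact (ciInf_le (hbdd_add n) 0).trans_lt hn

lemma iInf_add_mono {a : ℕ → ℝ} (hbdd : BddBelow (Set.range a)) :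
    Monotone fun n => ⨅ k, a (n + k) := by
  intro i j hij
  refine le_ciInf fun k => ?_
  have hle := ciInf_le (hbdd.mono (Set.range_comp_subset_range (i + ·) a)) (j - i + k)
  rwa [Function.comp_apply, show i + (j - i + k) = j + k by omega] at hle

lemma exists_increasesTo_absL0 {u : ℕ → L0} {f : L0}
    (hlim : ∀ᵐ x ∂m, Tendsto (fun n => u n x) atTop (𝓝 (f x))) :
    ∃ V : ℕ → L0, (∀ n, ∀ᵐ x ∂m, ‖V n x‖ ≤ ‖u n x‖) ∧ IncreasesTo V (absL0 f) := by
  have hbdd (x : Torus) : BddBelow (Set.range fun n => ‖u n x‖) :=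
    ⟨0, Set.forall_mem_range.2 fun _ => norm_nonneg _⟩
  let V (n : ℕ) : L0 := AEEqFun.mk (fun x => ((⨅ k, ‖u (n + k) x‖ : ℝ) : ℂ))
    (Complex.measurable_ofReal.comp (Measurable.iInf fun k =>
      (u (n + k)).stronglyMeasurable.measurable.norm)).aestronglyMeasurable
  have hV_ae (n : ℕ) : ∀ᵐ x ∂m, V n x = ((⨅ k, ‖u (n + k) x‖ : ℝ) : ℂ) := AEEqFun.coeFn_mk _ _
  have hnonneg (n : ℕ) (x : Torus) : 0 ≤ ⨅ k, ‖u (n + k) x‖ := le_ciInf fun k => norm_nonneg _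
  refine ⟨V, fun n => ?_, ?_⟩
  · filter_upwards [hV_ae n] with x hx
    rw [hx, Complex.norm_real, Real.norm_of_nonneg (hnonneg n x)]
    exact ciInf_le ⟨0, Set.forall_mem_range.2 fun _ => norm_nonneg _⟩ 0
  · filter_upwards [ae_all_iff.2 hV_ae, absL0_ae f, hlim] with x hVx habs hx
    have hmono := iInf_add_mono (hbdd x)
    have htendsto := tendsto_iInf_add hx.norm (hbdd x)
    simp only [hVx, habs, Complex.zero_le_real]
    exact ⟨fun n => hnonneg n x, fun i j hij => Complex.real_le_real.2 (hmono hij),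
      (Complex.continuous_ofReal.tendsto _).comp htendsto⟩

lemma fourierCoeff_eq_zero_of_tendsto {u : ℕ → Torus → ℂ} {g : Torus → ℂ} {n : ℤ}
    (hu : ∀ k, Integrable (u k) m) (hg : Integrable g m)
    (hlim : Tendsto (fun k => eLpNorm (u k - g) 1 m) atTop (𝓝 0))
    (hzero : ∀ k, fourierCoeff (u k) n = 0) : fourierCoeff g n = 0 := by
  have hle (k : ℕ) : ‖fourierCoeff g n‖ₑ ≤ eLpNorm (u k - g) 1 m := by
    have hdiff : fourierCoeff g n = ∫ x, fourier (-n) x * (g x - u k x) ∂m := by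
      simp only [mul_sub]
      rw [integral_sub (integrable_fourier_mul _ hg) (integrable_fourier_mul _ (hu k)),
        show ∫ x, fourier (-n) x * u k x ∂m = 0 from hzero k, sub_zero]
      rfl
    rw [hdiff, eLpNorm_one_eq_lintegral_enorm]
    refine (enorm_integral_le_lintegral_enorm _).trans_eq (lintegral_congr fun x => ?_)
    rw [enorm_mul, ← ofReal_norm (fourier (-n) x : ℂ), norm_fourier_apply, ENNReal.ofReal_one,
      one_mul, Pi.sub_apply, enorm_sub_rev]
  exact enorm_eq_zero.1 (le_antisymm (ge_of_tendsto' hlim hle) zero_le)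

lemma fourierCoeff_cauchyInt_of_neg {h : Torus → ℂ} (hh : Integrable h m) {r : ℝ}
    (hr : r ∈ Set.Ioo (0 : ℝ) 1) {n : ℤ} (hn : n < 0) :
    fourierCoeff (fun x : Torus => cauchyInt h (r * fourier 1 x)) n = 0 := by
  obtain ⟨j, hj⟩ : ∃ j : ℕ, -n = j := ⟨(-n).toNat, by omega⟩
  rw [← integral_fourier_mul_comp (differentiableOn_cauchyInt hh) hr (n := j) (by omega), ← hj]
  rfl

namespace BanachFunctionSpace

variable {Y : BanachFunctionSpace} {K θ τ : ℝ≥0}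

lemma rearr_mul_N_one_le (hD : Y.HasDilationBounds K θ τ) {f : L0} (hf : Y.N f < ∞) (k : ℕ) :
    ENNReal.ofReal (rearr f (2 ^ k)⁻¹) * Y.N (AEEqFun.const Torus (1 : ℂ)) ≤
      K * τ ^ k * Y.N f := by
  refine le_trans ?_ (hD f hf k).2
  rw [← enorm_complex_ofReal (rearr_nonneg _ _), ← Y.norm_smul]
  refine Y.ideal _ _ ?_
  filter_upwards [rdil_ae f (2 ^ k)⁻¹, ae_arg_pos, AEEqFun.coeFn_const (μ := m) Torus (1 : ℂ),
    AEEqFun.coeFn_smul ((rearr f (2 ^ k)⁻¹ : ℝ) : ℂ) (AEEqFun.const Torus (1 : ℂ))]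
    with x hx hpos hone hsmul
  rw [hx, hsmul, Pi.smul_apply, hone, Function.const_apply, smul_eq_mul, mul_one,
    Complex.norm_real, Complex.norm_real, Real.norm_of_nonneg (rearr_nonneg _ _),
    Real.norm_of_nonneg (rearr_nonneg _ _)]
  refine rearr_anti f (by positivity) ?_
  rw [div_le_iff₀ Real.two_pi_pos]
  gcongr
  exact (arg_lt_two_pi x).le

lemma calderonLow_two_pow_inv_le (hτ : τ < 2) (hD : Y.HasDilationBounds K θ τ) {f : L0}
    (hf : Y.N f < ∞) (j : ℕ) :
    calderonLow f (2 ^ j)⁻¹ ≤ (K * (1 - 2⁻¹ * τ)⁻¹ : ℝ≥0) *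
      (τ ^ j * (Y.N f / Y.N (AEEqFun.const Torus (1 : ℂ)))) := by
  refine tsum_pow_mul_le ((inv_mul_lt_one₀ two_pos).2 hτ) fun k => ?_
  rw [← mul_inv, ← pow_add]
  have hle := (ENNReal.le_div_iff_mul_le (Or.inl Y.N_one_ne_zero) (Or.inl Y.N_one_ne_top)).2
    (rearr_mul_N_one_le hD hf (k + j))
  refine hle.trans_eq ?_
  simp only [div_eq_mul_inv, pow_add]
  ring

theorem exists_setLIntegral_le (hτ : τ < 2) (hD : Y.HasDilationBounds K θ τ) :
    ∃ C κ : ℝ≥0, κ < 1 ∧ ∀ f : L0, Y.N f < ∞ → ∀ (j : ℕ) (E : Set Torus), MeasurableSet E →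
      m E ≤ ENNReal.ofReal (2 ^ j)⁻¹ → ∫⁻ x in E, ‖f x‖ₑ ∂m ≤ C * κ ^ j * Y.N f := by
  let B : ℝ≥0 := K * (1 - 2⁻¹ * τ)⁻¹
  have hC : 3 * B / Y.N (AEEqFun.const Torus (1 : ℂ)) ≠ ∞ :=
    ENNReal.div_ne_top (ENNReal.mul_ne_top (by simp) ENNReal.coe_ne_top) Y.N_one_ne_zero
  refine ⟨(3 * B / Y.N (AEEqFun.const Torus (1 : ℂ))).toNNReal, 2⁻¹ * τ,
    (inv_mul_lt_one₀ two_pos).2 hτ, fun f hf j E hE hmE => ?_⟩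
  have hpow : ENNReal.ofReal (3 * (2 ^ j)⁻¹) = 3 * ((2⁻¹ : ℝ≥0) : ℝ≥0∞) ^ j := by
    rw [← inv_pow, ENNReal.ofReal_mul zero_le_three, ENNReal.ofReal_pow (by positivity),
      ENNReal.ofReal_ofNat, ← ENNReal.ofReal_coe_nnreal, NNReal.coe_inv, NNReal.coe_ofNat]
  calc ∫⁻ x in E, ‖f x‖ₑ ∂m
      ≤ ENNReal.ofReal (3 * (2 ^ j)⁻¹) * calderonLow f (2 ^ j)⁻¹ :=
        setLIntegral_le_calderonLow f (by positivity) hE hmE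
    _ ≤ 3 * ((2⁻¹ : ℝ≥0) : ℝ≥0∞) ^ j *
          (B * (τ ^ j * (Y.N f / Y.N (AEEqFun.const Torus (1 : ℂ))))) := by
        rw [hpow]
        gcongr
        exact calderonLow_two_pow_inv_le hτ hD hf j
    _ = _ := by
        rw [ENNReal.coe_toNNReal hC, ENNReal.coe_mul 2⁻¹, mul_pow]
        simp only [div_eq_mul_inv]
        ring

lemma integrable_of_N_lt_top (hτ : τ < 2) (hD : Y.HasDilationBounds K θ τ) {f : L0}
    (hf : Y.N f < ∞) : Integrable f m := by
  obtain ⟨C, κ, -, hle⟩ := exists_setLIntegral_le hτ hD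
  have huniv := hle f hf 0 Set.univ MeasurableSet.univ (by simp)
  rw [Measure.restrict_univ, pow_zero, mul_one] at huniv
  exact ⟨f.aestronglyMeasurable, huniv.trans_lt (ENNReal.mul_lt_top ENNReal.coe_lt_top hf)⟩

theorem unifIntegrable_of_N_le (hτ : τ < 2) (hD : Y.HasDilationBounds K θ τ) {ι : Type*}
    {u : ι → L0} {M : ℝ≥0∞} (hM : M ≠ ∞) (hu : ∀ i, Y.N (u i) ≤ M) :
    UnifIntegrable (fun i => (u i : Torus → ℂ)) 1 m := by
  obtain ⟨C, κ, hκ, hle⟩ := exists_setLIntegral_le hτ hD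
  intro ε hε
  have hlim : Tendsto (fun j : ℕ => (C : ℝ≥0∞) * κ ^ j * M) atTop (𝓝 0) := by
    have hpow : Tendsto (fun j : ℕ => (κ : ℝ≥0∞) ^ j) atTop (𝓝 0) :=
      ENNReal.tendsto_pow_atTop_nhds_zero_of_lt_one (by exact_mod_cast hκ)
    simpa using ENNReal.Tendsto.mul_const (b := M)
      (ENNReal.Tendsto.const_mul (a := (C : ℝ≥0∞)) hpow (Or.inr ENNReal.coe_ne_top)) (Or.inr hM)
  obtain ⟨j, hj⟩ := (hlim.eventually (gt_mem_nhds (ENNReal.ofReal_pos.2 hε))).exists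
  refine ⟨(2 ^ j)⁻¹, by positivity, fun i E hE hmE => ?_⟩
  rw [eLpNorm_one_eq_lintegral_enorm]
  simp only [enorm_indicator_eq_indicator_enorm]
  rw [lintegral_indicator hE]
  calc ∫⁻ x in E, ‖u i x‖ₑ ∂m
      ≤ C * κ ^ j * Y.N (u i) := hle (u i) ((hu i).trans_lt hM.lt_top) j E hE hmE
    _ ≤ C * κ ^ j * M := by
        gcongr
        exact hu i
    _ ≤ ENNReal.ofReal ε := hj.le

theorem N_le_of_tendsto_ae (hF : Y.HasFatou) {u : ℕ → L0} {f : L0} {C : ℝ≥0∞}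
    (hu : ∀ n, Y.N (u n) ≤ C)
    (hlim : ∀ᵐ x ∂m, Tendsto (fun n => u n x) atTop (𝓝 (f x))) : Y.N f ≤ C := by
  rcases eq_or_ne C ∞ with rfl | hC
  · exact le_top
  obtain ⟨V, hV_le, hV_inc⟩ := exists_increasesTo_absL0 hlim
  have hVN (n : ℕ) : Y.N (V n) ≤ C := (Y.ideal _ _ (hV_le n)).trans (hu n)
  have hfatou := (hF V (absL0 f) (fun n => (hVN n).trans_lt hC.lt_top) hV_inc
    ((iSup_le hVN).trans_lt hC.lt_top)).2
  rw [Y.N_absL0] at hfatou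
  exact hfatou.trans_le (iSup_le hVN)

theorem exists_N_cauchyInt_part_le (hY : Y.IsRI) (hθ : θ < 1) (hτ : τ < 2)
    (hD : Y.HasDilationBounds K θ τ) : ∃ M : ℝ≥0, ∀ h : L0, Y.N h < ∞ →
      ∀ r ∈ Set.Ioo (0 : ℝ) 1, ∀ (k : Fin 4) (g : L0),
        (∀ᵐ x ∂m, g x = cauchyInt (fun t => (part k (h t) : ℂ)) (r * fourier 1 x)) →
        Y.N g ≤ M * Y.N h := by
  obtain ⟨M, hM⟩ := exists_N_cauchyInt_norm_le hY hθ hτ hD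
  refine ⟨M, fun h hh r hr k g hg => ?_⟩
  let f : L0 := AEEqFun.mk (fun t => (part k (h t) : ℂ))
    (Complex.continuous_ofReal.comp_aestronglyMeasurable
      ((continuous_part k).comp_aestronglyMeasurable h.aestronglyMeasurable))
  have hf_ae : ∀ᵐ t ∂m, f t = (part k (h t) : ℂ) := AEEqFun.coeFn_mk _ _
  have hf_norm : ∀ᵐ t ∂m, ‖f t‖ = part k (h t) := by
    filter_upwards [hf_ae] with t ht
    rw [ht, Complex.norm_real, Real.norm_of_nonneg (part_nonneg _ _)]
  have hfN : Y.N f ≤ Y.N h :=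
    Y.ideal _ _ (hf_norm.mono fun t ht => ht.trans_le (part_le_norm _ _))
  have hf : Y.N f < ∞ := hfN.trans_lt hh
  have hcongr : (fun t => (part k (h t) : ℂ)) =ᵐ[m] fun t => ((‖f t‖ : ℝ) : ℂ) :=
    hf_norm.mono fun t ht => congrArg _ ht.symm
  refine (hM f hf (integrable_of_N_lt_top hτ hD hf) r hr g ?_).trans (mul_le_mul_right hfN _)
  exact hg.mono fun x hx => hx.trans (cauchyInt_congr hcongr _)

theorem exists_N_cauchyInt_le (hY : Y.IsRI) (hθ : θ < 1) (hτ : τ < 2)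
    (hD : Y.HasDilationBounds K θ τ) : ∃ M : ℝ≥0, ∀ h : L0, Y.N h < ∞ →
      ∀ r ∈ Set.Ioo (0 : ℝ) 1, ∀ g : L0,
        (∀ᵐ x ∂m, g x = cauchyInt h (r * fourier 1 x)) → Y.N g ≤ M * Y.N h := by
  obtain ⟨M, hM⟩ := exists_N_cauchyInt_part_le hY hθ hτ hD
  refine ⟨4 * M, fun h hh r hr g hg => ?_⟩
  have hint := integrable_of_N_lt_top hτ hD hh
  let G (k : Fin 4) : L0 := AEEqFun.mk _ (continuous_cauchyInt_circle
    (integrable_part hint k).ofReal ⟨hr.1.le, hr.2⟩).aestronglyMeasurable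
  have hG_ae (k : Fin 4) : ∀ᵐ x ∂m, G k x =
      cauchyInt (fun t => (part k (h t) : ℂ)) (r * fourier 1 x) := AEEqFun.coeFn_mk _ _
  have hsum : Y.N g = Y.N (∑ k : Fin 4, (Complex.I ^ (k : ℕ)) • G k) := by
    refine Y.N_congr ?_
    filter_upwards [hg, coeFn_sum_ae Finset.univ fun k : Fin 4 => (Complex.I ^ (k : ℕ)) • G k,
      ae_all_iff.2 hG_ae, ae_all_iff.2 fun k : Fin 4 =>
        AEEqFun.coeFn_smul (Complex.I ^ (k : ℕ)) (G k)] with x hgx hsumx hGx hsmul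
    rw [hgx, hsumx, cauchyInt_eq_sum_part hint (norm_mul_fourier_lt_one hr x)]
    exact congrArg _ (Finset.sum_congr rfl fun k _ => by
      rw [hsmul, Pi.smul_apply, hGx, smul_eq_mul])
  have hterm (k : Fin 4) : Y.N ((Complex.I ^ (k : ℕ)) • G k) ≤ M * Y.N h := by
    have hone : ‖Complex.I ^ (k : ℕ)‖ₑ = 1 := by
      rw [← ofReal_norm, norm_pow, Complex.norm_I, one_pow, ENNReal.ofReal_one]
    rw [Y.norm_smul, hone, one_mul]
    exact hM h hh r hr k (G k) (hG_ae k)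
  calc Y.N g ≤ ∑ k : Fin 4, Y.N ((Complex.I ^ (k : ℕ)) • G k) := hsum.trans_le (Y.N_sum_le _ _)
    _ ≤ ∑ _ : Fin 4, M * Y.N h := Finset.sum_le_sum fun k _ => hterm k
    _ = (4 * M : ℝ≥0) * Y.N h := by
        rw [Finset.sum_const, Finset.card_univ, Fintype.card_fin, nsmul_eq_mul, ← mul_assoc,
          ENNReal.coe_mul]
        rfl

theorem exists_N_le_of_isCauchyLimit (hY : Y.IsRI) (hF : Y.HasFatou) (hθ : θ < 1) (hτ : τ < 2)
    (hD : Y.HasDilationBounds K θ τ) : ∃ M : ℝ≥0, ∀ h g : L0, Y.N h < ∞ → IsCauchyLimit h g →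
      Y.N g ≤ M * Y.N h ∧ ∀ n : ℤ, n < 0 → fourierCoeff g n = 0 := by
  obtain ⟨M, hM⟩ := exists_N_cauchyInt_le hY hθ hτ hD
  refine ⟨M, fun h g hh hg => ?_⟩
  have hint := integrable_of_N_lt_top hτ hD hh
  obtain ⟨r, hr, hrlim⟩ := exists_seq_tendsto_one
  let u (k : ℕ) : L0 := AEEqFun.mk _
    (continuous_cauchyInt_circle hint ⟨(hr k).1.le, (hr k).2⟩).aestronglyMeasurable
  have hu_ae (k : ℕ) : ∀ᵐ x ∂m, u k x = cauchyInt h (r k * fourier 1 x) := AEEqFun.coeFn_mk _ _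
  have huN (k : ℕ) : Y.N (u k) ≤ M * Y.N h := hM h hh (r k) (hr k) (u k) (hu_ae k)
  have hulim : ∀ᵐ x ∂m, Tendsto (fun k => u k x) atTop (𝓝 (g x)) := by
    filter_upwards [hg, ae_all_iff.2 hu_ae] with x hx hux
    simp only [hux]
    exact hx.comp hrlim
  have hgN : Y.N g ≤ M * Y.N h := N_le_of_tendsto_ae hF huN hulim
  have hfin : (M : ℝ≥0∞) * Y.N h < ∞ := ENNReal.mul_lt_top ENNReal.coe_lt_top hh
  have hgint : Integrable g m := integrable_of_N_lt_top hτ hD (hgN.trans_lt hfin)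
  refine ⟨hgN, fun n hn => fourierCoeff_eq_zero_of_tendsto
    (fun k => integrable_of_N_lt_top hτ hD ((huN k).trans_lt hfin)) hgint
    (tendsto_Lp_finite_of_tendsto_ae le_rfl ENNReal.one_ne_top
      (fun k => (u k).aestronglyMeasurable) (memLp_one_iff_integrable.2 hgint)
      (unifIntegrable_of_N_le hτ hD hfin.ne huN) hulim) fun k => ?_⟩
  rw [← fourierCoeff_cauchyInt_of_neg hint (hr k) hn]
  exact integral_congr_ae ((hu_ae k).mono fun x hx => by simp only [hx])

end BanachFunctionSpace

/-! ### Outer functions -/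

lemma re_herglotz_le {u : Torus → ℝ} (hu : Integrable u m) {B : ℝ} (hB : ∀ t, u t ≤ B) {r : ℝ}
    (hr : r ∈ Set.Ico (0 : ℝ) 1) (x : Torus) : (herglotz u (r * fourier 1 x)).re ≤ B := by
  have hk : Continuous fun t => circlePoissonKernel r (x - t) :=
    (continuous_circlePoissonKernel hr).comp (continuous_const.sub continuous_id)
  obtain ⟨C, hC⟩ := isCompact_univ.exists_bound_of_continuousOn hk.continuousOn
  have hint : Integrable (fun t => circlePoissonKernel r (x - t) * u t) m :=
    hu.bdd_mul (c := C) hk.aestronglyMeasurable (ae_of_all _ fun t => hC _ (Set.mem_univ t))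
  calc (herglotz u (r * fourier 1 x)).re
      = ∫ t, circlePoissonKernel r (x - t) * u t ∂m := re_herglotz_eq hu hr x
    _ ≤ ∫ t, circlePoissonKernel r (x - t) * B ∂m :=
        integral_mono hint ((integrable_of_continuous hk).mul_const _) fun t =>
          mul_le_mul_of_nonneg_left (hB t) (circlePoissonKernel_nonneg hr _)
    _ = B := by rw [integral_mul_const, integral_circlePoissonKernel_sub hr, one_mul]

lemma exists_ae_tendsto_herglotz {u : Torus → ℝ} (hu : Integrable u m) :
    ∃ G : Torus → ℂ, AEStronglyMeasurable G m ∧ (∀ᵐ x ∂m, (G x).re = u x) ∧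
      ∀ᵐ x ∂m, Tendsto (fun r : ℝ => herglotz u (r * fourier 1 x)) (𝓝[<] 1) (𝓝 (G x)) := by
  have hu_complex : Integrable (fun t => (u t : ℂ)) m := hu.ofReal
  obtain ⟨g, hg⟩ := exists_isCauchyLimit hu_complex
  have hlim : ∀ᵐ x ∂m, Tendsto (fun r : ℝ => herglotz u (r * fourier 1 x)) (𝓝[<] 1)
      (𝓝 (2 * g x - fourierCoeff (fun t => (u t : ℂ)) 0)) :=
    hg.mono fun x hx => (hx.const_mul 2).sub_const _
  refine ⟨_, (g.aestronglyMeasurable.const_mul 2).sub aestronglyMeasurable_const, ?_, hlim⟩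
  filter_upwards [hlim, ae_tendsto_poissonInt hu_complex] with x hx hpoisson
  refine tendsto_nhds_unique ((Complex.continuous_re.tendsto _).comp hx) ?_
  refine ((Complex.continuous_re.tendsto _).comp hpoisson).congr' ?_
  filter_upwards [eventually_mem_Ioo_zero_one] with r hr
  simp only [Function.comp_apply, poissonInt, ← Complex.ofReal_mul]
  rw [re_herglotz_eq hu ⟨hr.1.le, hr.2⟩, integral_complex_ofReal, Complex.ofReal_re]

theorem fourierCoeff_radialLimit_of_neg {Φ : ℂ → ℂ} (hΦ : DifferentiableOn ℂ Φ (Metric.ball 0 1))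
    {B : ℝ} (hB : ∀ r ∈ Set.Ioo (0 : ℝ) 1, ∀ x : Torus, ‖Φ (r * fourier 1 x)‖ ≤ B)
    {F : Torus → ℂ}
    (hF : ∀ᵐ x ∂m, Tendsto (fun r : ℝ => Φ (r * fourier 1 x)) (𝓝[<] 1) (𝓝 (F x))) {n : ℤ}
    (hn : n < 0) : fourierCoeff F n = 0 := by
  obtain ⟨k, hk⟩ : ∃ k : ℕ, -n = k := ⟨(-n).toNat, by omega⟩
  obtain ⟨r, hr, hrlim⟩ := exists_seq_tendsto_one
  have hzero (j : ℕ) : ∫ x : Torus, fourier k x * Φ (r j * fourier 1 x) ∂m = 0 :=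
    integral_fourier_mul_comp hΦ (hr j) (by omega)
  have hconv : Tendsto (fun j => ∫ x : Torus, fourier k x * Φ (r j * fourier 1 x) ∂m) atTop
      (𝓝 (∫ x, fourier k x * F x ∂m)) := by
    refine tendsto_integral_of_dominated_convergence (fun _ => B) (fun j => ?_)
      (integrable_const _) (fun j => ae_of_all _ fun x => ?_) ?_
    · exact ((fourier k).continuous.mul (continuous_comp_mul_fourier hΦ.continuousOn
        ⟨(hr j).1.le, (hr j).2⟩)).aestronglyMeasurable
    · rw [norm_mul, norm_fourier_apply, one_mul]
      exact hB _ (hr j) x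
    · exact hF.mono fun x hx => (hx.comp hrlim).const_mul _
  simp only [hzero] at hconv
  rw [fourierCoeff, hk]
  exact tendsto_nhds_unique hconv tendsto_const_nhds

theorem exists_outer {ψ : Torus → ℝ} (hψ : Measurable ψ) {ε M : ℝ} (hε : 0 < ε)
    (hψε : ∀ t, ε ≤ ψ t) (hψM : ∀ t, ψ t ≤ M) :
    ∃ f : L0, (∀ᵐ t ∂m, ‖f t‖ = ψ t) ∧ ∀ n : ℤ, n < 0 → fourierCoeff f n = 0 := by
  have hpos (t : Torus) : 0 < ψ t := hε.trans_le (hψε t)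
  have hM : 0 < M := (hpos 0).trans_le (hψM 0)
  have hlog_le (t : Torus) : Real.log (ψ t) ≤ Real.log M := Real.log_le_log (hpos t) (hψM t)
  have hlog : Integrable (fun t => Real.log (ψ t)) m :=
    Integrable.of_bound (Real.measurable_log.comp hψ).aestronglyMeasurable
      (max |Real.log ε| |Real.log M|) (ae_of_all _ fun t =>
        abs_le_max_abs_abs (Real.log_le_log hε (hψε t)) (hlog_le t))
  obtain ⟨G, hG_meas, hG_re, hG_lim⟩ := exists_ae_tendsto_herglotz hlog
  let f : L0 := AEEqFun.mk _ (Complex.continuous_exp.comp_aestronglyMeasurable hG_meas)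
  have hf : ∀ᵐ t ∂m, f t = Complex.exp (G t) := AEEqFun.coeFn_mk _ _
  refine ⟨f, ?_, fun n hn => fourierCoeff_radialLimit_of_neg
    (differentiableOn_herglotz hlog).cexp (B := M) (fun r hr x => ?_) ?_ hn⟩
  · filter_upwards [hf, hG_re] with t hft hre
    rw [hft, Complex.norm_exp, hre, Real.exp_log (hpos t)]
  · rw [Complex.norm_exp, ← Real.le_log_iff_exp_le hM]
    exact re_herglotz_le hlog hlog_le ⟨hr.1.le, hr.2⟩ x
  · filter_upwards [hf, hG_lim] with t hft hlim
    rw [hft]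
    exact (Complex.continuous_exp.tendsto _).comp hlim

/-! ### Multipliers -/

section Multipliers

variable {X : BanachFunctionSpace} (Y : BanachFunctionSpace)

namespace BanachFunctionSpace

lemma N_mul_mono {a f g : L0} (hfg : ∀ᵐ t ∂m, ‖f t‖ ≤ ‖g t‖) : Y.N (a * f) ≤ Y.N (a * g) := by
  refine Y.ideal _ _ ?_
  filter_upwards [hfg, AEEqFun.coeFn_mul a f, AEEqFun.coeFn_mul a g] with t ht hf hg
  rw [hf, hg, Pi.mul_apply, Pi.mul_apply, norm_mul, norm_mul]
  gcongr

lemma N_mul_smul (a : L0) (c : ℂ) (f : L0) : Y.N (a * c • f) = ‖c‖ₑ * Y.N (a * f) := by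
  rw [← Y.norm_smul]
  refine Y.N_congr ?_
  filter_upwards [AEEqFun.coeFn_mul a (c • f), AEEqFun.coeFn_smul c f,
    AEEqFun.coeFn_smul c (a * f), AEEqFun.coeFn_mul a f] with t hmul_smul hsmul hsmul_mul hmul
  rw [hmul_smul, Pi.mul_apply, hsmul, hsmul_mul, Pi.smul_apply, Pi.smul_apply, hmul,
    Pi.mul_apply, mul_smul_comm]

lemma N_mul_zero (a : L0) : Y.N (a * 0) = 0 := by
  have hsmul := Y.N_mul_smul a 0 0
  rwa [zero_smul ℂ (0 : L0), enorm_zero, zero_mul] at hsmul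

end BanachFunctionSpace

variable {Y}

lemma N_mul_le_multiplierNorm (a : L0) {f : L0} (hf : X.N f < ∞) :
    Y.N (a * f) ≤ multiplierNorm X Y a * X.N f := by
  rcases eq_or_ne (X.N f) 0 with hzero | hzero
  · rw [X.eq_zero_of_norm_eq_zero f hzero, Y.N_mul_zero]
    exact zero_le
  let c : ℂ := ((((X.N f).toNNReal⁻¹ : ℝ≥0) : ℝ) : ℂ)
  have hc : ‖c‖ₑ = (X.N f)⁻¹ := by
    rw [enorm_complex_coe_nnreal, ENNReal.coe_inv (ENNReal.toNNReal_ne_zero.2 ⟨hzero, hf.ne⟩),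
      ENNReal.coe_toNNReal hf.ne]
  have hunit : X.N (c • f) ≤ 1 := by
    rw [X.norm_smul, hc, ENNReal.inv_mul_cancel hzero hf.ne]
  have hle : Y.N (a * c • f) ≤ multiplierNorm X Y a :=
    le_iSup₂ (f := fun (g : L0) (_ : X.N g ≤ 1) => Y.N (a * g)) (c • f) hunit
  rw [Y.N_mul_smul, hc, mul_comm, ← div_eq_mul_inv] at hle
  exact (ENNReal.div_le_iff hzero hf.ne).1 hle

lemma exists_N_le_pow_lt_N_mul (n : ℕ) {a : L0} (ha : multiplierNorm X Y a = ∞) :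
    ∃ g : L0, X.N g ≤ 2⁻¹ ^ n ∧ 2 ^ n < Y.N (a * g) := by
  have hlt : (4 : ℝ≥0∞) ^ n < multiplierNorm X Y a := by
    rw [ha]
    exact ENNReal.pow_lt_top ENNReal.ofNat_lt_top
  obtain ⟨g, hg⟩ := lt_iSup_iff.1 hlt
  obtain ⟨hunit, hg⟩ := lt_iSup_iff.1 hg
  have hc : ‖((((2⁻¹ ^ n : ℝ≥0) : ℝ) : ℂ))‖ₑ = 2⁻¹ ^ n := by
    rw [enorm_complex_coe_nnreal, ENNReal.coe_pow, ENNReal.coe_inv two_ne_zero, ENNReal.coe_ofNat]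
  refine ⟨((((2⁻¹ ^ n : ℝ≥0) : ℝ) : ℂ)) • g, ?_, ?_⟩
  · rw [X.norm_smul, hc]
    exact mul_le_of_le_one_right' hunit
  · have hpow : (2 : ℝ≥0∞) ^ n = 2⁻¹ ^ n * 4 ^ n := by
      rw [← mul_pow, show (4 : ℝ≥0∞) = 2 * 2 by norm_num, ← mul_assoc,
        ENNReal.inv_mul_cancel two_ne_zero ENNReal.ofNat_ne_top, one_mul]
    rw [Y.N_mul_smul, hc, hpow]
    exact ENNReal.mul_lt_mul_right (by simp) (by simp) hg

theorem multiplierNorm_lt_top {a : L0} (ha : a ∈ multipliers X Y) :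
    multiplierNorm X Y a < ∞ := by
  by_contra hnot
  choose g hgX hgY using fun n => exists_N_le_pow_lt_N_mul n (not_lt_top_iff.1 hnot)
  have hsum : ∑' n, X.N (g n) < ∞ := by
    refine (ENNReal.tsum_le_tsum hgX).trans_lt ?_
    rw [ENNReal.tsum_geometric]
    simp
  obtain ⟨G, hG, hdom⟩ := X.exists_dominating hsum.ne
  have hlow (n : ℕ) : 2 ^ n < Y.N (a * G) := by
    refine (hgY n).trans_le (Y.N_mul_mono ?_)
    filter_upwards [hdom] with t ht
    exact (Finset.single_le_sum (f := fun k => ‖g k t‖) (fun k _ => norm_nonneg _)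
      (Finset.self_mem_range_succ n)).trans (ht (n + 1))
  have haG : Y.N (a * G) < ∞ := ha G (hG.trans_lt hsum)
  obtain ⟨n, hn⟩ := ENNReal.exists_nat_gt haG.ne
  refine absurd (hn.trans_le ?_) (hlow n).not_gt
  exact_mod_cast Nat.lt_two_pow_self.le

end Multipliers

/-! ### Toeplitz operators -/

/-- The character `e^{int}` as an element of `L⁰`, so that it can multiply elements of a
Banach function space. -/
def character (n : ℤ) : L0 := AEEqFun.mk (fourier n) (fourier n).continuous.aestronglyMeasurable

lemma character_mul_ae (n : ℤ) (f : L0) :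
    ∀ᵐ x ∂m, (character n * f) x = fourier n x * f x := by
  have hcharacter : ∀ᵐ x ∂m, character n x = fourier n x := AEEqFun.coeFn_mk _ _
  filter_upwards [AEEqFun.coeFn_mul (character n) f, hcharacter] with x hmul hx
  rw [hmul, Pi.mul_apply, hx]

lemma fourierCoeff_character_mul (n k : ℤ) (f : L0) :
    fourierCoeff (character n * f) k = fourierCoeff f (k - n) := by
  refine integral_congr_ae ((character_mul_ae n f).mono fun x hx => ?_)
  simp only [hx, smul_eq_mul]
  rw [← mul_assoc, ← fourier_add, neg_sub, sub_eq_neg_add]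

section Toeplitz

variable {X Y : BanachFunctionSpace}

lemma BanachFunctionSpace.N_character_mul (n : ℤ) (f : L0) : X.N (character n * f) = X.N f :=
  X.N_congr ((character_mul_ae n f).mono fun x hx => by
    rw [hx, norm_mul, norm_fourier_apply, one_mul])

lemma character_mul_mem_hardy (n : ℕ) {f : L0} (hf : f ∈ X.hardy) :
    character n * f ∈ X.hardy := by
  refine ⟨(X.N_character_mul n f).trans_lt hf.1, fun k hk => ?_⟩
  rw [fourierCoeff_character_mul]
  exact hf.2 _ (by omega)

lemma exists_mem_hardy_min_le_norm {g : L0} (hg : X.N g < ∞) (n : ℕ) {ε : ℝ≥0} (hε : 0 < ε) :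
    ∃ f ∈ X.hardy, (∀ᵐ t ∂m, min ‖g t‖ n ≤ ‖f t‖) ∧
      X.N f ≤ X.N g + ε * X.N (AEEqFun.const Torus (1 : ℂ)) := by
  let one : L0 := AEEqFun.const Torus (1 : ℂ)
  have hmin (t : Torus) : 0 ≤ min ‖g t‖ (n : ℝ) := le_min (norm_nonneg _) n.cast_nonneg
  obtain ⟨f, hf_norm, hf_coeff⟩ := exists_outer (ψ := fun t => min ‖g t‖ n + ε) (M := n + ε)
    ((g.stronglyMeasurable.measurable.norm.min measurable_const).add_const _)
    (NNReal.coe_pos.2 hε) (fun t => le_add_of_nonneg_left (hmin t)) fun t => by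
      gcongr
      exact min_le_right _ _
  have hf_le : X.N f ≤ X.N g + ε * X.N one :=
    calc X.N f ≤ X.N (absL0 g + ((ε : ℝ) : ℂ) • one) := by
          refine X.ideal _ _ ?_
          filter_upwards [hf_norm, AEEqFun.coeFn_add (absL0 g) (((ε : ℝ) : ℂ) • one), absL0_ae g,
            AEEqFun.coeFn_smul ((ε : ℝ) : ℂ) one, AEEqFun.coeFn_const (μ := m) Torus (1 : ℂ)]
            with t hft hadd habs hsmul hone
          rw [hft, hadd, Pi.add_apply, habs, hsmul, Pi.smul_apply, hone, Function.const_apply,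
            smul_eq_mul, mul_one, ← Complex.ofReal_add, Complex.norm_real,
            Real.norm_of_nonneg (by positivity)]
          gcongr
          exact min_le_left _ _
      _ ≤ X.N (absL0 g) + X.N (((ε : ℝ) : ℂ) • one) := X.norm_add_le _ _
      _ = X.N g + ε * X.N one := by rw [X.N_absL0, X.norm_smul, enorm_complex_coe_nnreal]
  refine ⟨f, ⟨hf_le.trans_lt ?_, hf_coeff⟩, ?_, hf_le⟩
  · exact ENNReal.add_lt_top.2 ⟨hg, ENNReal.mul_lt_top ENNReal.coe_lt_top X.N_one_ne_top.lt_top⟩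
  · filter_upwards [hf_norm] with t hft
    rw [hft]
    exact le_add_of_nonneg_right ε.coe_nonneg

lemma le_mul_of_forall_pos_le_mul_add {b C x y : ℝ≥0∞} (hC : C ≠ ∞) (hy : y ≠ ∞)
    (h : ∀ ε : ℝ≥0, 0 < ε → b ≤ C * (x + ε * y)) : b ≤ C * x := by
  have hlim : Tendsto (fun ε : ℝ≥0 => C * (x + ε * y)) (𝓝[>] 0) (𝓝 (C * (x + 0 * y))) :=
    ENNReal.Tendsto.const_mul (Tendsto.const_add _ (ENNReal.Tendsto.mul_const
      ((ENNReal.tendsto_coe.2 tendsto_id).mono_left nhdsWithin_le_nhds) (Or.inr hy))) (Or.inr hC)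
  rw [zero_mul, add_zero] at hlim
  exact ge_of_tendsto hlim (eventually_nhdsWithin_of_forall h)

namespace ToeplitzBoundedBy

variable {a : L0} {C : ℝ≥0∞}

/-- The shifts `z̄ⁿ T_a(zⁿ f)` have norm at most `C * ‖f‖` and converge to `a f` in measure. -/
theorem N_mul_le_of_mem_hardy (hF : Y.HasFatou) (hC : ToeplitzBoundedBy X Y a C) {f : L0}
    (hf : f ∈ X.hardy) : Y.N (a * f) ≤ C * X.N f := by
  choose g _ hproj hgN using fun n : ℕ => hC _ (character_mul_mem_hardy n hf)
  have haf : Integrable (a * f : L0) m := by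
    obtain ⟨_, -, hproj_zero, -⟩ := hC f hf
    exact hproj_zero.1
  have hlim (n : ℕ) : IsCauchyLimit (fun t => fourier n t * (a * f : L0) t) (g n) := by
    have hcongr : ((a * (character n * f) : L0) : Torus → ℂ) =ᵐ[m]
        fun t => fourier n t * (a * f : L0) t := by
      filter_upwards [AEEqFun.coeFn_mul a (character n * f), character_mul_ae n f,
        AEEqFun.coeFn_mul a f] with t hmul hchar haft
      rw [hmul, Pi.mul_apply, hchar, haft, Pi.mul_apply, mul_left_comm]
    filter_upwards [(isRieszProjection_iff.1 (hproj n)).2] with x hx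
    simpa only [cauchyInt_congr hcongr] using hx
  obtain ⟨ns, -, hns⟩ := (tendstoInMeasure_shift haf hlim).exists_seq_tendsto_ae
  refine Y.N_le_of_tendsto_ae hF (u := fun k => character (-(ns k : ℤ)) * g (ns k))
    (fun k => ?_) ?_
  · rw [Y.N_character_mul]
    exact (hgN _).trans_eq (by rw [X.N_character_mul])
  · filter_upwards [hns, ae_all_iff.2 fun k => character_mul_ae (-(ns k : ℤ)) (g (ns k))]
      with x hx hchar
    simpa only [hchar] using hx

lemma N_mul_le_of_norm_le_min (hF : Y.HasFatou) (hC : ToeplitzBoundedBy X Y a C) (hC_top : C ≠ ∞)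
    {g w : L0} (hg : X.N g < ∞) (n : ℕ) (hw : ∀ᵐ t ∂m, ‖w t‖ ≤ min ‖g t‖ n) :
    Y.N (a * w) ≤ C * X.N g := by
  refine le_mul_of_forall_pos_le_mul_add hC_top X.N_one_ne_top fun ε hε => ?_
  obtain ⟨f, hf, hmin, hfN⟩ := exists_mem_hardy_min_le_norm hg n hε
  calc Y.N (a * w) ≤ Y.N (a * f) := Y.N_mul_mono (by
        filter_upwards [hw, hmin] with t hwt hft using hwt.trans hft)
    _ ≤ C * X.N f := hC.N_mul_le_of_mem_hardy hF hf
    _ ≤ C * (X.N g + ε * X.N (AEEqFun.const Torus (1 : ℂ))) := by gcongr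

theorem N_mul_le (hF : Y.HasFatou) (hC : ToeplitzBoundedBy X Y a C) {g : L0} (hg : X.N g < ∞) :
    Y.N (a * g) ≤ C * X.N g := by
  rcases eq_or_ne (X.N g) 0 with hzero | hzero
  · rw [X.eq_zero_of_norm_eq_zero g hzero, Y.N_mul_zero]
    exact zero_le
  rcases eq_or_ne C ∞ with rfl | hC_top
  · exact le_top.trans_eq (ENNReal.top_mul hzero).symm
  let w (n : ℕ) : L0 := AEEqFun.mk (fun t => ((min ‖g t‖ n : ℝ) : ℂ))
    (Complex.measurable_ofReal.comp
      (g.stronglyMeasurable.measurable.norm.min measurable_const)).aestronglyMeasurable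
  have hw_ae (n : ℕ) : ∀ᵐ t ∂m, w n t = ((min ‖g t‖ n : ℝ) : ℂ) := AEEqFun.coeFn_mk _ _
  have hwN (n : ℕ) : Y.N (a * w n) ≤ C * X.N g := by
    refine hC.N_mul_le_of_norm_le_min hF hC_top hg n ?_
    filter_upwards [hw_ae n] with t ht
    rw [ht, Complex.norm_real, Real.norm_of_nonneg (le_min (norm_nonneg _) n.cast_nonneg)]
  have habs : Y.N (a * absL0 g) ≤ C * X.N g := by
    refine Y.N_le_of_tendsto_ae hF hwN ?_
    filter_upwards [ae_all_iff.2 hw_ae, ae_all_iff.2 fun n => AEEqFun.coeFn_mul a (w n),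
      absL0_ae g, AEEqFun.coeFn_mul a (absL0 g)] with t hwt haw habs_t hmul
    rw [hmul, Pi.mul_apply, habs_t]
    refine tendsto_const_nhds.congr' ?_
    filter_upwards [eventually_ge_atTop ⌈‖g t‖⌉₊] with n hn
    rw [haw, Pi.mul_apply, hwt, min_eq_left (Nat.ceil_le.1 hn)]
  refine (Y.N_mul_mono ?_).trans habs
  filter_upwards [absL0_ae g] with t ht
  rw [ht, Complex.norm_real, norm_norm]

end ToeplitzBoundedBy

theorem multiplierNorm_le_toeplitzNorm (hF : Y.HasFatou) (a : L0) :
    multiplierNorm X Y a ≤ toeplitzNorm X Y a :=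
  le_sInf fun _ hC => iSup₂_le fun _ hg =>
    (ToeplitzBoundedBy.N_mul_le hF hC (hg.trans_lt ENNReal.one_lt_top)).trans
      (mul_le_of_le_one_right' hg)

lemma integrable_of_mem_space (hY : Y.IsRI) (hBoyd : Y.HasNontrivialBoydIndices) {f : L0}
    (hf : f ∈ Y.space) : Integrable f m := by
  obtain ⟨K, θ, τ, -, hτ, hD⟩ := BanachFunctionSpace.exists_hasDilationBounds hY hBoyd
  exact BanachFunctionSpace.integrable_of_N_lt_top hτ hD hf

theorem exists_N_le_of_isRieszProjection (hY : Y.IsRI) (hBoyd : Y.HasNontrivialBoydIndices)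
    (hF : Y.HasFatou) : ∃ M : ℝ≥0, ∀ f ∈ Y.space, ∀ g : L0, IsRieszProjection f g →
      Y.N g ≤ M * Y.N f ∧ ∀ n : ℤ, n < 0 → fourierCoeff g n = 0 := by
  obtain ⟨K, θ, τ, hθ, hτ, hD⟩ := BanachFunctionSpace.exists_hasDilationBounds hY hBoyd
  obtain ⟨M, hM⟩ := BanachFunctionSpace.exists_N_le_of_isCauchyLimit hY hF hθ hτ hD
  exact ⟨M, fun f hf g hg => hM f g hf (isRieszProjection_iff.1 hg).2⟩

theorem exists_rieszBoundedBy (hY : Y.IsRI) (hBoyd : Y.HasNontrivialBoydIndices)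
    (hF : Y.HasFatou) : ∃ M : ℝ≥0, RieszBoundedBy Y M := by
  obtain ⟨M, hM⟩ := exists_N_le_of_isRieszProjection hY hBoyd hF
  refine ⟨M, fun f hf => ?_⟩
  have hint := integrable_of_mem_space hY hBoyd hf
  obtain ⟨g, hg⟩ := exists_isCauchyLimit hint
  have hproj : IsRieszProjection f g := isRieszProjection_iff.2 ⟨hint, hg⟩
  have hgN := (hM f hf g hproj).1
  exact ⟨g, hgN.trans_lt (ENNReal.mul_lt_top ENNReal.coe_lt_top hf), hproj, hgN⟩

theorem RieszBoundedBy.toeplitzBoundedBy (hY : Y.IsRI) (hBoyd : Y.HasNontrivialBoydIndices)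
    (hF : Y.HasFatou) {R : ℝ≥0∞} (hR : RieszBoundedBy Y R) {a : L0}
    (ha : a ∈ multipliers X Y) : ToeplitzBoundedBy X Y a (R * multiplierNorm X Y a) := by
  obtain ⟨M, hM⟩ := exists_N_le_of_isRieszProjection hY hBoyd hF
  intro f hf
  have haf := ha f hf.1
  obtain ⟨g, hg, hproj, hgN⟩ := hR _ haf
  refine ⟨g, ⟨hg, (hM _ haf g hproj).2⟩, hproj, ?_⟩
  calc Y.N g ≤ R * Y.N (a * f) := hgN
    _ ≤ R * (multiplierNorm X Y a * X.N f) := by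
        gcongr
        exact N_mul_le_multiplierNorm a hf.1
    _ = R * multiplierNorm X Y a * X.N f := (mul_assoc _ _ _).symm

theorem rieszNorm_lt_top (hY : Y.IsRI) (hBoyd : Y.HasNontrivialBoydIndices)
    (hF : Y.HasFatou) : rieszNorm Y < ∞ := by
  obtain ⟨M, hM⟩ := exists_rieszBoundedBy hY hBoyd hF
  exact (sInf_le hM).trans_lt ENNReal.coe_lt_top

theorem toeplitzBounded_iff (hY : Y.IsRI) (hBoyd : Y.HasNontrivialBoydIndices)
    (hF : Y.HasFatou) (a : L0) : ToeplitzBounded X Y a ↔ a ∈ multipliers X Y := by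
  constructor
  · rintro ⟨C, hC⟩ g hg
    exact (hC.N_mul_le hF hg).trans_lt (ENNReal.mul_lt_top ENNReal.coe_lt_top hg)
  · intro ha
    obtain ⟨M, hM⟩ := exists_rieszBoundedBy hY hBoyd hF
    refine ⟨M * (multiplierNorm X Y a).toNNReal, ?_⟩
    rw [ENNReal.coe_mul, ENNReal.coe_toNNReal (multiplierNorm_lt_top ha).ne]
    exact hM.toeplitzBoundedBy hY hBoyd hF ha

theorem toeplitzNorm_le (hY : Y.IsRI) (hBoyd : Y.HasNontrivialBoydIndices)
    (hF : Y.HasFatou) {a : L0} (ha : a ∈ multipliers X Y) :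
    toeplitzNorm X Y a ≤ rieszNorm Y * multiplierNorm X Y a := by
  obtain ⟨M, hM⟩ := exists_rieszBoundedBy hY hBoyd hF
  rw [rieszNorm, sInf_eq_iInf', ENNReal.iInf_mul' (fun h => absurd h (multiplierNorm_lt_top ha).ne)
    fun _ => ⟨⟨M, hM⟩⟩]
  exact le_iInf fun R => sInf_le (RieszBoundedBy.toeplitzBoundedBy hY hBoyd hF R.2 ha)

end Toeplitz

end ToeplitzRI

end

open ToeplitzRI in
theorem theorem4p3_general (X Y : BanachFunctionSpace) (_hX : ∀ f ∈ X.space, Integrable f m)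
    (hY : Y.IsRI) (hBoyd : Y.HasNontrivialBoydIndices) (hFatou : Y.HasFatou) :
    rieszNorm Y < ∞ ∧ ∀ a : L0,
      (ToeplitzBounded X Y a ↔ a ∈ multipliers X Y) ∧
      (a ∈ multipliers X Y →
        multiplierNorm X Y a ≤ toeplitzNorm X Y a ∧
        toeplitzNorm X Y a ≤ rieszNorm Y * multiplierNorm X Y a) :=
  ⟨rieszNorm_lt_top hY hBoyd hFatou, fun a =>
    ⟨toeplitzBounded_iff hY hBoyd hFatou a, fun ha =>
      ⟨multiplierNorm_le_toeplitzNorm hFatou a, toeplitzNorm_le hY hBoyd hFatou ha⟩⟩⟩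

theorem theorem4p3 (X Y : ToeplitzRI.BanachFunctionSpace) (hX : X.IsRI) (hY : Y.IsRI)
    (hXY : X.space ⊆ Y.space) (hBoyd : Y.HasNontrivialBoydIndices) (hFatou : Y.HasFatou) :
    ToeplitzRI.rieszNorm Y < ⊤ ∧
    ∀ a : ToeplitzRI.L0,
      (ToeplitzRI.ToeplitzBounded X Y a ↔ a ∈ ToeplitzRI.multipliers X Y) ∧
      (a ∈ ToeplitzRI.multipliers X Y →
        ToeplitzRI.multiplierNorm X Y a ≤ ToeplitzRI.toeplitzNorm X Y a ∧
        ToeplitzRI.toeplitzNorm X Y a ≤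
          ToeplitzRI.rieszNorm Y * ToeplitzRI.multiplierNorm X Y a) := by
  exact theorem4p3_general X Y
    (fun _ hf => ToeplitzRI.integrable_of_mem_space hY hBoyd (hXY hf)) hY hBoyd hFatou
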